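/- Let $B$ be a compact integral affine manifold with singularities, with singular locus $\Delta$, and let $\mathscr P$ be a toric polyhedral decomposition of $B$ whose cells have no self-intersections. For $\tau\in\mathscr P$ let $W_\tau$ be the open star of the barycentre of $\tau$ in the barycentric subdivision, $\mathcal W=\{W_\tau\}$, let $\mathcal Q_\tau=\Lambda/\Lambda_\tau$ be the lattice of integral tangent vectors modulo those tangent to $\tau$, and let $S_\tau:W_\tau\to\mathcal Q_\tau\otimes\mathbb R$ be the integral affine submersion contracting $\tau$ that is given by the toric structure, with complete fan $\Sigma_\tau$. Let $\mathcal Q_{\mathscr P}\otimes\mathbb C^\times$ be the sheaf on $B$ with stalk $\mathcal Q_\tau\otimes\mathbb C^\times$ on $\mathrm{Int}(\tau)$, the generization maps being induced by the projections $\mathcal Q_\tau\to\mathcal Q_\sigma$ ($\tau\subset\sigma$) given by parallel transport. A Čech 1-cocycle $\bar s$ of this sheaf on $\mathcal W$ gives, for each $e:\tau\to\sigma$ (that is, $\tau\subset\sigma$), an element $\bar s_e\in\mathcal Q_\sigma\otimes\mathbb C^\times$; write $\bar s_e(m)\in\mathbb C^\times$ for its pairing with $m\in\mathcal Q_\sigma^*$.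 Let $\mathbb L$ be a tropical Lagrangian multi-section over $(B,\mathscr P)$: a branched covering $\pi:(L,\mu)\to B$ with a polyhedral decomposition $\mathscr P'$, each cell of which is mapped homeomorphically onto a cell of $\mathscr P$, admitting a fan structure (a connected cone complex $\Sigma_{\tau'}$ with a branched covering onto $\Sigma_\tau$, $\tau=\pi(\tau')$, and a submersion $S_{\tau'}:W_{\tau'}\to|\Sigma_{\tau'}|$ lying over $S_\tau$) at every cell $\tau'$, together with a global section $\varphi$ of $\mathcal{PL}_{\mathscr P'}/\pi^{-1}\mathcal{A}\mathit{ff}_B$, where affine functions have integral slopes. Here $W_{\tau'}$ is the connected component of $\pi^{-1}(W_\tau)$ containing $\mathrm{Int}(\tau')$, and $\mathcal W'=\{W_{\tau'}\}_{\tau'\in\mathscr P'}$. Let $\{\varphi_{\tau'}\}$ be local representatives of $\varphi$: piecewise linear functions $\varphi_{\tau'}$ on $|\Sigma_{\tau'}|$ such that $S_{\tau'}^*\varphi_{\tau'}$ represents $\varphi|_{W_{\tau'}}$. For a lift $\sigma'\supset\tau'$ of a maximal cell $\sigma\in\mathscr P$, let $m_\tau(\sigma')\in\mathcal Q_\tau^*$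 be the slope of $\varphi_{\tau'}$ on $S_{\tau'}(\sigma')$. For a 1-cocycle $\bar s$ and $\tau_1'\subset\tau_2'\subset\tau_3'\subset\sigma'$, with $\sigma'$ a lift of a maximal cell and $\tau_i=\pi(\tau_i')$, $g_1:\tau_1\to\tau_2$, $g_2:\tau_2\to\tau_3$, $g_3:\tau_1\to\tau_3$, put $$\bar s_{\tau_1\tau_2\tau_3}(\sigma')=\bar s_{g_1}(m_{\tau_2}(\sigma'))\,\bar s_{g_2}(m_{\tau_3}(\sigma'))\,\bar s_{g_3}(m_{\tau_3}(\sigma'))^{-1}\in\mathbb C^\times .$$ Then: 1. $\bar s_{\tau_1\tau_2\tau_3}(\sigma')$ depends only on $\tau_1'\subset\tau_2'\subset\tau_3'$, not on the maximal $\sigma'\supset\tau_3'$; hence it defines a unique Čech 2-cochain $\bar s_{\tau_1'\tau_2'\tau_3'}$ of $\mathbb C^\times$ on the cover $\mathcal W'$. 2. This cochain is closed for the Čech differential. 3. Its class in $H^2(\mathcal W',\mathbb C^\times)$ is independent of the choice of local representatives of $\varphi$. 4. $[\bar s]\mapsto[\bar s_{\tau_1'\tau_2'\tau_3'}]$ is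 a well-defined group homomorphism $$o_{\mathbb L}:H^1(\mathcal W,\mathcal Q_{\mathscr P}\otimes\mathbb C^\times)\to H^2(\mathcal W',\mathbb C^\times),$$ the same for all choices of local representatives. (Cohomology is Čech cohomology of the canonical covers $\mathcal W$ of $B$ and $\mathcal W'$ of $L$.) -/

import Mathlib

open Set Filter Topology
open scoped Matrix TensorProduct

/-! ## Integral linear algebra and branched coverings -/

/-- The real linear map attached to an integral matrix. -/
def intMul {a b : ℕ} (A : Matrix (Fin b) (Fin a) ℤ) (x : Fin a → ℝ) : Fin b → ℝ :=
  A.map (Int.cast : ℤ → ℝ) *ᵥ x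

/-- The pairing of an integral covector with a real vector. -/
def covecEval {k : ℕ} (m : (Fin k → ℤ) →ₗ[ℤ] ℤ) (x : Fin k → ℝ) : ℝ :=
  ∑ i, (m (Pi.single i 1) : ℝ) * x i

/-- The relative interior of a cell with respect to a collection of cells: the complement in the
cell of all strictly smaller cells. -/
def relInt {X : Type*} (cells : Set (Set X)) (σ : Set X) : Set X :=
  σ \ ⋃ τ ∈ {τ | τ ∈ cells ∧ τ ⊂ σ}, τ

/-- The trace `y ↦ ∑ μ(x)`, the sum over the points `x ∈ V` with `π x = y`. -/
noncomputable def fibreTrace {X Y : Type*} (π : X → Y) (μ : X → ℕ) (V : Set X) (y : Y) : ℕ :=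
  ∑ᶠ x ∈ {x | x ∈ V ∧ π x = y}, μ x

/-- Branched coverings with multiplicity map `μ`: finite fibres, and for every connected open `W`
and every connected component `V` of `π⁻¹(W)` the trace of `μ` along `π|_V` is constant on `W`. -/
structure IsBranchedCovering {X Y : Type*} [TopologicalSpace X] [TopologicalSpace Y]
    (π : X → Y) (μ : X → ℕ) : Prop where
  continuous : Continuous π
  surjective : Function.Surjective π
  mult_pos : ∀ x, 0 < μ x
  finite_fibre : ∀ y, (π ⁻¹' {y}).Finite
  trace_const : ∀ W : Set Y, IsOpen W → IsConnected W → ∀ x ∈ π ⁻¹' W, ∀ y ∈ W, ∀ z ∈ W,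
    fibreTrace π μ (connectedComponentIn (π ⁻¹' W) x) y =
      fibreTrace π μ (connectedComponentIn (π ⁻¹' W) x) z

/-! ## Integral affine manifolds with singularities -/

/-- An integral affine structure with singular locus `Δ` on an `n`-manifold `B`: an atlas on the
complement of the closed set `Δ` with transition maps locally in `ℤⁿ ⋊ GLₙ(ℤ)`. That `Δ` has
codimension at least two enters as: `Δ` has dense complement and does not disconnect any
connected open set. -/
structure IntegralAffineManifold (n : ℕ) (B : Type*) [TopologicalSpace B]
    [ChartedSpace (EuclideanSpace ℝ (Fin n)) B] where
  Δ : Set B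
  closed_sing : IsClosed Δ
  dense_reg : Dense Δᶜ
  codim_two : ∀ U : Set B, IsOpen U → IsPreconnected U → IsPreconnected (U \ Δ)
  charts : Set (OpenPartialHomeomorph B (Fin n → ℝ))
  cover_reg : ⋃ e ∈ charts, e.source = Δᶜ
  transition : ∀ e ∈ charts, ∀ e' ∈ charts, ∀ x ∈ e.source ∩ e'.source,
    ∃ (A : Matrix (Fin n) (Fin n) ℤ) (b : Fin n → ℤ), IsUnit A ∧
      ∀ᶠ y in 𝓝 x, e' y = intMul A (e y) + fun i => (b i : ℝ)

namespace IntegralAffineManifold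

variable {n : ℕ} {B : Type*} [TopologicalSpace B] [ChartedSpace (EuclideanSpace ℝ (Fin n)) B]

/-- `f : B → ℝᵏ` is, near the point `x` of the domain of the chart `e`, affine in the coordinates
`e` with integral linear part `A`. -/
def HasLinearPart {k : ℕ} (f : B → Fin k → ℝ) (e : OpenPartialHomeomorph B (Fin n → ℝ)) (x : B)
    (A : Matrix (Fin k) (Fin n) ℤ) : Prop :=
  ∃ b : Fin k → ℝ, ∀ᶠ y in 𝓝 x, f y = intMul A (e y) + b

/-- The germ of `f` at `x` belongs to the sheaf `𝒜ff_B`: near `x` the function `f` is continuous,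
and on the regular part it is locally affine with integral slope. -/
def AffAt (M : IntegralAffineManifold n B) (x : B) (f : B → ℝ) : Prop :=
  ∃ U : Set B, IsOpen U ∧ x ∈ U ∧ ContinuousOn f U ∧
    ∀ e ∈ M.charts, ∀ y ∈ U ∩ e.source, ∃ (a : Fin n → ℤ) (c : ℝ),
      ∀ᶠ z in 𝓝 y, f z = ∑ i, (a i : ℝ) * e z i + c

end IntegralAffineManifold

/-! ## Polyhedral decompositions of the base -/

/-- The barycentre of a polytope: the average of its vertices. -/
noncomputable def polytopeBary {d : ℕ} (p : Set (Fin d → ℝ)) : Fin d → ℝ :=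
  ((p.extremePoints ℝ).ncard : ℝ)⁻¹ • ∑ᶠ v ∈ p.extremePoints ℝ, v

/-- A finite polyhedral decomposition, without self-intersecting cells, of an integral affine
manifold with singularities. Every cell is the injective image of a full-dimensional polytope. -/
structure PolyhedralDecomposition {n : ℕ} {B : Type*} [TopologicalSpace B]
    [ChartedSpace (EuclideanSpace ℝ (Fin n)) B] (M : IntegralAffineManifold n B) where
  cells : Set (Set B)
  finite_cells : cells.Finite
  cover : ⋃₀ cells = univ
  dim : cells → ℕ
  poly : ∀ σ : cells, Set (Fin (dim σ) → ℝ)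
  isPolytope : ∀ σ, ∃ V : Finset (Fin (dim σ) → ℝ), poly σ = convexHull ℝ (V : Set (Fin (dim σ) → ℝ))
  fullDim : ∀ σ, (interior (poly σ)).Nonempty
  param : ∀ σ : cells, (Fin (dim σ) → ℝ) → B
  param_continuousOn : ∀ σ, ContinuousOn (param σ) (poly σ)
  param_injOn : ∀ σ, InjOn (param σ) (poly σ)
  param_image : ∀ σ, param σ '' poly σ = σ
  -- the cells contained in a cell are exactly the images of the nonempty faces of its polytope
  face_mem : ∀ (σ : cells) (F : Set (Fin (dim σ) → ℝ)), IsExposed ℝ (poly σ) F → F.Nonempty →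
    param σ '' F ∈ cells
  face_of_le : ∀ τ σ : cells, τ ≤ σ →
    ∃ F : Set (Fin (dim σ) → ℝ), IsExposed ℝ (poly σ) F ∧ (τ : Set B) = param σ '' F
  -- the inclusion of a face is integral affine, and the lattice of the face is saturated
  face_affine : ∀ τ σ : cells, τ ≤ σ →
    ∃ (A : Matrix (Fin (dim σ)) (Fin (dim τ)) ℤ) (A' : Matrix (Fin (dim τ)) (Fin (dim σ)) ℤ)
      (b : Fin (dim σ) → ℝ), A' * A = 1 ∧
      ∀ x ∈ poly τ, intMul A x + b ∈ poly σ ∧ param σ (intMul A x + b) = param τ x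
  -- the intersection of two cells is a union of common faces
  inter : ∀ σ σ' : cells, ∀ x ∈ (σ : Set B) ∩ σ', ∃ τ : cells, τ ≤ σ ∧ τ ≤ σ' ∧ x ∈ (τ : Set B)
  pure : ∀ τ : cells, ∃ σ : cells, τ ≤ σ ∧ dim σ = n
  -- vertices and interiors of maximal cells are regular, and maximal cells are integral affine
  vertex_regular : ∀ σ : cells, dim σ = 0 → Disjoint (σ : Set B) M.Δ
  max_regular : ∀ σ : cells, dim σ = n → Disjoint (relInt cells (σ : Set B)) M.Δ
  max_affine : ∀ σ : cells, dim σ = n → ∀ e ∈ M.charts, ∀ x ∈ interior (poly σ),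
    param σ x ∈ e.source →
    ∃ (A : Matrix (Fin n) (Fin (dim σ)) ℤ) (A' : Matrix (Fin (dim σ)) (Fin n) ℤ) (b : Fin n → ℝ),
      A' * A = 1 ∧ A * A' = 1 ∧ ∀ᶠ y in 𝓝 x, e (param σ y) = intMul A y + b

namespace PolyhedralDecomposition

variable {n : ℕ} {B : Type*} [TopologicalSpace B] [ChartedSpace (EuclideanSpace ℝ (Fin n)) B]
  {M : IntegralAffineManifold n B} (P : PolyhedralDecomposition M)

/-- The barycentre of a cell. -/
noncomputable def bary (σ : P.cells) : B := P.param σ (polytopeBary (P.poly σ))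

/-- The open set `W_τ`: the open star of the barycentre of `τ` in the barycentric subdivision.
A point of the open simplex with vertices the barycentres of a chain `c` of cells contained in `σ`
is written in the coordinates of `σ` as `∑ w κ • q κ` with positive weights `w`. -/
def star (τ : P.cells) : Set B :=
  {x | ∃ (σ : P.cells) (c : Finset P.cells) (w : P.cells → ℝ)
      (q : P.cells → Fin (P.dim σ) → ℝ),
    IsChain (· ≤ ·) (c : Set P.cells) ∧ τ ∈ c ∧
    (∀ κ ∈ c, κ ≤ σ ∧ 0 < w κ ∧ q κ ∈ P.poly σ ∧ P.param σ (q κ) = P.bary κ) ∧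
    ∑ κ ∈ c, w κ = 1 ∧ P.param σ (∑ κ ∈ c, w κ • q κ) = x}

/-- The midpoint, in the cell `σ ⊇ τ`, of the barycentres of `τ` and of `σ`. -/
noncomputable def edgePt (τ σ : P.cells) : B :=
  P.param σ ((1 / 2 : ℝ) • Function.invFunOn (P.param σ) (P.poly σ) (P.bary τ) +
    (1 / 2 : ℝ) • polytopeBary (P.poly σ))

end PolyhedralDecomposition

/-- A toric polyhedral decomposition: each `W_τ` carries an integral affine submersion `S_τ` to
`ℝ^{n - dim τ}` (locally, in affine charts, an affine map whose linear part is a surjection of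
lattices) that contracts `τ`. At a regular point `y` of the interior of `τ` the derivative of
`S_τ` has kernel `Λ_τ`, so it identifies `𝒬_τ = Λ_y / Λ_τ` with `ℤ^{n - dim τ}`. -/
structure ToricDecomposition {n : ℕ} {B : Type*} [TopologicalSpace B]
    [ChartedSpace (EuclideanSpace ℝ (Fin n)) B] (M : IntegralAffineManifold n B) extends
    PolyhedralDecomposition M where
  S : ∀ τ : cells, B → Fin (n - dim τ) → ℝ
  S_continuousOn : ∀ τ, ContinuousOn (S τ) (toPolyhedralDecomposition.star τ)
  S_zero : ∀ τ : cells, ∀ x ∈ (τ : Set B) ∩ toPolyhedralDecomposition.star τ, S τ x = 0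
  S_submersion : ∀ τ, ∀ e ∈ M.charts, ∀ x ∈ toPolyhedralDecomposition.star τ ∩ e.source,
    ∃ (A : Matrix (Fin (n - dim τ)) (Fin n) ℤ) (A' : Matrix (Fin n) (Fin (n - dim τ)) ℤ),
      A * A' = 1 ∧ IntegralAffineManifold.HasLinearPart (S τ) e x A

/-! ## Ordered Čech cohomology of a presheaf of abelian groups -/

/-- A presheaf of abelian groups on the subsets of `X`. -/
structure AbPresheaf.{u} (X : Type u) where
  sec : Set X → Type u
  [grp : ∀ U, AddCommGroup (sec U)]
  res : ∀ {U V : Set X}, U ⊆ V → sec V →+ sec U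
  res_refl : ∀ (U : Set X) (s : sec U), res (subset_refl U) s = s
  res_comp : ∀ {U V Z : Set X} (h : U ⊆ V) (h' : V ⊆ Z) (s : sec Z),
    res h (res h' s) = res (h.trans h') s

attribute [instance] AbPresheaf.grp

namespace AbPresheaf

variable {X : Type*} (F : AbPresheaf X) {I : Type*} [PartialOrder I] (W : I → Set X)

/-- Čech `p`-cochains of a family indexed by a partially ordered set such that members with
incomparable indices are disjoint (such as the covers `{W_τ}` and `{W_τ'}`): one section over `W_{τ₀} ∩ ⋯ ∩ W_{τ_p}` for every chain
`τ₀ ≤ ⋯ ≤ τ_p`. -/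
abbrev Cochain (p : ℕ) : Type _ := ∀ c : Fin (p + 1) →o I, F.sec (⋂ i, W (c i))

/-- The `j`-th face of a chain. -/
def chainFace {p : ℕ} (c : Fin (p + 2) →o I) (j : Fin (p + 2)) : Fin (p + 1) →o I :=
  c.comp (Fin.succAboveOrderEmb j).toOrderHom

theorem iInter_subset_chainFace {p : ℕ} (c : Fin (p + 2) →o I) (j : Fin (p + 2)) :
    (⋂ i, W (c i)) ⊆ ⋂ i, W (chainFace c j i) :=
  subset_iInter fun i => iInter_subset (fun k => W (c k)) (j.succAbove i)

/-- The Čech differential. -/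
def cechD (p : ℕ) : F.Cochain W p →+ F.Cochain W (p + 1) where
  toFun s c := ∑ j : Fin (p + 2),
    ((-1 : ℤ) ^ (j : ℕ)) • F.res (iInter_subset_chainFace W c j) (s (chainFace c j))
  map_zero' := by
    funext c
    simp
  map_add' s t := by
    funext c
    simp [Finset.sum_add_distrib]

/-- Čech cocycles of degree `p`. -/
def cocycles (p : ℕ) : AddSubgroup (F.Cochain W p) := (F.cechD W p).ker

/-- Čech coboundaries of degree `p + 1`. -/
def coboundaries (p : ℕ) : AddSubgroup (F.Cochain W (p + 1)) := (F.cechD W p).range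

/-- Čech cohomology `H^{p+1}` of the family `W` with values in `F`. -/
abbrev cechH (p : ℕ) : Type _ :=
  F.cocycles W (p + 1) ⧸ (F.coboundaries W p).addSubgroupOf (F.cocycles W (p + 1))

/-- The cohomology class of a cocycle. -/
def cechClass (p : ℕ) : F.cocycles W (p + 1) →+ F.cechH W p :=
  QuotientAddGroup.mk' _

end AbPresheaf

/-- The group `ℂˣ`, written additively. -/
abbrev CStar : Type := Additive ℂˣ

/-- The constant sheaf `ℂˣ`: locally constant functions. -/
noncomputable def constCStar (X : Type*) [TopologicalSpace X] : AbPresheaf X where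
  sec U := LocallyConstant U CStar
  res h := LocallyConstant.comapAddMonoidHom ⟨inclusion h, continuous_inclusion h⟩
  res_refl _ _ := rfl
  res_comp _ _ _ := rfl

/-! ## The sheaf `𝒬_𝒫 ⊗ ℂˣ` -/

namespace ToricDecomposition

variable {n : ℕ} {B : Type*} [TopologicalSpace B] [ChartedSpace (EuclideanSpace ℝ (Fin n)) B]
  {M : IntegralAffineManifold n B} (P : ToricDecomposition M)

/-- The open set `W_τ`. -/
abbrev W (τ : P.cells) : Set B := P.toPolyhedralDecomposition.star τ

/-- The interior of a cell. -/
abbrev Int (τ : P.cells) : Set B := relInt P.cells (τ : Set B)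

/-- Maximal cells. -/
abbrev IsMaxCell (σ : P.cells) : Prop := P.dim σ = n

/-- The lattice `𝒬_τ = Λ / Λ_τ`, through the identification given by `S_τ`. -/
abbrev Q (τ : P.cells) : Type := Fin (n - P.dim τ) → ℤ

/-- The dual lattice `𝒬_τ^*`. -/
abbrev QDual (τ : P.cells) : Type := P.Q τ →ₗ[ℤ] ℤ

/-- The group `𝒬_τ ⊗ ℂˣ`. -/
abbrev QC (τ : P.cells) : Type := P.Q τ ⊗[ℤ] CStar

/-- `p` is induced on `𝒬_τ → 𝒬_σ` by parallel transport in `W_τ ∩ W_σ`: at every regular point,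
the derivative of `S_σ` is the derivative of `S_τ` followed by `p`. -/
def IsTransport (τ σ : P.cells)
    (p : Matrix (Fin (n - P.dim σ)) (Fin (n - P.dim τ)) ℤ) : Prop :=
  ∀ e ∈ M.charts, ∀ x ∈ P.W τ ∩ P.W σ ∩ e.source, ∀ A A',
    IntegralAffineManifold.HasLinearPart (P.S τ) e x A →
    IntegralAffineManifold.HasLinearPart (P.S σ) e x A' → A' = p * A

open Classical in
/-- The projection `𝒬_τ → 𝒬_σ` for `τ ⊆ σ`, induced by parallel transport (it exists and is
unique; the value `0` is never taken for lack of existence). -/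
noncomputable def trans (τ σ : P.cells) : P.Q τ →ₗ[ℤ] P.Q σ :=
  if h : ∃ p, P.IsTransport τ σ p then Matrix.mulVecLin h.choose else 0

/-- The map `𝒬_τ ⊗ ℂˣ → 𝒬_σ ⊗ ℂˣ` for `τ ⊆ σ`. -/
noncomputable def transC (τ σ : P.cells) : P.QC τ →ₗ[ℤ] P.QC σ :=
  (P.trans τ σ).rTensor CStar

/-- Sections over `U` of the constructible sheaf `𝒬_𝒫 ⊗ ℂˣ`, whose stalk on `Int τ` is
`𝒬_τ ⊗ ℂˣ` and whose generization maps are the projections: families `u_τ(x)`, `x ∈ U ∩ Int τ`,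
such that `u_σ(y)` is the image of `u_τ(x)` for all `y` near `x`. -/
def sections (U : Set B) :
    AddSubgroup (∀ τ : P.cells, ↥(U ∩ P.Int τ) → P.QC τ) where
  carrier := {u | ∀ (τ : P.cells) (x : ↥(U ∩ P.Int τ)), ∀ᶠ y in 𝓝 (x : B),
    ∀ (σ : P.cells) (hy : y ∈ U ∩ P.Int σ), u σ ⟨y, hy⟩ = P.transC τ σ (u τ x)}
  zero_mem' τ x := Eventually.of_forall fun y σ hy => by simp
  add_mem' {u v} hu hv τ x := by
    filter_upwards [hu τ x, hv τ x] with y h1 h2 σ hy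
    simp [h1 σ hy, h2 σ hy]
  neg_mem' {u} hu τ x := by
    filter_upwards [hu τ x] with y h1 σ hy
    simp [h1 σ hy]

/-- The sheaf `𝒬_𝒫 ⊗ ℂˣ` on `B`. -/
def QSheaf : AbPresheaf B where
  sec U := P.sections U
  res {U V} h :=
    { toFun := fun u => ⟨fun τ x => u.1 τ ⟨x.1, h x.2.1, x.2.2⟩, fun τ x => by
        filter_upwards [u.2 τ ⟨x.1, h x.2.1, x.2.2⟩] with y hu σ hy
        exact hu σ ⟨h hy.1, hy.2⟩⟩
      map_zero' := rfl
      map_add' := fun _ _ => rfl }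
  res_refl _ _ := rfl
  res_comp _ _ _ := rfl

/-- The pairing `(𝒬_σ ⊗ ℂˣ) × 𝒬_σ^* → ℂˣ`, `(q ⊗ z, m) ↦ z ^ m(q)`, written additively. -/
noncomputable def pairing {σ : P.cells} (s : P.QC σ) (m : P.QDual σ) : CStar :=
  TensorProduct.lid ℤ CStar (m.rTensor CStar s)

/-- The chain `τ ≤ σ`. -/
def edge {I : Type*} [PartialOrder I] {τ σ : I} (h : τ ≤ σ) : Fin 2 →o I where
  toFun := ![τ, σ]
  monotone' := by
    intro i j hij
    fin_cases i <;> fin_cases j <;> simp_all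

open Classical in
/-- The element `s_e ∈ 𝒬_σ ⊗ ℂˣ` given by a 1-cochain `s` and `e : τ → σ`. The section `s_e` over
`W_τ ∩ W_σ` takes a constant value on `Int σ`; it is read off at the midpoint of the barycentres,
which always lies in `W_τ ∩ W_σ ∩ Int σ`. -/
noncomputable def edgeValue (s : P.QSheaf.Cochain P.W 1) {τ σ : P.cells} (h : τ ≤ σ) : P.QC σ :=
  if hx : P.edgePt τ σ ∈ (⋂ i, P.W (edge h i)) ∩ P.Int σ then
    (s (edge h)).1 σ ⟨P.edgePt τ σ, hx⟩
  else 0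

/-- The cone `K_{τ → σ} = ℝ_{≥ 0} · S_τ(σ)`. -/
def cone (τ σ : P.cells) : Set (Fin (n - P.dim τ) → ℝ) :=
  {y | ∃ r : ℝ, 0 ≤ r ∧ ∃ x ∈ (σ : Set B) ∩ P.W τ, y = r • P.S τ x}

/-- The fan `Σ_τ`. -/
def fan (τ : P.cells) : Set (Set (Fin (n - P.dim τ) → ℝ)) :=
  {K | ∃ σ : P.cells, τ ≤ σ ∧ K = P.cone τ σ}

end ToricDecomposition

/-! ## Coverings of the base and their polyhedral decompositions -/

/-- A branched covering `π : (L, μ) → B` with a polyhedral decomposition `𝒫'`. The cells of `L` are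
compact and `π` maps each of them injectively (hence homeomorphically) onto a cell of `B`. -/
structure PolyhedralCovering {n : ℕ} {B : Type*} [TopologicalSpace B]
    [ChartedSpace (EuclideanSpace ℝ (Fin n)) B] {M : IntegralAffineManifold n B}
    (P : ToricDecomposition M) (L : Type*) [TopologicalSpace L] where
  proj : L → B
  mult : L → ℕ
  branched : IsBranchedCovering proj mult
  cells : Set (Set L)
  locallyFinite : LocallyFinite fun σ : cells => (σ : Set L)
  cover : ⋃₀ cells = univ
  compact_cell : ∀ σ : cells, IsCompact (σ : Set L)
  inter_mem : ∀ σ τ : cells, ((σ : Set L) ∩ τ).Nonempty → (σ : Set L) ∩ τ ∈ cells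
  image_mem : ∀ σ : cells, proj '' σ ∈ P.cells
  injOn : ∀ σ : cells, InjOn proj (σ : Set L)
  image_relInt : ∀ σ : cells, proj '' relInt cells (σ : Set L) = relInt P.cells (proj '' σ)
  mult_const : ∀ σ : cells, ∀ x ∈ relInt cells (σ : Set L), ∀ y ∈ relInt cells (σ : Set L),
    mult x = mult y

namespace PolyhedralCovering

variable {n : ℕ} {B : Type*} [TopologicalSpace B] [ChartedSpace (EuclideanSpace ℝ (Fin n)) B]
  {M : IntegralAffineManifold n B} {P : ToricDecomposition M}
  {L : Type*} [TopologicalSpace L] (C : PolyhedralCovering P L)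

/-- The cell `π(τ')`. -/
def img (τ : C.cells) : P.cells := ⟨C.proj '' τ, C.image_mem τ⟩

theorem img_mono {τ σ : C.cells} (h : τ ≤ σ) : C.img τ ≤ C.img σ :=
  image_mono (f := C.proj) h

/-- The interior of a cell. -/
abbrev Int (τ : C.cells) : Set L := relInt C.cells (τ : Set L)

/-- Maximal cells: the lifts of the maximal cells of `B`. -/
abbrev IsMaxCell (σ : C.cells) : Prop := P.IsMaxCell (C.img σ)

/-- The set `W_{τ'}`: the connected component of `π⁻¹(W_τ)` that contains `Int τ'`. -/
def W (τ : C.cells) : Set L :=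
  ⋃ x ∈ C.Int τ, connectedComponentIn (C.proj ⁻¹' P.W (C.img τ)) x

/-- The germ of `f` at `x` belongs to the pull-back `𝒜ff_L = π⁻¹ 𝒜ff_B`. -/
def AffAt (x : L) (f : L → ℝ) : Prop :=
  ∃ g : B → ℝ, M.AffAt (C.proj x) g ∧ ∀ᶠ y in 𝓝 x, f y = g (C.proj y)

/-- The germ of `f` at `x` belongs to `𝒫ℒ_{𝒫'}`: near `x` the function `f` is continuous, and near
each point of the interior of a cell `τ'` it agrees on that interior with an affine function. -/
def PLAt (x : L) (f : L → ℝ) : Prop :=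
  ∃ U : Set L, IsOpen U ∧ x ∈ U ∧ ContinuousOn f U ∧
    ∀ τ : C.cells, ∀ y ∈ U ∩ C.Int τ, ∃ g : B → ℝ, M.AffAt (C.proj y) g ∧
      ∀ᶠ z in 𝓝[C.Int τ] y, f z = g (C.proj z)

/-- A global section of the quotient sheaf `ℳ𝒫ℒ_{𝒫'} = 𝒫ℒ_{𝒫'} / 𝒜ff_L`: a piecewise linear germ
at every point, such that the germ at `x` also represents, modulo affine functions, the germs at
all points near `x`. -/
structure MPLSection where
  germ : L → L → ℝ
  isPL : ∀ x, C.PLAt x (germ x)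
  compat : ∀ x, ∀ᶠ y in 𝓝 x, C.AffAt y (fun z => germ x z - germ y z)

/-- `f` represents the section `φ` on `V`. -/
def Represents (φ : C.MPLSection) (V : Set L) (f : L → ℝ) : Prop :=
  ∀ x ∈ V, C.AffAt x (fun z => f z - φ.germ x z)

end PolyhedralCovering

/-- A connected cone complex with a branched covering map onto a complete fan `Fan` in `ℝᵏ`. -/
structure ConeComplexOver {k : ℕ} (Fan : Set (Set (Fin k → ℝ))) where
  carrier : Type
  [top : TopologicalSpace carrier]
  [t2 : T2Space carrier]
  [conn : ConnectedSpace carrier]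
  proj : carrier → Fin k → ℝ
  mult : carrier → ℕ
  branched : IsBranchedCovering proj mult
  cones : Set (Set carrier)
  finite_cones : cones.Finite
  cover : ⋃₀ cones = univ
  closedEmbedding : ∀ κ : cones, IsClosedEmbedding ((κ : Set carrier).domRestrict proj)
  closed_cone : ∀ κ : cones, IsClosed (κ : Set carrier)
  image_mem : ∀ κ : cones, proj '' κ ∈ Fan
  face_mem : ∀ κ : cones, ∀ K ∈ Fan, K ⊆ proj '' κ → (κ : Set carrier) ∩ proj ⁻¹' K ∈ cones
  inter : ∀ κ κ' : cones, ∀ x ∈ (κ : Set carrier) ∩ κ', ∃ ν : cones, ν ≤ κ ∧ ν ≤ κ' ∧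
    x ∈ (ν : Set carrier)

attribute [instance] ConeComplexOver.top ConeComplexOver.t2 ConeComplexOver.conn

namespace ConeComplexOver

variable {k : ℕ} {Fan : Set (Set (Fin k → ℝ))} (X : ConeComplexOver Fan)

/-- The germ of `h` at `s` is piecewise linear: continuous, and affine with integral slope on each
cone through `s`. -/
def PLAt (s : X.carrier) (h : X.carrier → ℝ) : Prop :=
  (∃ U : Set X.carrier, IsOpen U ∧ s ∈ U ∧ ContinuousOn h U) ∧
    ∀ κ ∈ X.cones, s ∈ κ → ∃ (m : (Fin k → ℤ) →ₗ[ℤ] ℤ) (c : ℝ),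
      ∀ᶠ t in 𝓝[κ] s, h t = covecEval m (X.proj t) + c

/-- `h` is piecewise linear on the whole cone complex. -/
def IsPL (h : X.carrier → ℝ) : Prop :=
  Continuous h ∧ ∀ κ ∈ X.cones, ∃ (m : (Fin k → ℤ) →ₗ[ℤ] ℤ) (c : ℝ),
    ∀ t ∈ κ, h t = covecEval m (X.proj t) + c

end ConeComplexOver

namespace PolyhedralCovering

variable {n : ℕ} {B : Type*} [TopologicalSpace B] [ChartedSpace (EuclideanSpace ℝ (Fin n)) B]
  {M : IntegralAffineManifold n B} {P : ToricDecomposition M}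
  {L : Type*} [TopologicalSpace L] (C : PolyhedralCovering P L)

/-- A fan structure along the cell `τ'`: a connected cone complex `π_{τ'} : Σ_{τ'} → Σ_τ` and a
submersion `S_{τ'} : W_{τ'} → |Σ_{τ'}|` over `S_τ`, mapping every cell `σ' ⊇ τ'` into a cone over
`K_{τ → σ}`. Submersion means that, modulo affine functions, every piecewise linear germ on
`W_{τ'}` is the pull-back of a piecewise linear germ on `|Σ_{τ'}|`. -/
structure FanStructure (τ : C.cells) where
  X : ConeComplexOver (P.fan (C.img τ))
  S : L → X.carrier
  S_continuousOn : ContinuousOn S (C.W τ)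
  S_over : ∀ x ∈ C.W τ, X.proj (S x) = P.S (C.img τ) (C.proj x)
  S_cell : ∀ σ : C.cells, τ ≤ σ → ∃ κ ∈ X.cones,
    X.proj '' κ = P.cone (C.img τ) (C.img σ) ∧ ∀ x ∈ (σ : Set L) ∩ C.W τ, S x ∈ κ
  submersion : ∀ x ∈ C.W τ, ∀ f : L → ℝ, C.PLAt x f →
    ∃ h : X.carrier → ℝ, X.PLAt (S x) h ∧ C.AffAt x (fun z => f z - h (S z))

end PolyhedralCovering

/-- A tropical Lagrangian multi-section: a toric branched covering with a polyhedral decomposition,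
and a global section of `ℳ𝒫ℒ_{𝒫'}`. -/
structure TropicalLagrangianMultisection {n : ℕ} {B : Type*} [TopologicalSpace B]
    [ChartedSpace (EuclideanSpace ℝ (Fin n)) B] {M : IntegralAffineManifold n B}
    (P : ToricDecomposition M) (L : Type*) [TopologicalSpace L] extends
    PolyhedralCovering P L where
  toric : ∀ τ, Nonempty (toPolyhedralCovering.FanStructure τ)
  φ : toPolyhedralCovering.MPLSection

namespace TropicalLagrangianMultisection

variable {n : ℕ} {B : Type*} [TopologicalSpace B] [ChartedSpace (EuclideanSpace ℝ (Fin n)) B]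
  {M : IntegralAffineManifold n B} {P : ToricDecomposition M}
  {L : Type*} [TopologicalSpace L] (T : TropicalLagrangianMultisection P L)

/-- A choice of local representatives of `φ`: for every cell `τ'` a fan structure and a piecewise
linear function `φ_{τ'}` on `|Σ_{τ'}|` such that `S_{τ'}^* φ_{τ'}` represents `φ` on `W_{τ'}`. -/
structure LocalRep where
  fan : ∀ τ : T.cells, T.toPolyhedralCovering.FanStructure τ
  fn : ∀ τ : T.cells, (fan τ).X.carrier → ℝ
  isPL : ∀ τ, (fan τ).X.IsPL (fn τ)
  represents : ∀ τ, T.Represents T.φ (T.W τ) (fun x => fn τ ((fan τ).S x))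

namespace LocalRep

variable {T} (R : T.LocalRep)

/-- `m ∈ 𝒬_τ^*` is a slope of `φ_{τ'}` on `S_{τ'}(σ')`. -/
def IsSlope (τ σ : T.cells) (m : P.QDual (T.img τ)) : Prop :=
  ∃ c : ℝ, ∀ x ∈ (σ : Set L) ∩ T.W τ,
    R.fn τ ((R.fan τ).S x) = covecEval m ((R.fan τ).X.proj ((R.fan τ).S x)) + c

theorem exists_slope {τ σ : T.cells} (h : τ ≤ σ) : ∃ m, R.IsSlope τ σ m := by
  obtain ⟨κ, hκ, -, hS⟩ := (R.fan τ).S_cell σ h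
  obtain ⟨m, c, hm⟩ := (R.isPL τ).2 κ hκ
  exact ⟨m, c, fun x hx => hm _ (hS x hx)⟩

/-- The slope `m_τ(σ') ∈ 𝒬_τ^*` of `φ_{τ'}` on `S_{τ'}(σ')`, for `τ' ⊆ σ'` (it is unique when `σ'`
is maximal). -/
noncomputable def slope {τ σ : T.cells} (h : τ ≤ σ) : P.QDual (T.img τ) :=
  (R.exists_slope h).choose

/-- The element `s_{τ₁τ₂τ₃}(σ') = s_{g₁}(m_{τ₂}(σ')) · s_{g₂}(m_{τ₃}(σ')) · s_{g₃}(m_{τ₃}(σ'))⁻¹`,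
written additively, for lifts `τ₁' ⊆ τ₂' ⊆ τ₃' ⊆ σ'`, where `g₁ : τ₁ → τ₂`, `g₂ : τ₂ → τ₃` and
`g₃ : τ₁ → τ₃`. -/
noncomputable def obs (s : P.QSheaf.Cochain P.W 1) {τ₁ τ₂ τ₃ σ : T.cells}
    (h₁₂ : τ₁ ≤ τ₂) (h₂₃ : τ₂ ≤ τ₃) (h : τ₃ ≤ σ) : CStar :=
  P.pairing (P.edgeValue s (T.img_mono h₁₂)) (R.slope (h₂₃.trans h)) +
    P.pairing (P.edgeValue s (T.img_mono h₂₃)) (R.slope h) -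
    P.pairing (P.edgeValue s (T.img_mono (h₁₂.trans h₂₃))) (R.slope h)

/-- The 2-cochain `c` of `L` is `s_{τ₁τ₂τ₃}(σ')`, for every maximal `σ' ⊇ τ₃'`. -/
def IsObsCochain (s : P.QSheaf.Cochain P.W 1) (c : (constCStar L).Cochain T.W 2) : Prop :=
  ∀ (t : Fin 3 →o T.cells) (σ : T.cells) (h : t 2 ≤ σ), T.IsMaxCell σ →
    c t = LocallyConstant.const _
      (R.obs s (t.monotone (by decide : (0 : Fin 3) ≤ 1)) (t.monotone (by decide : (1 : Fin 3) ≤ 2)) h)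

end LocalRep

end TropicalLagrangianMultisection

/-! ## Convex bodies -/

section Convex

variable {E : Type*} [NormedAddCommGroup E] [NormedSpace ℝ E] {s F : Set E} {x y : E}

/-! Write `ℂˣ` additively. For `τ' ≤ σ' ≤ κ'` with `κ'` maximal put `d(τ',σ') = m_τ(κ') - m_σ(κ') ∘
p`, where `p : 𝒬_τ → 𝒬_σ` is parallel transport. The cocycle relation reads `s_{g₃} = s_{g₂} +
p(s_{g₁})`, so the `s_{g₂}` terms cancel and the value in question is the pairing of `s_{g₁}` with
`d(τ₂',τ₃')` (`obs_eq`). Near a point of `Int σ'` lying in `W_{τ'}`, the representatives attached to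
`τ'` and `σ'` differ by the pull-back of one affine function on `B`, whose slope is `d`. Hence `d`
does not depend on `κ'` (`slope_sub_eq`), which is part 1.

The rest is formal. For fixed `κ'` the cochain is the differential of `(τ',σ') ↦ s_e(m_σ(κ'))`, so
it is closed. For two systems of representatives, `m_σ(κ') - m'_σ(κ')` no longer depends on `κ'`,
and pairing it with `s_e` gives a global 1-cochain that bounds the difference. If `s_e = t_σ -
p(t_τ)`, then `d(τ₁',τ₃') = d(τ₁',τ₂') + d(τ₂',τ₃') ∘ p` shows that pairing `t_τ` with `d(τ',σ')`
gives a bounding 1-cochain. Additivity in `s` is clear from the formula.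

The geometry must supply three inputs. Unique barycentric weights (`HasWeight.unique`) describe open
cells and stars by supports and give segments inside them; this makes the stars open and their
overlaps connected, and lets sections of `𝒬_𝒫 ⊗ ℂˣ` be carried along segments (`section_transport`).
Transport exists and composes (`exists_factor`, `trans_comp`): `S_σ` factors through `S_τ` on one
maximal cell, and the identity spreads over the overlap minus `Δ`, which is connected. Finally `π`
is open (`isOpenMap_proj`), so every cell of `L` lies in a maximal one and identities on open
subsets of `L` descend to `B`. -/

theorem eq_zero_of_max_mem_interior (l : StrongDual ℝ E) (hx : x ∈ interior s)
    (h : ∀ y ∈ s, l y ≤ l x) : l = 0 := by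
  have hm : IsLocalMax l x := by
    filter_upwards [mem_interior_iff_mem_nhds.1 hx] with y hy using h y hy
  exact hm.hasFDerivAt_eq_zero l.hasFDerivAt

theorem IsExposed.eq_of_mem_interior (hF : IsExposed ℝ s F) (hx : x ∈ F) (hi : x ∈ interior s) :
    F = s := by
  obtain ⟨l, rfl⟩ := hF ⟨x, hx⟩
  have := eq_zero_of_max_mem_interior l hi hx.2
  simp [this]

theorem Convex.exists_isExposed (hs : Convex ℝ s) (hne : (interior s).Nonempty) (hx : x ∈ s)
    (hi : x ∉ interior s) : ∃ F, IsExposed ℝ s F ∧ x ∈ F ∧ F ≠ s := by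
  obtain ⟨l, u, hl, h1, h2⟩ := geometric_hahn_banach_of_nonempty_interior hs
    (convex_singleton x) (disjoint_singleton_right.2 hi) hne (singleton_nonempty x)
  have hmax : ∀ y ∈ s, l y ≤ l x := fun y hy => (h1 y hy).trans (h2 x rfl)
  refine ⟨{x ∈ s | ∀ y ∈ s, l y ≤ l x}, fun _ => ⟨l, rfl⟩, ⟨hx, hmax⟩, fun h => ?_⟩
  obtain ⟨z, hz⟩ := hne
  have hz' : z ∈ {x ∈ s | ∀ y ∈ s, l y ≤ l x} := by rw [h]; exact interior_subset hz
  exact hl (eq_zero_of_max_mem_interior l hz hz'.2)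

/-- Every point of a compact set other than the point `b` lies on a segment from
`b` to a boundary point. -/
theorem IsCompact.exists_boundary_point (hc : IsCompact s) {b : E} (hy : y ∈ s) (hyb : y ≠ b) :
    ∃ z ∈ s, z ∉ interior s ∧ ∃ a : ℝ, 0 ≤ a ∧ a < 1 ∧ y = a • b + (1 - a) • z := by
  let g : ℝ → E := fun t => b + t • (y - b)
  have hg : Continuous g := by fun_prop
  -- The point `y` sits at parameter 1 on the ray from `b`. The last parameter `t` at which the ray
  -- meets `s` gives the boundary point, and then `b` has weight `1 - t⁻¹` in `y`.
  let T : Set ℝ := Ici 1 ∩ g ⁻¹' s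
  have hTc : IsClosed T := isClosed_Ici.inter (hc.isClosed.preimage hg)
  have h1 : (1 : ℝ) ∈ T := ⟨mem_Ici.2 le_rfl, by simpa [g] using hy⟩
  have hbd : BddAbove T := by
    obtain ⟨R, hR⟩ := hc.isBounded.exists_norm_le
    have hpos : 0 < ‖y - b‖ := norm_pos_iff.2 (sub_ne_zero.2 hyb)
    refine ⟨(R + ‖b‖) / ‖y - b‖, fun t ht => ?_⟩
    rw [le_div_iff₀ hpos]
    have h2 := hR _ ht.2
    have h3 : ‖t • (y - b)‖ = t * ‖y - b‖ := by
      rw [norm_smul, Real.norm_of_nonneg (zero_le_one.trans ht.1)]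
    have h4 : ‖t • (y - b)‖ ≤ ‖g t‖ + ‖b‖ := by
      have : t • (y - b) = g t - b := by simp [g]
      rw [this]; exact norm_sub_le _ _
    linarith
  set t := sSup T
  have ht : t ∈ T := hTc.csSup_mem ⟨1, h1⟩ hbd
  have ht1 : 1 ≤ t := ht.1
  have ht0 : 0 < t := by linarith
  refine ⟨g t, ht.2, fun hi => ?_, 1 - t⁻¹, ?_, ?_, ?_⟩
  · have : ∀ᶠ r in 𝓝 t, g r ∈ s := hg.continuousAt.eventually (mem_interior_iff_mem_nhds.1 hi)
    obtain ⟨ε, hε, hr⟩ := Metric.eventually_nhds_iff.1 this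
    have h5 : t + ε / 2 ∈ T := ⟨by simp only [mem_Ici]; linarith, hr (by
      rw [Real.dist_eq]; simp only [add_sub_cancel_left]; rw [abs_of_pos] <;> linarith)⟩
    have := le_csSup hbd h5
    linarith
  · have := inv_le_one_of_one_le₀ ht1
    linarith
  · have := inv_pos.2 ht0
    linarith
  · have : (1 - (1 - t⁻¹)) • g t = t⁻¹ • b + (y - b) := by
      simp only [g, sub_sub_cancel, smul_add, smul_smul]
      rw [inv_mul_cancel₀ ht0.ne', one_smul]
    rw [this, sub_smul, one_smul]; abel

end Convex

/-- Otherwise a functional supporting `p` at the average of the vertices takes its maximum at every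
vertex, hence is constant on `p` by Krein–Milman. This is impossible for a nonzero functional on a
set with interior. -/
theorem polytopeBary_mem_interior {d : ℕ} {p : Set (Fin d → ℝ)} (V : Finset (Fin d → ℝ))
    (hp : p = convexHull ℝ (V : Set (Fin d → ℝ))) (hne : (interior p).Nonempty) :
    polytopeBary p ∈ interior p := by
  have hc : IsCompact p := by rw [hp]; exact V.finite_toSet.isCompact_convexHull (𝕜 := ℝ)
  have hconv : Convex ℝ p := by rw [hp]; exact convex_convexHull _ _
  have hfin : (p.extremePoints ℝ).Finite := by
    rw [hp]; exact V.finite_toSet.subset extremePoints_convexHull_subset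
  have hex : (p.extremePoints ℝ).Nonempty :=
    hc.extremePoints_nonempty (hne.mono interior_subset)
  set X := hfin.toFinset
  have hXne : X.Nonempty := by simpa [X] using hex
  have hcard : (0 : ℝ) < X.card := by exact_mod_cast hXne.card_pos
  have hb : polytopeBary p = (X.card : ℝ)⁻¹ • ∑ v ∈ X, v := by
    rw [polytopeBary, finsum_mem_eq_finite_toFinset_sum _ hfin, Set.ncard_eq_toFinset_card _ hfin]
  by_contra hi
  obtain ⟨l, u, hl, h1, h2⟩ := geometric_hahn_banach_of_nonempty_interior hconv
    (convex_singleton _) (disjoint_singleton_right.2 hi) hne (singleton_nonempty _)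
  have hmax : ∀ y ∈ p, l y ≤ l (polytopeBary p) := fun y hy => (h1 y hy).trans (h2 _ rfl)
  set m := l (polytopeBary p)
  have hXp : ∀ v ∈ X, v ∈ p := fun v hv => extremePoints_subset ((hfin.mem_toFinset).1 hv)
  have hsum : ∑ v ∈ X, (m - l v) = 0 := by
    have : m = (X.card : ℝ)⁻¹ * ∑ v ∈ X, l v := by
      simp only [m]; rw [hb, map_smul, map_sum, smul_eq_mul]
    rw [Finset.sum_sub_distrib, Finset.sum_const, nsmul_eq_mul, this]
    field_simp; simp
  have heq : ∀ v ∈ X, l v = m := fun v hv => by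
    have := (Finset.sum_eq_zero_iff_of_nonneg
      (fun v hv => sub_nonneg.2 (hmax v (hXp v hv)))).1 hsum v hv
    linarith
  have hall : p ⊆ {y | l y = m} := by
    rw [← closure_convexHull_extremePoints hc hconv]
    refine closure_minimal (convexHull_min (fun v hv => heq v ((hfin.mem_toFinset).2 hv)) ?_)
      (isClosed_eq l.continuous continuous_const)
    exact convex_hyperplane l.isLinear m
  obtain ⟨z, hz⟩ := hne
  exact hl (eq_zero_of_max_mem_interior l hz fun y hy => by
    rw [hall hy, hall (interior_subset hz)])

/-! ## Cells and their interiors -/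

theorem intMul_eq_mulVecLin {a b : ℕ} (A : Matrix (Fin b) (Fin a) ℤ) (x : Fin a → ℝ) :
    intMul A x = (A.map (Int.cast : ℤ → ℝ)).mulVecLin x := rfl

theorem continuous_intMul {a b : ℕ} (A : Matrix (Fin b) (Fin a) ℤ) : Continuous (intMul A) :=
  (A.map (Int.cast : ℤ → ℝ)).mulVecLin.continuous_of_finiteDimensional

theorem intMul_mul {a b c : ℕ} (A : Matrix (Fin b) (Fin a) ℤ) (A' : Matrix (Fin c) (Fin b) ℤ)
    (x : Fin a → ℝ) : intMul (A' * A) x = intMul A' (intMul A x) := by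
  have : (A' * A).map (Int.cast : ℤ → ℝ) = A'.map Int.cast * A.map Int.cast :=
    Matrix.map_mul (f := Int.castRingHom ℝ)
  exact (congrArg (· *ᵥ x) this).trans (Matrix.mulVec_mulVec _ _ _).symm

theorem intMul_one {a : ℕ} (x : Fin a → ℝ) : intMul (1 : Matrix (Fin a) (Fin a) ℤ) x = x := by
  simp [intMul, Matrix.map_one]

theorem intMul_leftInverse {a b : ℕ} {A : Matrix (Fin b) (Fin a) ℤ}
    {A' : Matrix (Fin a) (Fin b) ℤ} (h : A' * A = 1) (x : Fin a → ℝ) :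
    intMul A' (intMul A x) = x := by rw [← intMul_mul, h, intMul_one]

theorem mem_relInt_iff {X : Type*} {cells : Set (Set X)} {σ : Set X} {x : X} :
    x ∈ relInt cells σ ↔ x ∈ σ ∧ ∀ τ ∈ cells, τ ⊆ σ → x ∈ τ → τ = σ := by
  simp only [relInt, Set.mem_sdiff, mem_iUnion, mem_ofPred_eq, not_exists, exists_prop, and_congr_right_iff]
  refine fun _ => ⟨fun h τ hτ hle hx => ?_, fun h τ hτ => ?_⟩
  · by_contra hne
    exact h τ ⟨⟨hτ, hle.ssubset_of_ne hne⟩, hx⟩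
  · exact hτ.1.2.ne (h τ hτ.1.1 hτ.1.2.1 hτ.2)

namespace PolyhedralDecomposition

variable {n : ℕ} {B : Type*} [TopologicalSpace B] [ChartedSpace (EuclideanSpace ℝ (Fin n)) B]
  {M : IntegralAffineManifold n B} (P : PolyhedralDecomposition M)

noncomputable instance : Fintype P.cells := P.finite_cells.fintype

theorem convex_poly (σ : P.cells) : Convex ℝ (P.poly σ) := by
  obtain ⟨V, hV⟩ := P.isPolytope σ
  rw [hV]; exact convex_convexHull _ _

theorem isCompact_poly (σ : P.cells) : IsCompact (P.poly σ) := by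
  obtain ⟨V, hV⟩ := P.isPolytope σ
  rw [hV]; exact V.finite_toSet.isCompact_convexHull (𝕜 := ℝ)

theorem polytopeBary_mem (σ : P.cells) : polytopeBary (P.poly σ) ∈ interior (P.poly σ) := by
  obtain ⟨V, hV⟩ := P.isPolytope σ
  exact polytopeBary_mem_interior V hV (P.fullDim σ)

theorem param_mem (σ : P.cells) {y : Fin (P.dim σ) → ℝ} (hy : y ∈ P.poly σ) :
    P.param σ y ∈ (σ : Set B) := by
  rw [← P.param_image σ]; exact mem_image_of_mem _ hy

theorem isCompact_cell (σ : P.cells) : IsCompact (σ : Set B) := by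
  rw [← P.param_image σ]
  exact (P.isCompact_poly σ).image_of_continuousOn (P.param_continuousOn σ)

/-- The coordinates, in the cell `σ`, of a point of `B`. -/
noncomputable def coord (σ : P.cells) (x : B) : Fin (P.dim σ) → ℝ :=
  Function.invFunOn (P.param σ) (P.poly σ) x

theorem coord_spec (σ : P.cells) {x : B} (hx : x ∈ (σ : Set B)) :
    P.coord σ x ∈ P.poly σ ∧ P.param σ (P.coord σ x) = x := by
  rw [← P.param_image σ] at hx
  exact ⟨Function.invFunOn_mem hx, Function.invFunOn_eq hx⟩

theorem coord_param (σ : P.cells) {y : Fin (P.dim σ) → ℝ} (hy : y ∈ P.poly σ) :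
    P.coord σ (P.param σ y) = y :=
  P.param_injOn σ (P.coord_spec σ (P.param_mem σ hy)).1 hy (P.coord_spec σ (P.param_mem σ hy)).2

/-- A boundary point lies in a proper exposed face, whose image is a strictly smaller cell;
conversely an exposed face that meets the interior is the whole polytope. -/
theorem param_mem_relInt_iff (σ : P.cells) {y : Fin (P.dim σ) → ℝ} (hy : y ∈ P.poly σ) :
    P.param σ y ∈ relInt P.cells (σ : Set B) ↔ y ∈ interior (P.poly σ) := by
  rw [mem_relInt_iff]
  constructor
  · rintro ⟨-, h⟩
    by_contra hi
    obtain ⟨F, hF, hyF, hne⟩ := (P.convex_poly σ).exists_isExposed (P.fullDim σ) hy hi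
    have hFσ : F ⊆ P.poly σ := hF.subset
    have := h _ (P.face_mem σ F hF ⟨y, hyF⟩) (by
      rw [← P.param_image σ]; exact image_mono hFσ) (mem_image_of_mem _ hyF)
    apply hne
    refine hFσ.antisymm fun z hz => ?_
    have hz' : P.param σ z ∈ P.param σ '' F := by rw [this]; exact P.param_mem σ hz
    obtain ⟨w, hw, hwz⟩ := hz'
    rwa [← P.param_injOn σ (hFσ hw) hz hwz]
  · refine fun hi => ⟨P.param_mem σ hy, fun τ hτ hle hx => ?_⟩
    obtain ⟨F, hF, hτF⟩ := P.face_of_le ⟨τ, hτ⟩ σ hle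
    simp only at hτF
    rw [hτF] at hx
    obtain ⟨w, hw, hwy⟩ := hx
    have := P.param_injOn σ (hF.subset hw) hy hwy
    subst this
    rw [hτF, hF.eq_of_mem_interior hw hi, P.param_image]

theorem bary_mem_relInt (σ : P.cells) : P.bary σ ∈ relInt P.cells (σ : Set B) :=
  (P.param_mem_relInt_iff σ (interior_subset (P.polytopeBary_mem σ))).2 (P.polytopeBary_mem σ)

theorem bary_mem (σ : P.cells) : P.bary σ ∈ (σ : Set B) :=
  P.param_mem σ (interior_subset (P.polytopeBary_mem σ))

theorem coord_bary_self (σ : P.cells) : P.coord σ (P.bary σ) = polytopeBary (P.poly σ) :=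
  P.coord_param σ (interior_subset (P.polytopeBary_mem σ))

variable {P}

theorem le_of_mem_relInt {σ κ : P.cells} {x : B} (hx : x ∈ relInt P.cells (σ : Set B))
    (hκ : x ∈ (κ : Set B)) : σ ≤ κ := by
  obtain ⟨τ, h1, h2, h3⟩ := P.inter σ κ x ⟨(mem_relInt_iff.1 hx).1, hκ⟩
  have : τ = σ := Subtype.ext ((mem_relInt_iff.1 hx).2 τ τ.2 h1 h3)
  exact this ▸ h2

theorem eq_of_mem_relInt {σ κ : P.cells} {x : B} (hx : x ∈ relInt P.cells (σ : Set B))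
    (hκ : x ∈ relInt P.cells (κ : Set B)) : σ = κ :=
  (le_of_mem_relInt hx (mem_relInt_iff.1 hκ).1).antisymm
    (le_of_mem_relInt hκ (mem_relInt_iff.1 hx).1)

theorem exists_mem_relInt_le {κ : P.cells} {x : B} (hx : x ∈ (κ : Set B)) :
    ∃ σ : P.cells, σ ≤ κ ∧ x ∈ relInt P.cells (σ : Set B) := by
  obtain ⟨σ, hle, hσ⟩ := (Set.toFinite {τ : P.cells | x ∈ (τ : Set B)}).exists_le_minimal hx
  refine ⟨σ, hle, mem_relInt_iff.2 ⟨hσ.prop, fun τ hτ hle hxτ => ?_⟩⟩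
  exact hle.antisymm (hσ.le_of_le (y := ⟨τ, hτ⟩) hxτ hle)

variable (P) in
theorem exists_mem_relInt (x : B) : ∃ σ : P.cells, x ∈ relInt P.cells (σ : Set B) := by
  obtain ⟨κ, hκ, hx⟩ := mem_sUnion.1 (P.cover.symm ▸ mem_univ x : x ∈ ⋃₀ P.cells)
  obtain ⟨σ, -, h⟩ := exists_mem_relInt_le (κ := ⟨κ, hκ⟩) hx
  exact ⟨σ, h⟩

theorem dim_mono {τ σ : P.cells} (h : τ ≤ σ) : P.dim τ ≤ P.dim σ := by
  obtain ⟨A, A', b, hA, -⟩ := P.face_affine τ σ h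
  have hinj : Function.Injective (A.map (Int.cast : ℤ → ℝ)).mulVecLin := fun x y hxy => by
    rw [← intMul_leftInverse hA x, ← intMul_leftInverse hA y]
    exact congrArg _ hxy
  simpa using LinearMap.finrank_le_finrank_of_injective hinj

variable (P) in
theorem dim_le (τ : P.cells) : P.dim τ ≤ n := by
  obtain ⟨σ, h, hσ⟩ := P.pure τ
  exact (dim_mono h).trans_eq hσ

/-- In equal dimensions the affine inclusion of the face is open, so the barycentre of `τ` lies in
the interior of `σ` as well. Relative interiors of different cells are disjoint. -/
theorem eq_of_le_of_dim_le {τ σ : P.cells} (h : τ ≤ σ) (hd : P.dim σ ≤ P.dim τ) : τ = σ := by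
  obtain ⟨F, hF, hτF⟩ := P.face_of_le τ σ h
  obtain ⟨A, A', b, hA, hp⟩ := P.face_affine τ σ h
  have hinj : Function.Injective (A.map (Int.cast : ℤ → ℝ)).mulVecLin := fun x y hxy => by
    rw [← intMul_leftInverse hA x, ← intMul_leftInverse hA y]
    exact congrArg _ hxy
  have hsurj : Function.Surjective (A.map (Int.cast : ℤ → ℝ)).mulVecLin := by
    have hdd := le_antisymm (dim_mono h) hd
    exact (LinearMap.injective_iff_surjective_of_finrank_eq_finrank (by simpa using hdd)).1 hinj
  have hopen : IsOpenMap (intMul A) :=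
    (LinearMap.toContinuousLinearMap (A.map (Int.cast : ℤ → ℝ)).mulVecLin).isOpenMap hsurj
  have hb := P.polytopeBary_mem τ
  have himg : (fun x => intMul A x + b) '' interior (P.poly τ) ⊆ P.poly σ := by
    rintro _ ⟨x, hx, rfl⟩
    exact (hp x (interior_subset hx)).1
  have hop : IsOpen ((fun x => intMul A x + b) '' interior (P.poly τ)) := by
    rw [← image_image (fun x => x + b) (intMul A)]
    exact isOpenMap_add_right b _ (hopen _ isOpen_interior)
  have hi := interior_maximal himg hop (mem_image_of_mem _ hb)
  have := (P.param_mem_relInt_iff σ (interior_subset hi)).2 hi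
  rw [(hp _ (interior_subset hb)).2] at this
  exact eq_of_mem_relInt (P.bary_mem_relInt τ) this

theorem eq_of_le_of_dim_eq {σ κ : P.cells} (h : σ ≤ κ) (hσ : P.dim σ = n) : σ = κ :=
  eq_of_le_of_dim_le h (by rw [hσ]; exact P.dim_le κ)

/-- A maximal cell lies in no other cell, so its interior is the complement of the finite union of
all the other compact cells. -/
theorem isOpen_relInt [T2Space B] {σ : P.cells} (hσ : P.dim σ = n) :
    IsOpen (relInt P.cells (σ : Set B)) := by
  have : relInt P.cells (σ : Set B) = (⋃ κ ∈ {κ : P.cells | κ ≠ σ}, (κ : Set B))ᶜ := by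
    ext x
    simp only [mem_compl_iff, mem_iUnion, not_exists, exists_prop, not_and, mem_ofPred_eq]
    constructor
    · exact fun hx κ hκ hxκ => hκ (eq_of_le_of_dim_eq (le_of_mem_relInt hx hxκ) hσ).symm
    · intro h
      obtain ⟨κ, hκ⟩ := P.exists_mem_relInt x
      by_cases hne : κ = σ
      · exact hne ▸ hκ
      · exact absurd (mem_relInt_iff.1 hκ).1 (h κ hne)
  rw [this, isOpen_compl_iff]
  exact (Set.toFinite _).isClosed_biUnion fun κ _ => (P.isCompact_cell κ).isClosed

theorem closure_relInt (σ : P.cells) : (σ : Set B) ⊆ closure (relInt P.cells (σ : Set B)) := by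
  intro x hx
  rw [← P.param_image σ] at hx
  obtain ⟨y, hy, rfl⟩ := hx
  have hcl : y ∈ closure (interior (P.poly σ)) := by
    rw [(P.convex_poly σ).closure_interior_eq_closure_of_nonempty_interior (P.fullDim σ)]
    exact subset_closure hy
  have h1 := ((P.param_continuousOn σ y hy).mono interior_subset).mem_closure_image hcl
  refine closure_mono ?_ h1
  rintro _ ⟨z, hz, rfl⟩
  exact (P.param_mem_relInt_iff σ (interior_subset hz)).2 hz

end PolyhedralDecomposition

namespace PolyhedralDecomposition

variable {n : ℕ} {B : Type*} [TopologicalSpace B] [ChartedSpace (EuclideanSpace ℝ (Fin n)) B]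
  {M : IntegralAffineManifold n B} (P : PolyhedralDecomposition M)

/-! ## Barycentric weights -/

/-- A system of weights on a chain of cells. -/
structure IsWeight (w : P.cells → ℝ) : Prop where
  nonneg : ∀ κ, 0 ≤ w κ
  sum_eq : ∑ κ, w κ = 1
  chain : ∀ κ κ', w κ ≠ 0 → w κ' ≠ 0 → κ ≤ κ' ∨ κ' ≤ κ

/-- The weights `w` are carried by faces of `σ`. -/
def CarriedBy (w : P.cells → ℝ) (σ : P.cells) : Prop := ∀ κ, w κ ≠ 0 → κ ≤ σ

/-- The combination of the barycentres with weights `w`, in the coordinates of `σ`. -/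
noncomputable def comb (σ : P.cells) (w : P.cells → ℝ) : Fin (P.dim σ) → ℝ :=
  ∑ κ, w κ • P.coord σ (P.bary κ)

/-- The point `x` has barycentric weights `w`. -/
def HasWeight (w : P.cells → ℝ) (x : B) : Prop :=
  P.IsWeight w ∧ ∃ σ, P.CarriedBy w σ ∧ P.param σ (P.comb σ w) = x

variable {P} {w w' w₀ : P.cells → ℝ} {σ τ κ ρ : P.cells} {x : B}

theorem CarriedBy.mono (h : P.CarriedBy w ρ) (hle : ρ ≤ σ) : P.CarriedBy w σ :=
  fun κ hκ => (h κ hκ).trans hle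

theorem continuous_comb (σ : P.cells) : Continuous (P.comb σ) := by
  unfold comb; fun_prop

theorem comb_add (σ : P.cells) (w w' : P.cells → ℝ) : P.comb σ (w + w') = P.comb σ w + P.comb σ w' := by
  simp [comb, add_smul, Finset.sum_add_distrib]

theorem comb_smul (σ : P.cells) (a : ℝ) (w : P.cells → ℝ) : P.comb σ (a • w) = a • P.comb σ w := by
  simp [comb, Finset.smul_sum, smul_smul]

theorem coord_bary_mem (h : κ ≤ σ) : P.coord σ (P.bary κ) ∈ P.poly σ :=
  (P.coord_spec σ (h (P.bary_mem κ))).1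

theorem IsWeight.ne_zero_exists (hw : P.IsWeight w) : ∃ κ, w κ ≠ 0 := by
  by_contra! h
  have := hw.sum_eq
  simp [h] at this

theorem IsWeight.exists_top (hw : P.IsWeight w) : ∃ ρ, w ρ ≠ 0 ∧ P.CarriedBy w ρ := by
  obtain ⟨κ, hκ⟩ := hw.ne_zero_exists
  obtain ⟨ρ, -, hρ⟩ := (Set.toFinite {κ | w κ ≠ 0}).exists_le_maximal hκ
  refine ⟨ρ, hρ.prop, fun κ hκ => ?_⟩
  rcases hw.chain κ ρ hκ hρ.prop with h | h
  · exact h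
  · exact hρ.le_of_ge hκ h

theorem IsWeight.comb_mem (hw : P.IsWeight w) (h : P.CarriedBy w σ) : P.comb σ w ∈ P.poly σ := by
  classical
  -- Cells of weight zero need not lie in `σ`, so their `coord` may be a junk value of `invFunOn`.
  -- It is replaced by a point of the polytope before convexity is used.
  have h1 : P.comb σ w = ∑ κ, w κ • (if w κ ≠ 0 then P.coord σ (P.bary κ)
      else polytopeBary (P.poly σ)) := by
    refine Finset.sum_congr rfl fun κ _ => ?_
    by_cases hκ : w κ = 0 <;> simp [hκ]
  rw [h1]
  refine (P.convex_poly σ).sum_mem (fun κ _ => hw.nonneg κ) hw.sum_eq fun κ _ => ?_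
  split_ifs with hκ
  · exact coord_bary_mem (h κ hκ)
  · exact interior_subset (P.polytopeBary_mem σ)

/-- A functional supporting the polytope at the combination is maximal at every barycentre of
nonzero weight, in particular at that of `σ`, which is an interior point. -/
theorem IsWeight.comb_mem_interior (hw : P.IsWeight w) (h : P.CarriedBy w σ) (hσ : w σ ≠ 0) :
    P.comb σ w ∈ interior (P.poly σ) := by
  by_contra hi
  obtain ⟨l, hl, hmax⟩ := geometric_hahn_banach_of_nonempty_interior_point
    (P.convex_poly σ) hi (P.fullDim σ)
  have hsum : ∑ κ, w κ * (l (P.comb σ w) - l (P.coord σ (P.bary κ))) = 0 := by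
    have : l (P.comb σ w) = ∑ κ, w κ * l (P.coord σ (P.bary κ)) := by
      conv_lhs => rw [comb]
      simp [map_sum]
    simp_rw [mul_sub]
    rw [Finset.sum_sub_distrib, ← Finset.sum_mul, hw.sum_eq, one_mul, ← this, sub_self]
  have hz := (Finset.sum_eq_zero_iff_of_nonneg fun κ _ => ?_).1 hsum σ (Finset.mem_univ σ)
  · have h2 : l (P.comb σ w) = l (P.coord σ (P.bary σ)) := by
      rcases mul_eq_zero.1 hz with h | h
      · exact absurd h hσ
      · linarith
    rw [coord_bary_self] at h2
    exact hl (eq_zero_of_max_mem_interior l (P.polytopeBary_mem σ) fun y hy => h2 ▸ hmax y hy)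
  · by_cases hκ : w κ = 0
    · simp [hκ]
    · exact mul_nonneg (hw.nonneg κ) (sub_nonneg.2 (hmax _ (coord_bary_mem (h κ hκ))))

/-- The inclusion of a face in the coordinates of the cells. -/
theorem exists_coord_affine (h : ρ ≤ σ) :
    ∃ (A : Matrix (Fin (P.dim σ)) (Fin (P.dim ρ)) ℤ) (A' : Matrix (Fin (P.dim ρ)) (Fin (P.dim σ)) ℤ)
      (b : Fin (P.dim σ) → ℝ), A' * A = 1 ∧
      ∀ x ∈ (ρ : Set B), P.coord σ x = intMul A (P.coord ρ x) + b := by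
  obtain ⟨A, A', b, hA, hp⟩ := P.face_affine ρ σ h
  refine ⟨A, A', b, hA, fun x hx => ?_⟩
  obtain ⟨h1, h2⟩ := P.coord_spec ρ hx
  rw [← P.coord_param σ (hp _ h1).1, (hp _ h1).2, h2]

/-- Face inclusions are affine and the weights sum to 1, so the point does not depend on the cell
whose coordinates are used. -/
theorem IsWeight.param_comb (hw : P.IsWeight w) (h : P.CarriedBy w ρ) (hle : ρ ≤ σ) :
    P.param σ (P.comb σ w) = P.param ρ (P.comb ρ w) := by
  obtain ⟨A, A', b, hA, hc⟩ := exists_coord_affine hle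
  have h1 : P.comb σ w = intMul A (P.comb ρ w) + b := by
    have h2 : intMul A (P.comb ρ w) = ∑ κ, w κ • intMul A (P.coord ρ (P.bary κ)) := by
      simp only [intMul_eq_mulVecLin, comb, map_sum, map_smul]
    have h3 : b = ∑ κ, w κ • b := by rw [← Finset.sum_smul, hw.sum_eq, one_smul]
    rw [h2]
    conv_rhs => rw [h3]
    rw [← Finset.sum_add_distrib]
    refine Finset.sum_congr rfl fun κ _ => ?_
    by_cases hκ : w κ = 0
    · simp [hκ]
    · rw [hc _ (h κ hκ (P.bary_mem κ)), smul_add]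
  have h4 := hc _ (P.param_mem ρ (hw.comb_mem h))
  rw [P.coord_param ρ (hw.comb_mem h), ← h1] at h4
  rw [← h4, (P.coord_spec σ (hle (P.param_mem ρ (hw.comb_mem h)))).2]

theorem HasWeight.param_comb (h : P.HasWeight w x) (hσ : P.CarriedBy w σ) :
    P.param σ (P.comb σ w) = x := by
  obtain ⟨hw, κ, hκ, rfl⟩ := h
  obtain ⟨ρ, hρ, hc⟩ := hw.exists_top
  rw [hw.param_comb hc (hσ ρ hρ), hw.param_comb hc (hκ ρ hρ)]

theorem HasWeight.coord_eq (h : P.HasWeight w x) (hσ : P.CarriedBy w σ) :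
    P.coord σ x = P.comb σ w := by
  rw [← h.param_comb hσ, P.coord_param σ (h.1.comb_mem hσ)]

theorem HasWeight.mem (h : P.HasWeight w x) (hσ : P.CarriedBy w σ) : x ∈ (σ : Set B) := by
  rw [← h.param_comb hσ]; exact P.param_mem σ (h.1.comb_mem hσ)

theorem HasWeight.mem_relInt_iff (h : P.HasWeight w x) :
    x ∈ relInt P.cells (σ : Set B) ↔ w σ ≠ 0 ∧ P.CarriedBy w σ := by
  have key : ∀ ρ : P.cells, w ρ ≠ 0 → P.CarriedBy w ρ → x ∈ relInt P.cells (ρ : Set B) :=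
    fun ρ hρ hc => by
      rw [← h.param_comb hc, P.param_mem_relInt_iff ρ (h.1.comb_mem hc)]
      exact h.1.comb_mem_interior hc hρ
  refine ⟨fun hx => ?_, fun hx => key σ hx.1 hx.2⟩
  obtain ⟨ρ, hρ, hc⟩ := h.1.exists_top
  rw [eq_of_mem_relInt hx (key ρ hρ hc)]
  exact ⟨hρ, hc⟩

open Classical in
theorem isWeight_single (σ : P.cells) : P.IsWeight (Pi.single σ 1) where
  nonneg κ := by
    by_cases h : κ = σ
    · subst h; simp
    · simp [h]
  sum_eq := by simp
  chain κ κ' h h' := by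
    left
    have h1 : κ = σ := by by_contra hne; simp [hne] at h
    have h2 : κ' = σ := by by_contra hne; simp [hne] at h'
    rw [h1, h2]

open Classical in
theorem comb_single (σ κ : P.cells) : P.comb σ (Pi.single κ 1) = P.coord σ (P.bary κ) := by
  rw [comb, Finset.sum_eq_single κ] <;> simp +contextual

theorem IsWeight.combo (h₀ : P.IsWeight w₀) (h : P.IsWeight w) (hs : ∀ κ, w₀ κ ≠ 0 → w κ ≠ 0)
    {a b : ℝ} (ha : 0 ≤ a) (hb : 0 ≤ b) (hab : a + b = 1) : P.IsWeight (a • w₀ + b • w) where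
  nonneg κ := add_nonneg (mul_nonneg ha (h₀.nonneg κ)) (mul_nonneg hb (h.nonneg κ))
  sum_eq := by
    simp only [Pi.add_apply, Pi.smul_apply, smul_eq_mul, Finset.sum_add_distrib, ← Finset.mul_sum,
      h₀.sum_eq, h.sum_eq, mul_one, hab]
  chain κ κ' hκ hκ' := by
    have : ∀ κ, (a • w₀ + b • w) κ ≠ 0 → w κ ≠ 0 := fun κ hκ hz => by
      have : w₀ κ = 0 := by by_contra h1; exact hs κ h1 hz
      simp [hz, this] at hκ
    exact h.chain _ _ (this _ hκ) (this _ hκ')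

open Classical in
/-- The weights obtained by removing the weight `a` from the cell `ρ` and normalizing. -/
noncomputable def strip (w : P.cells → ℝ) (ρ : P.cells) (a : ℝ) : P.cells → ℝ :=
  (1 - a)⁻¹ • (w + (-a) • Pi.single ρ 1)

theorem strip_of_ne {a : ℝ} (h : κ ≠ ρ) : strip w ρ a κ = (1 - a)⁻¹ * w κ := by
  simp [strip, h]

theorem strip_self {a : ℝ} : strip w ρ a ρ = (1 - a)⁻¹ * (w ρ - a) := by
  simp [strip, sub_eq_add_neg]

theorem strip_ne_zero {a : ℝ} (hρ : w ρ ≠ 0) (h : strip w ρ a κ ≠ 0) : w κ ≠ 0 := by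
  by_cases hκ : κ = ρ
  · exact hκ ▸ hρ
  · rw [strip_of_ne hκ] at h
    exact right_ne_zero_of_mul h

open Classical in
theorem comb_strip {a : ℝ} : P.comb σ (strip w ρ a) =
    (1 - a)⁻¹ • (P.comb σ w + (-a) • P.coord σ (P.bary ρ)) := by
  rw [strip, comb_smul, comb_add, comb_smul, comb_single]

theorem IsWeight.strip (hw : P.IsWeight w) (hρ : w ρ ≠ 0) {a : ℝ} (ha : a ≤ w ρ) (ha1 : a < 1) :
    P.IsWeight (strip w ρ a) where
  nonneg κ := by
    have h1 : 0 ≤ (1 - a)⁻¹ := inv_nonneg.2 (by linarith)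
    by_cases hκ : κ = ρ
    · subst hκ; rw [strip_self]; exact mul_nonneg h1 (by linarith)
    · rw [strip_of_ne hκ]; exact mul_nonneg h1 (hw.nonneg κ)
  sum_eq := by
    classical
    have h1 : 1 - a ≠ 0 := by linarith
    simp only [PolyhedralDecomposition.strip, Pi.add_apply, Pi.smul_apply, smul_eq_mul, Finset.sum_add_distrib,
      ← Finset.mul_sum, hw.sum_eq, Finset.sum_pi_single', Finset.mem_univ, if_true]
    field_simp; ring
  chain κ κ' hκ hκ' := hw.chain _ _ (strip_ne_zero hρ hκ) (strip_ne_zero hρ hκ')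

theorem IsWeight.eq_single (hw : P.IsWeight w) (h : w ρ = 1) {κ : P.cells} (hκ : κ ≠ ρ) :
    w κ = 0 := by
  classical
  have h1 := hw.sum_eq
  rw [← Finset.add_sum_erase _ _ (Finset.mem_univ ρ), h] at h1
  have h2 : ∑ κ ∈ Finset.univ.erase ρ, w κ = 0 := by linarith
  exact (Finset.sum_eq_zero_iff_of_nonneg fun κ _ => hw.nonneg κ).1 h2 κ (by simp [hκ])

theorem IsWeight.le_one (hw : P.IsWeight w) (κ : P.cells) : w κ ≤ 1 := by
  rw [← hw.sum_eq]
  exact Finset.single_le_sum (fun κ _ => hw.nonneg κ) (Finset.mem_univ κ)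

/-- Induction on the top cell `ρ` of the support, which is the same for `w` and `w'` because `x`
lies in the interior of one cell only. Removing the smaller of the two weights of `ρ` from both
gives two weight systems of a common point, one of which has a strictly smaller top cell. Weight 1
at `ρ` is treated separately, since the normalization divides by `1 - w ρ`. -/
theorem HasWeight.unique_aux (ρ : P.cells) : ∀ (w w' : P.cells → ℝ) (x : B), P.HasWeight w x →
    P.HasWeight w' x → w ρ ≠ 0 → P.CarriedBy w ρ → w = w' := by
  induction ρ using WellFoundedLT.induction with
  | ind ρ ih =>
  intro w w' x h h' hρ hc
  obtain ⟨hρ', hc'⟩ := h'.mem_relInt_iff.1 (h.mem_relInt_iff.2 ⟨hρ, hc⟩)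
  wlog hle : w ρ ≤ w' ρ generalizing w w'
  · exact (this w' w h' h hρ' hc' hρ hc (le_of_not_ge hle)).symm
  rcases (h.1.le_one ρ).eq_or_lt with h1 | h1
  · have h1' : w' ρ = 1 := le_antisymm (h'.1.le_one ρ) (h1 ▸ hle)
    funext κ
    by_cases hκ : κ = ρ
    · rw [hκ, h1, h1']
    · rw [h.1.eq_single h1 hκ, h'.1.eq_single h1' hκ]
  have hs := h.1.strip hρ le_rfl h1
  have hs' := h'.1.strip hρ' hle h1
  have hcs : P.CarriedBy (strip w ρ (w ρ)) ρ := fun κ hκ => hc κ (strip_ne_zero hρ hκ)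
  have hcs' : P.CarriedBy (strip w' ρ (w ρ)) ρ := fun κ hκ => hc' κ (strip_ne_zero hρ' hκ)
  have hy : P.HasWeight (strip w ρ (w ρ)) (P.param ρ (P.comb ρ (strip w ρ (w ρ)))) :=
    ⟨hs, ρ, hcs, rfl⟩
  have hy' : P.HasWeight (strip w' ρ (w ρ)) (P.param ρ (P.comb ρ (strip w ρ (w ρ)))) :=
    ⟨hs', ρ, hcs', by rw [comb_strip, comb_strip, ← h.coord_eq hc, ← h'.coord_eq hc']⟩
  obtain ⟨ρ₁, hρ₁, hc₁⟩ := hs.exists_top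
  have hne : ρ₁ ≠ ρ := by rintro rfl; simp [strip_self] at hρ₁
  have heq := ih ρ₁ (lt_of_le_of_ne (hcs ρ₁ hρ₁) hne) _ _ _ hy hy' hρ₁ hc₁
  have h2 : (1 - w ρ)⁻¹ ≠ 0 := inv_ne_zero (by linarith)
  funext κ
  have h3 := congrFun heq κ
  by_cases hκ : κ = ρ
  · subst hκ
    rw [strip_self, strip_self] at h3
    linarith [mul_left_cancel₀ h2 h3]
  · rw [strip_of_ne hκ, strip_of_ne hκ] at h3
    exact mul_left_cancel₀ h2 h3

theorem HasWeight.unique (h : P.HasWeight w x) (h' : P.HasWeight w' x) : w = w' := by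
  obtain ⟨ρ, hρ, hc⟩ := h.1.exists_top
  exact HasWeight.unique_aux ρ w w' x h h' hρ hc

/-- Induction on `σ`: project `x` from the barycentre of `σ` to the boundary, take weights of the
projected point in a proper face, and mix them with the barycentre of `σ`. -/
theorem exists_hasWeight_aux (σ : P.cells) : ∀ x ∈ (σ : Set B),
    ∃ w, P.HasWeight w x ∧ P.CarriedBy w σ := by
  classical
  induction σ using WellFoundedLT.induction with
  | ind σ ih =>
  intro x hx
  obtain ⟨hy, hyx⟩ := P.coord_spec σ hx
  have hcs : P.CarriedBy (Pi.single σ 1) σ := fun κ hκ => by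
    by_contra hne
    exact hκ (Pi.single_eq_of_ne (fun h => hne h.le) _)
  by_cases hyb : P.coord σ x = polytopeBary (P.poly σ)
  · exact ⟨Pi.single σ 1, ⟨isWeight_single σ, σ, hcs, by
      rw [comb_single, coord_bary_self, ← hyb, hyx]⟩, hcs⟩
  obtain ⟨z, hz, hzi, a, ha, ha1, hyz⟩ := (P.isCompact_poly σ).exists_boundary_point hy hyb
  obtain ⟨ρ, hle, hzρ⟩ := exists_mem_relInt_le (P.param_mem σ hz)
  have hlt : ρ < σ := lt_of_le_of_ne hle fun h => by
    subst h; exact hzi ((P.param_mem_relInt_iff ρ hz).1 hzρ)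
  obtain ⟨w, hw, hwc⟩ := ih ρ hlt _ (_root_.mem_relInt_iff.1 hzρ).1
  have hwc' := hwc.mono hle
  have hwσ : w σ = 0 := by
    by_contra h
    exact hlt.not_ge (hwc σ h)
  have hcomb : P.comb σ (a • Pi.single σ 1 + (1 - a) • w) = P.coord σ x := by
    rw [comb_add, comb_smul, comb_smul, comb_single, coord_bary_self, ← hw.coord_eq hwc',
      P.coord_param σ hz, ← hyz]
  have hc : P.CarriedBy (a • Pi.single σ 1 + (1 - a) • w) σ := fun κ hκ => by
    by_contra hne
    have h1 : w κ = 0 := by by_contra h; exact hne (hwc' κ h)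
    have h2 : κ ≠ σ := fun h => hne (h ▸ le_rfl)
    simp [h1, h2] at hκ
  refine ⟨_, ⟨⟨fun κ => ?_, ?_, fun κ κ' h h' => ?_⟩, σ, hc, by rw [hcomb, hyx]⟩, hc⟩
  · exact add_nonneg (mul_nonneg ha ((isWeight_single σ).nonneg κ))
      (mul_nonneg (by linarith) (hw.1.nonneg κ))
  · simp [Finset.sum_add_distrib, ← Finset.mul_sum, hw.1.sum_eq]
  · by_cases hκ : κ = σ
    · exact Or.inr (hκ ▸ hc κ' h')
    by_cases hκ' : κ' = σ
    · exact Or.inl (hκ' ▸ hc κ h)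
    simp only [Pi.add_apply, Pi.smul_apply, smul_eq_mul, Pi.single_eq_of_ne hκ,
      Pi.single_eq_of_ne hκ', mul_zero, zero_add] at h h'
    exact hw.1.chain _ _ (right_ne_zero_of_mul h) (right_ne_zero_of_mul h')

theorem exists_hasWeight (x : B) : ∃ w, P.HasWeight w x := by
  obtain ⟨σ, hσ⟩ := P.exists_mem_relInt x
  obtain ⟨w, hw, -⟩ := exists_hasWeight_aux σ x (_root_.mem_relInt_iff.1 hσ).1
  exact ⟨w, hw⟩

/-! ## Open stars -/

/-- The coordinates `q` in the definition of the star are forced by injectivity of `param`, so only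
the weights carry information. -/
theorem mem_star_iff : x ∈ P.star τ ↔ ∃ w, P.HasWeight w x ∧ w τ ≠ 0 := by
  classical
  constructor
  · rintro ⟨σ, c, w, q, hchain, hτ, hq, hsum, rfl⟩
    have hw : P.IsWeight (fun κ => if κ ∈ c then w κ else 0) := by
      refine ⟨fun κ => ?_, ?_, fun κ κ' h h' => ?_⟩
      · split_ifs with h
        · exact (hq κ h).2.1.le
        · exact le_rfl
      · simpa [← Finset.sum_filter] using hsum
      · have h1 : κ ∈ c := by by_contra hn; simp [hn] at h
        have h2 : κ' ∈ c := by by_contra hn; simp [hn] at h'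
        exact hchain.total h1 h2
    refine ⟨_, ⟨hw, σ, fun κ h => ?_, ?_⟩, ?_⟩
    · have h1 : κ ∈ c := by by_contra hn; simp [hn] at h
      exact (hq κ h1).1
    · congr 1
      have : ∀ κ, (if κ ∈ c then w κ else 0) • P.coord σ (P.bary κ) =
          if κ ∈ c then w κ • q κ else 0 := fun κ => by
        split_ifs with h
        · rw [← (hq κ h).2.2.2, P.coord_param σ (hq κ h).2.2.1]
        · simp
      rw [comb, Finset.sum_congr rfl fun κ _ => this κ, ← Finset.sum_filter]
      simp
    · simp only [hτ, if_true]
      exact (hq τ hτ).2.1.ne'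
  · rintro ⟨w, ⟨hw, σ, hc, rfl⟩, hτ⟩
    refine ⟨σ, Finset.univ.filter fun κ => w κ ≠ 0, w, fun κ => P.coord σ (P.bary κ), ?_, by simpa,
      fun κ hκ => ?_, ?_, ?_⟩
    · intro κ hκ κ' hκ' _
      exact hw.chain κ κ' (by simpa using hκ) (by simpa using hκ')
    · have h : w κ ≠ 0 := by simpa using hκ
      have h2 := P.coord_spec σ (hc κ h (P.bary_mem κ))
      exact ⟨hc κ h, lt_of_le_of_ne (hw.nonneg κ) h.symm, h2.1, h2.2⟩
    · rw [Finset.sum_filter_ne_zero, hw.sum_eq]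
    · congr 1
      rw [comb, Finset.sum_filter]
      refine Finset.sum_congr rfl fun κ _ => ?_
      split_ifs with h
      · rfl
      · simp [not_not.1 h]

theorem HasWeight.mem_star_iff (h : P.HasWeight w x) : x ∈ P.star τ ↔ w τ ≠ 0 := by
  rw [PolyhedralDecomposition.mem_star_iff]
  exact ⟨fun ⟨w', h', hτ⟩ => h.unique h' ▸ hτ, fun hτ => ⟨w, h, hτ⟩⟩

theorem relInt_subset_star : relInt P.cells (τ : Set B) ⊆ P.star τ := fun x hx => by
  obtain ⟨w, hw⟩ := P.exists_hasWeight x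
  exact hw.mem_star_iff.2 (hw.mem_relInt_iff.1 hx).1

/-- The complement is a finite union of continuous images of the sets of weights carried by `σ` with
`w τ = 0`. These are compact: being supported on a chain is the closed condition that `w κ * w κ' =
0` for incomparable `κ`, `κ'`. -/
theorem isOpen_star [T2Space B] (τ : P.cells) : IsOpen (P.star τ) := by
  let K : P.cells → Set (P.cells → ℝ) := fun σ => {w | P.IsWeight w ∧ P.CarriedBy w σ ∧ w τ = 0}
  have hK : ∀ σ, K σ = (univ.pi fun _ => Icc (0 : ℝ) 1) ∩ ({w | ∑ κ, w κ = 1} ∩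
      ((⋂ κ, ⋂ κ', ⋂ (_ : ¬ (κ ≤ κ' ∨ κ' ≤ κ)), {w | w κ * w κ' = 0}) ∩
      ((⋂ κ, ⋂ (_ : ¬ κ ≤ σ), {w | w κ = 0}) ∩ {w | w τ = 0}))) := by
    intro σ
    ext w
    simp only [K, mem_inter_iff, mem_ofPred_eq, mem_iInter, Set.mem_pi, mem_univ, true_implies, mem_Icc]
    constructor
    · rintro ⟨h, hc, h0⟩
      refine ⟨fun κ => ⟨h.nonneg κ, h.le_one κ⟩, h.sum_eq, fun κ κ' hn => ?_, fun κ hn => ?_, h0⟩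
      · by_contra hne
        exact hn (h.chain κ κ' (left_ne_zero_of_mul hne) (right_ne_zero_of_mul hne))
      · by_contra hne; exact hn (hc κ hne)
    · rintro ⟨h1, h2, h3, h4, h0⟩
      refine ⟨⟨fun κ => (h1 κ).1, h2, fun κ κ' h h' => ?_⟩, fun κ h => ?_, h0⟩
      · by_contra hn; exact mul_ne_zero h h' (h3 κ κ' hn)
      · by_contra hn; exact h (h4 κ hn)
  have hKc : ∀ σ, IsCompact (K σ) := fun σ => by
    rw [hK]
    refine (isCompact_univ_pi fun _ => isCompact_Icc).inter_right ?_
    refine (isClosed_eq (by fun_prop) continuous_const).inter (IsClosed.inter ?_ (IsClosed.inter ?_ ?_))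
    · exact isClosed_iInter fun κ => isClosed_iInter fun κ' => isClosed_iInter fun _ =>
        isClosed_eq (by fun_prop) continuous_const
    · exact isClosed_iInter fun κ => isClosed_iInter fun _ =>
        isClosed_eq (by fun_prop) continuous_const
    · exact isClosed_eq (by fun_prop) continuous_const
  have hcompl : (P.star τ)ᶜ = ⋃ σ, P.param σ '' (P.comb σ '' K σ) := by
    ext x
    obtain ⟨w, hw⟩ := P.exists_hasWeight x
    rw [mem_compl_iff, hw.mem_star_iff, not_not, mem_iUnion]
    constructor
    · intro h0
      obtain ⟨σ, hc, hx⟩ := hw.2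
      exact ⟨σ, _, ⟨w, ⟨hw.1, hc, h0⟩, rfl⟩, hx⟩
    · rintro ⟨σ, _, ⟨w', ⟨h1, h2, h3⟩, rfl⟩, hx⟩
      rw [hw.unique ⟨h1, σ, h2, hx⟩, h3]
  rw [← isClosed_compl_iff, hcompl]
  refine isClosed_iUnion_of_finite fun σ => IsCompact.isClosed ?_
  refine ((hKc σ).image (continuous_comb σ)).image_of_continuousOn
    ((P.param_continuousOn σ).mono ?_)
  rintro _ ⟨w, hw, rfl⟩
  exact hw.1.comb_mem hw.2.1

/-! ## Segments in the barycentric subdivision -/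

/-- The segment from the point with weights `w₀` to the point with weights `w`, in the coordinates
of `κ`. -/
noncomputable def seg (κ : P.cells) (w₀ w : P.cells → ℝ) (t : ℝ) : B :=
  P.param κ (P.comb κ ((1 - t) • w₀ + t • w))

theorem isWeight_seg (h₀ : P.IsWeight w₀) (h : P.IsWeight w) (hs : ∀ κ, w₀ κ ≠ 0 → w κ ≠ 0)
    {t : ℝ} (ht : t ∈ Icc (0 : ℝ) 1) : P.IsWeight ((1 - t) • w₀ + t • w) :=
  h₀.combo h hs (by linarith [ht.2]) ht.1 (by ring)

theorem hasWeight_seg (h₀ : P.IsWeight w₀) (h : P.IsWeight w) (hs : ∀ κ, w₀ κ ≠ 0 → w κ ≠ 0)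
    (hc : P.CarriedBy w κ) {t : ℝ} (ht : t ∈ Icc (0 : ℝ) 1) : P.HasWeight ((1 - t) • w₀ + t • w) (seg κ w₀ w t) :=
  ⟨isWeight_seg h₀ h hs ht, κ, fun ν hν => hc ν fun hz => hν (by
    have : w₀ ν = 0 := by by_contra hn; exact hs ν hn hz
    simp [hz, this]), rfl⟩

theorem continuousOn_seg (h₀ : P.IsWeight w₀) (h : P.IsWeight w) (hs : ∀ κ, w₀ κ ≠ 0 → w κ ≠ 0)
    (hc : P.CarriedBy w κ) : ContinuousOn (seg κ w₀ w) (Icc 0 1) := by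
  refine (P.param_continuousOn κ).comp (t := P.poly κ)
    (((continuous_comb κ).comp (by fun_prop)).continuousOn) fun t ht => ?_
  refine (isWeight_seg h₀ h hs ht).comb_mem fun ν hν => hc ν fun hz => hν (by
    have : w₀ ν = 0 := by by_contra hn; exact hs ν hn hz
    simp [hz, this])

theorem seg_weight_pos_left (h₀ : P.IsWeight w₀) (h : P.IsWeight w) {t : ℝ} (ht : t ∈ Icc (0 : ℝ) 1)
    (ht1 : t < 1) {ν : P.cells} (hν : w₀ ν ≠ 0) :
    ((1 - t) • w₀ + t • w) ν ≠ 0 := by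
  have h1 := lt_of_le_of_ne (h₀.nonneg ν) hν.symm
  have := mul_pos (sub_pos.2 ht1) h1
  have := mul_nonneg ht.1 (h.nonneg ν)
  simp only [Pi.add_apply, Pi.smul_apply, smul_eq_mul]
  linarith

theorem seg_weight_pos_right (h₀ : P.IsWeight w₀) (h : P.IsWeight w) {t : ℝ} (ht : t ∈ Icc (0 : ℝ) 1)
    (ht0 : 0 < t) {ν : P.cells} (hν : w ν ≠ 0) :
    ((1 - t) • w₀ + t • w) ν ≠ 0 := by
  have h1 := lt_of_le_of_ne (h.nonneg ν) hν.symm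
  have := mul_pos ht0 h1
  have := mul_nonneg (sub_nonneg.2 ht.2) (h₀.nonneg ν)
  simp only [Pi.add_apply, Pi.smul_apply, smul_eq_mul]
  linarith

end PolyhedralDecomposition

/-! ### Points with prescribed support, and connectedness of stars. -/

namespace PolyhedralDecomposition

variable {n : ℕ} {B : Type*} [TopologicalSpace B] [ChartedSpace (EuclideanSpace ℝ (Fin n)) B]
  {M : IntegralAffineManifold n B} {P : PolyhedralDecomposition M}
  {w w' w₀ : P.cells → ℝ} {σ τ κ ρ : P.cells} {x x₀ : B}

theorem HasWeight.carriedBy (h : P.HasWeight w x) (hx : x ∈ (σ : Set B)) : P.CarriedBy w σ := by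
  obtain ⟨w', hw', hc⟩ := exists_hasWeight_aux σ x hx
  rwa [h.unique hw']

/-- Equal weights on the chain. The point lies in the stars of exactly the members of the chain and
in the interior of the largest one, and serves as a test point for identities on overlaps. -/
theorem exists_hasWeight_chain (c : Finset P.cells) (hne : c.Nonempty)
    (hc : ∀ κ ∈ c, ∀ κ' ∈ c, κ ≤ κ' ∨ κ' ≤ κ) :
    ∃ w x, P.HasWeight w x ∧ ∀ κ, w κ ≠ 0 ↔ κ ∈ c := by
  classical
  have hcard : (0 : ℝ) < c.card := by exact_mod_cast hne.card_pos
  have hsupp : ∀ κ, (if κ ∈ c then (c.card : ℝ)⁻¹ else 0) ≠ 0 ↔ κ ∈ c := fun κ => by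
    split_ifs with h <;> simp [h, hne.ne_empty]
  have hw : P.IsWeight fun κ => if κ ∈ c then (c.card : ℝ)⁻¹ else 0 := by
    refine ⟨fun κ => ?_, ?_, fun κ κ' h h' => hc κ ((hsupp κ).1 h) κ' ((hsupp κ').1 h')⟩
    · split_ifs
      · positivity
      · exact le_rfl
    · rw [← Finset.sum_filter]
      simp [hcard.ne']
  obtain ⟨ρ, -, h⟩ := hw.exists_top
  exact ⟨_, _, ⟨hw, ρ, h, rfl⟩, hsupp⟩

theorem exists_hasWeight_edgePt (h : τ ≤ σ) :
    ∃ w, P.HasWeight w (P.edgePt τ σ) ∧ ∀ κ, w κ ≠ 0 ↔ κ = τ ∨ κ = σ := by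
  classical
  have hsupp : ∀ κ, ((1 / 2 : ℝ) • Pi.single τ 1 + (1 / 2 : ℝ) • Pi.single σ 1 : P.cells → ℝ) κ ≠ 0
      ↔ κ = τ ∨ κ = σ := fun κ => by
    by_cases h1 : κ = τ <;> by_cases h2 : κ = σ
    · subst h1; subst h2; simp
    · subst h1; simp [h2]
    · subst h2; simp [h1]
    · simp [h1, h2]
  refine ⟨_, ⟨⟨fun κ => ?_, ?_, fun κ κ' hκ hκ' => ?_⟩, σ, fun κ hκ => ?_, ?_⟩, hsupp⟩
  · have h1 := (isWeight_single (P := P) τ).nonneg κ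
    have h2 := (isWeight_single (P := P) σ).nonneg κ
    simp only [Pi.add_apply, Pi.smul_apply, smul_eq_mul]
    positivity
  · simp only [Pi.add_apply, Pi.smul_apply, smul_eq_mul, Finset.sum_add_distrib, ← Finset.mul_sum,
      Finset.sum_pi_single', Finset.mem_univ, if_true]
    norm_num
  · rcases (hsupp κ).1 hκ with rfl | rfl <;> rcases (hsupp κ').1 hκ' with rfl | rfl <;> simp [h]
  · rcases (hsupp κ).1 hκ with rfl | rfl
    · exact h
    · exact le_rfl
  · rw [comb_add, comb_smul, comb_smul, comb_single, comb_single, coord_bary_self]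
    rfl

theorem exists_hasWeight_bary (τ : P.cells) :
    ∃ w, P.HasWeight w (P.bary τ) ∧ ∀ κ, w κ ≠ 0 ↔ κ = τ := by
  classical
  refine ⟨Pi.single τ 1, ⟨isWeight_single τ, τ, fun κ hκ => ?_, ?_⟩, fun κ => ?_⟩
  · by_contra hne
    exact hκ (Pi.single_eq_of_ne (fun h => hne h.le) _)
  · rw [comb_single, coord_bary_self]; rfl
  · by_cases h : κ = τ
    · subst h; simp
    · simp [h]

/-- Two points, the weights of one of which are supported on those of the other, are joined inside
the corresponding stars. -/
theorem HasWeight.exists_isPreconnected (h₀ : P.HasWeight w₀ x₀) (h : P.HasWeight w x)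
    (hs : ∀ κ, w₀ κ ≠ 0 → w κ ≠ 0) :
    ∃ J : Set B, IsPreconnected J ∧ x₀ ∈ J ∧ x ∈ J ∧ ∀ y ∈ J, ∃ v, P.HasWeight v y ∧
      (∀ κ, w₀ κ ≠ 0 → v κ ≠ 0) ∧ ∀ κ, v κ ≠ 0 → w κ ≠ 0 := by
  obtain ⟨σ, hc, hx⟩ := h.2
  have hc₀ : P.CarriedBy w₀ σ := fun κ hκ => hc κ (hs κ hκ)
  refine ⟨seg σ w₀ w '' Icc 0 1, isPreconnected_Icc.image _ (continuousOn_seg h₀.1 h.1 hs hc),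
    ⟨0, by simp, ?_⟩, ⟨1, by simp, ?_⟩, ?_⟩
  · simpa [seg] using h₀.param_comb hc₀
  · simpa [seg] using hx
  · rintro _ ⟨t, ht, rfl⟩
    refine ⟨_, hasWeight_seg h₀.1 h.1 hs hc ht, fun κ hκ => ?_, fun κ hκ hz => ?_⟩
    · rcases ht.2.lt_or_eq with h1 | h1
      · exact seg_weight_pos_left h₀.1 h.1 ht h1 hκ
      · exact seg_weight_pos_right h₀.1 h.1 ht (by linarith) (hs κ hκ)
    · have : w₀ κ = 0 := by by_contra hn; exact hs κ hn hz
      simp [hz, this] at hκ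

/-- The overlap is star-shaped in barycentric weights about the midpoint `edgePt τ σ`, whose support
`{τ, σ}` is contained in that of every point of the overlap. -/
theorem isPreconnected_star_inter (h : τ ≤ σ) : IsPreconnected (P.star τ ∩ P.star σ) := by
  obtain ⟨w₀, h₀, hs₀⟩ := exists_hasWeight_edgePt (P := P) h
  refine isPreconnected_of_forall (P.edgePt τ σ) fun x hx => ?_
  obtain ⟨w, hw⟩ := P.exists_hasWeight x
  have hτ := hw.mem_star_iff.1 hx.1
  have hσ := hw.mem_star_iff.1 hx.2
  obtain ⟨J, hJ, h1, h2, h3⟩ := h₀.exists_isPreconnected hw fun κ hκ => by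
    rcases (hs₀ κ).1 hκ with rfl | rfl <;> assumption
  refine ⟨J, fun y hy => ?_, h1, h2, hJ⟩
  obtain ⟨v, hv, hv₀, -⟩ := h3 y hy
  exact ⟨hv.mem_star_iff.2 (hv₀ _ ((hs₀ _).2 (Or.inl rfl))),
    hv.mem_star_iff.2 (hv₀ _ ((hs₀ _).2 (Or.inr rfl)))⟩

theorem exists_isPreconnected_bary (hx : x ∈ (σ : Set B)) (hτ : x ∈ P.star τ) :
    ∃ J : Set B, IsPreconnected J ∧ P.bary τ ∈ J ∧ x ∈ J ∧ J ⊆ (σ : Set B) ∩ P.star τ := by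
  obtain ⟨w₀, h₀, hs₀⟩ := exists_hasWeight_bary (P := P) τ
  obtain ⟨w, hw⟩ := P.exists_hasWeight x
  obtain ⟨J, hJ, h1, h2, h3⟩ := h₀.exists_isPreconnected hw fun κ hκ => by
    rw [(hs₀ κ).1 hκ]; exact hw.mem_star_iff.1 hτ
  refine ⟨J, hJ, h1, h2, fun y hy => ?_⟩
  obtain ⟨v, hv, hv₀, hvw⟩ := h3 y hy
  exact ⟨hv.mem fun κ hκ => hw.carriedBy hx κ (hvw κ hκ),
    hv.mem_star_iff.2 (hv₀ _ ((hs₀ _).2 rfl))⟩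

theorem param_mem_star_iff (hc : P.CarriedBy w κ) (hw : P.IsWeight w) :
    P.param κ (P.comb κ w) ∈ P.star τ ↔ w τ ≠ 0 :=
  HasWeight.mem_star_iff ⟨hw, κ, hc, rfl⟩

/-- The part of the open star of `τ` in the interior of a cell, in the coordinates of the cell. -/
theorem isPreconnected_interior_star (h : τ ≤ κ) :
    IsPreconnected {y | y ∈ interior (P.poly κ) ∧ P.param κ y ∈ P.star τ} := by
  obtain ⟨w₀, h₀, hs₀⟩ := exists_hasWeight_edgePt (P := P) h
  have hc₀ : P.CarriedBy w₀ κ := fun ν hν => by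
    rcases (hs₀ ν).1 hν with rfl | rfl
    exacts [h, le_rfl]
  refine isPreconnected_of_forall (P.comb κ w₀) fun y hy => ?_
  obtain ⟨w, hw⟩ := P.exists_hasWeight (P.param κ y)
  have hyp := interior_subset hy.1
  have hc := hw.carriedBy (P.param_mem κ hyp)
  have hyw : P.comb κ w = y := by rw [← hw.coord_eq hc, P.coord_param κ hyp]
  have hτ := hw.mem_star_iff.1 hy.2
  have hκ := (hw.mem_relInt_iff.1 ((P.param_mem_relInt_iff κ hyp).2 hy.1)).1
  have hs : ∀ ν, w₀ ν ≠ 0 → w ν ≠ 0 := fun ν hν => by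
    rcases (hs₀ ν).1 hν with rfl | rfl <;> assumption
  refine ⟨(fun t : ℝ => P.comb κ ((1 - t) • w₀ + t • w)) '' Icc 0 1, ?_, ⟨0, by simp⟩,
    ⟨1, by simp, by simpa using hyw⟩, isPreconnected_Icc.image _
      ((continuous_comb κ).comp (by fun_prop)).continuousOn⟩
  rintro _ ⟨t, ht, rfl⟩
  have hpos : ∀ ν, w₀ ν ≠ 0 → ((1 - t) • w₀ + t • w) ν ≠ 0 := fun ν hν => by
    rcases ht.2.lt_or_eq with h1 | h1
    · exact seg_weight_pos_left h₀.1 hw.1 ht h1 hν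
    · exact seg_weight_pos_right h₀.1 hw.1 ht (by linarith) (hs ν hν)
  have hv := hasWeight_seg h₀.1 hw.1 hs hc ht
  have hvc : P.CarriedBy ((1 - t) • w₀ + t • w) κ := fun ν hν => hc ν fun hz => by
    have : w₀ ν = 0 := by by_contra hn; exact hs ν hn hz
    simp [hz, this] at hν
  exact ⟨hv.1.comb_mem_interior hvc (hpos κ ((hs₀ κ).2 (Or.inr rfl))),
    (param_mem_star_iff hvc hv.1).2 (hpos τ ((hs₀ τ).2 (Or.inl rfl)))⟩

/-- Moving slightly towards the barycentre of `κ` makes the weight of `κ` positive and keeps that of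
`τ` nonzero. -/
theorem mem_closure_interior_star {y : Fin (P.dim κ) → ℝ} (hy : y ∈ P.poly κ)
    (hτ : P.param κ y ∈ P.star τ) :
    y ∈ closure {y | y ∈ interior (P.poly κ) ∧ P.param κ y ∈ P.star τ} := by
  classical
  obtain ⟨w, hw⟩ := P.exists_hasWeight (P.param κ y)
  have hc := hw.carriedBy (P.param_mem κ hy)
  have hyw : P.comb κ w = y := by rw [← hw.coord_eq hc, P.coord_param κ hy]
  let g : ℝ → Fin (P.dim κ) → ℝ := fun t => P.comb κ ((1 - t) • w + t • Pi.single κ 1)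
  have hg : Continuous g := (continuous_comb κ).comp (by fun_prop)
  have hlim : Tendsto g (𝓝[>] 0) (𝓝 y) := by
    have := hg.tendsto 0
    simp only [g, sub_zero, one_smul, zero_smul, add_zero, hyw] at this
    exact this.mono_left nhdsWithin_le_nhds
  have hev : ∀ᶠ t : ℝ in 𝓝[>] 0, t < 1 := nhdsWithin_le_nhds (Iio_mem_nhds one_pos)
  refine mem_closure_of_tendsto hlim ?_
  filter_upwards [hev, self_mem_nhdsWithin] with t ht1 ht0
  have ht0 : 0 < t := ht0
  have hsing := isWeight_single (P := P) κ
  have hv : P.IsWeight ((1 - t) • w + t • Pi.single κ 1) := by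
    refine ⟨fun ν => add_nonneg (mul_nonneg (by linarith) (hw.1.nonneg ν))
      (mul_nonneg ht0.le (hsing.nonneg ν)), ?_, fun ν ν' hν hν' => ?_⟩
    · simp [Finset.sum_add_distrib, ← Finset.mul_sum, hw.1.sum_eq]
    · have key : ∀ ν, ((1 - t) • w + t • Pi.single κ 1 : P.cells → ℝ) ν ≠ 0 → ν = κ ∨ w ν ≠ 0 := fun ν hν => by
        by_contra! hn
        simp [hn.1, hn.2] at hν
      rcases key ν hν with rfl | h1 <;> rcases key ν' hν' with rfl | h2
      · simp
      · exact Or.inr (hc _ h2)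
      · exact Or.inl (hc _ h1)
      · exact hw.1.chain _ _ h1 h2
  have hvc : P.CarriedBy ((1 - t) • w + t • Pi.single κ 1) κ := fun ν hν => by
    by_cases h1 : ν = κ
    · exact h1.le
    · refine hc ν fun hz => ?_
      simp [h1, hz] at hν
  refine ⟨hv.comb_mem_interior hvc ?_, (param_mem_star_iff hvc hv).2 ?_⟩
  · exact seg_weight_pos_right hw.1 hsing ⟨ht0.le, ht1.le⟩ ht0 (by simp)
  · exact seg_weight_pos_left hw.1 hsing ⟨ht0.le, ht1.le⟩ ht1 (hw.mem_star_iff.1 hτ)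

end PolyhedralDecomposition

/-! ## Locally affine functions -/

theorem LinearMap.eq_zero_of_eventually {d k : ℕ} (l : (Fin d → ℝ) →ₗ[ℝ] (Fin k → ℝ))
    {c : Fin k → ℝ} {z : Fin d → ℝ} (h : ∀ᶠ y in 𝓝 z, l y + c = 0) : l = 0 ∧ c = 0 := by
  have h1 : HasFDerivAt (fun y => l y) (LinearMap.toContinuousLinearMap l) z :=
    (LinearMap.toContinuousLinearMap l).hasFDerivAt
  have h2 : HasFDerivAt (fun y => l y) (0 : (Fin d → ℝ) →L[ℝ] (Fin k → ℝ)) z := by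
    refine (hasFDerivAt_const (-c) z).congr_of_eventuallyEq ?_
    filter_upwards [h] with y hy using eq_neg_of_add_eq_zero_left hy
  have h3 := h1.unique h2
  have h4 : l = 0 := by
    refine LinearMap.ext fun y => ?_
    exact congrArg (fun f : (Fin d → ℝ) →L[ℝ] (Fin k → ℝ) => f y) h3
  refine ⟨h4, ?_⟩
  have := h.self_of_nhds
  simpa [h4] using this

theorem intMul_congr {a b : ℕ} {A A' : Matrix (Fin b) (Fin a) ℤ}
    (h : ∀ x, intMul A x = intMul A' x) : A = A' := by
  ext i j
  have := congrFun (h (Pi.single j 1)) i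
  simpa [intMul] using this

theorem intMul_add {a b : ℕ} (A : Matrix (Fin b) (Fin a) ℤ) (x y : Fin a → ℝ) :
    intMul A (x + y) = intMul A x + intMul A y := (A.map (Int.cast : ℤ → ℝ)).mulVecLin.map_add x y

theorem intMul_congr_of_eventually {a b : ℕ} {A A' : Matrix (Fin b) (Fin a) ℤ}
    {c c' : Fin b → ℝ} {z : Fin a → ℝ} (h : ∀ᶠ y in 𝓝 z, intMul A y + c = intMul A' y + c') :
    A = A' := by
  have := LinearMap.eq_zero_of_eventually
    ((A.map (Int.cast : ℤ → ℝ)).mulVecLin - (A'.map (Int.cast : ℤ → ℝ)).mulVecLin) (c := c - c')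
    (z := z) (by
      filter_upwards [h] with y hy
      simp only [LinearMap.sub_apply, ← intMul_eq_mulVecLin]
      rw [← sub_eq_zero] at hy
      rw [← hy]; abel)
  exact intMul_congr fun x => by
    have := LinearMap.congr_fun (sub_eq_zero.1 this.1) x
    exact this

/-- `f` is affine near `x` in some coordinate system belonging to `𝒞`. -/
def LocAffAt {X : Type*} [TopologicalSpace X] {d k : ℕ}
    (𝒞 : Set (OpenPartialHomeomorph X (Fin d → ℝ))) (f : X → Fin k → ℝ) (x : X) : Prop :=
  ∃ e ∈ 𝒞, x ∈ e.source ∧ ∃ (l : (Fin d → ℝ) →ₗ[ℝ] (Fin k → ℝ)) (c : Fin k → ℝ),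
    ∀ᶠ y in 𝓝 x, f y = l (e y) + c

section LocAff

variable {X : Type*} [TopologicalSpace X] {d k : ℕ}
  {𝒞 : Set (OpenPartialHomeomorph X (Fin d → ℝ))} {f : X → Fin k → ℝ} {x : X}

theorem OpenPartialHomeomorph.eventually_nhds_image {e : OpenPartialHomeomorph X (Fin d → ℝ)}
    (hx : x ∈ e.source) {p : (Fin d → ℝ) → Prop} (h : ∀ᶠ y in 𝓝 x, p (e y)) :
    ∀ᶠ z in 𝓝 (e x), p z := by
  rw [← e.map_nhds_eq hx]
  exact h

/-- Near `x` one affine expression in one chart is valid; if it vanishes on some open set, its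
linear part and its constant are both zero. -/
theorem LocAffAt.eventually (h : LocAffAt 𝒞 f x) :
    ∀ᶠ x' in 𝓝 x, (∀ᶠ y in 𝓝 x', f y = 0) → ∀ᶠ y in 𝓝 x, f y = 0 := by
  obtain ⟨e, -, hx, l, c, hf⟩ := h
  filter_upwards [hf.eventually_nhds, e.open_source.mem_nhds hx] with x' hx' hsrc h0
  have h1 : ∀ᶠ y in 𝓝 x', l (e y) + c = 0 := by
    filter_upwards [hx', h0] with y h1 h2
    rw [← h1, h2]
  obtain ⟨rfl, rfl⟩ := l.eq_zero_of_eventually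
    (OpenPartialHomeomorph.eventually_nhds_image (p := fun z => l z + c = 0) hsrc h1)
  simpa using hf

/-- Analytic continuation for locally affine functions. -/
theorem LocAffAt.eventually_eq_zero {S : Set X} (hS : IsPreconnected S)
    (h : ∀ x ∈ S, LocAffAt 𝒞 f x) {x₀ : X} (hx₀ : x₀ ∈ S) (h₀ : ∀ᶠ y in 𝓝 x₀, f y = 0) (hx : x ∈ S) :
    ∀ᶠ y in 𝓝 x, f y = 0 := by
  refine hS.induction₂' (fun a b => (∀ᶠ y in 𝓝 a, f y = 0) → ∀ᶠ y in 𝓝 b, f y = 0) (fun a ha => ?_)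
    (fun a b c _ _ _ h1 h2 h => h2 (h1 h)) hx₀ hx h₀
  -- Vanishing of the germ passes from `b` near `a` back to `a` by local affineness, and from `a` to
  -- all `b` near `a` trivially. Connectedness does the rest.
  have h1 := (h a ha).eventually
  refine nhdsWithin_le_nhds ?_
  filter_upwards [h1, eventually_imp_distrib_left.2 fun h : ∀ᶠ y in 𝓝 a, f y = 0 =>
    h.eventually_nhds] with b hb hb' using ⟨hb', hb⟩

end LocAff

theorem IntegralAffineManifold.HasLinearPart.congr {n k : ℕ} {B : Type*} [TopologicalSpace B]
    [ChartedSpace (EuclideanSpace ℝ (Fin n)) B]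
    {f : B → Fin k → ℝ} {e : OpenPartialHomeomorph B (Fin n → ℝ)} {x : B}
    {A A' : Matrix (Fin k) (Fin n) ℤ} (hx : x ∈ e.source)
    (h : IntegralAffineManifold.HasLinearPart f e x A)
    (h' : IntegralAffineManifold.HasLinearPart f e x A') : A = A' := by
  obtain ⟨b, hb⟩ := h
  obtain ⟨b', hb'⟩ := h'
  refine intMul_congr_of_eventually (c := b) (c' := b') (z := e x)
    (OpenPartialHomeomorph.eventually_nhds_image
      (p := fun z => intMul A z + b = intMul A' z + b') hx ?_)
  filter_upwards [hb, hb'] with y h1 h2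
  rw [← h1, h2]

namespace ToricDecomposition

open PolyhedralDecomposition IntegralAffineManifold

variable {n : ℕ} {B : Type*} [TopologicalSpace B] [ChartedSpace (EuclideanSpace ℝ (Fin n)) B]
  {M : IntegralAffineManifold n B} {P : ToricDecomposition M} {τ σ κ : P.cells} {x : B}

/-! ## Parallel transport -/

theorem exists_chart (hx : x ∉ M.Δ) : ∃ e ∈ M.charts, x ∈ e.source := by
  have : x ∈ ⋃ e ∈ M.charts, e.source := by rw [M.cover_reg]; exact hx
  simpa using this

theorem not_mem_sing (hκ : P.IsMaxCell κ) (hx : x ∈ P.Int κ) : x ∉ M.Δ :=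
  fun h => (P.max_regular κ hκ).le_bot ⟨hx, h⟩

theorem exists_local_linear (hκ : P.IsMaxCell κ) {y : Fin (P.dim κ) → ℝ}
    (hy : y ∈ interior (P.poly κ)) (hτ : P.param κ y ∈ P.W τ) :
    ∃ (A : Matrix (Fin (n - P.dim τ)) (Fin (P.dim κ)) ℤ)
      (A' : Matrix (Fin (P.dim κ)) (Fin (n - P.dim τ)) ℤ) (c : Fin (n - P.dim τ) → ℝ),
      A * A' = 1 ∧ ∀ᶠ y' in 𝓝 y, P.S τ (P.param κ y') = intMul A y' + c := by
  have hz := (P.param_mem_relInt_iff κ (interior_subset hy)).2 hy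
  obtain ⟨e, he, hsrc⟩ := exists_chart (not_mem_sing hκ hz)
  obtain ⟨A₁, A₁', b₁, -, h₁, h₂⟩ := P.max_affine κ hκ e he y hy hsrc
  obtain ⟨A₂, A₂', h₃, b₂, h₄⟩ := P.S_submersion τ e he _ ⟨hτ, hsrc⟩
  have hcont : ContinuousAt (P.param κ) y :=
    (P.param_continuousOn κ).continuousAt (mem_interior_iff_mem_nhds.1 hy)
  refine ⟨A₂ * A₁, A₁' * A₂', intMul A₂ b₁ + b₂, ?_, ?_⟩
  · rw [Matrix.mul_assoc, ← Matrix.mul_assoc A₁, h₁, Matrix.one_mul, h₃]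
  · filter_upwards [h₂, hcont.eventually h₄] with y' h5 h6
    rw [h6, h5, intMul_add, intMul_mul, add_assoc]

/-- The map `S_τ` is affine on a maximal cell. -/
theorem exists_linear (h : τ ≤ κ) (hκ : P.IsMaxCell κ) :
    ∃ (A : Matrix (Fin (n - P.dim τ)) (Fin (P.dim κ)) ℤ)
      (A' : Matrix (Fin (P.dim κ)) (Fin (n - P.dim τ)) ℤ) (c : Fin (n - P.dim τ) → ℝ),
      A * A' = 1 ∧ ∀ y ∈ P.poly κ, P.param κ y ∈ P.W τ → P.S τ (P.param κ y) = intMul A y + c := by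
  -- On the connected set `D` the map is locally affine, so the formula found at the midpoint
  -- `edgePt τ κ` continues over `D`; density of `D` and continuity of `S τ` extend it to the
  -- boundary of the cell.
  let D := {y | y ∈ interior (P.poly κ) ∧ P.param κ y ∈ P.W τ}
  obtain ⟨w, hw, hs⟩ := exists_hasWeight_edgePt (P := P.toPolyhedralDecomposition) h
  have hm : P.edgePt τ κ ∈ P.Int κ := hw.mem_relInt_iff.2 ⟨(hs κ).2 (Or.inr rfl), fun ν hν => by
    rcases (hs ν).1 hν with rfl | rfl
    exacts [h, le_rfl]⟩
  obtain ⟨hy₁, hy₂⟩ := P.coord_spec κ (mem_relInt_iff.1 hm).1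
  have hy₀ : P.coord κ (P.edgePt τ κ) ∈ D := by
    refine ⟨(P.param_mem_relInt_iff κ hy₁).1 (by rwa [hy₂]), ?_⟩
    rw [hy₂]; exact hw.mem_star_iff.2 ((hs τ).2 (Or.inl rfl))
  obtain ⟨A, A', c, hA, hloc⟩ := exists_local_linear hκ hy₀.1 hy₀.2
  refine ⟨A, A', c, hA, ?_⟩
  let f : (Fin (P.dim κ) → ℝ) → Fin (n - P.dim τ) → ℝ :=
    fun y => P.S τ (P.param κ y) - (intMul A y + c)
  have hD : ∀ y ∈ D, LocAffAt {OpenPartialHomeomorph.refl _} f y := fun y hy => by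
    obtain ⟨A₁, -, c₁, -, h₁⟩ := exists_local_linear hκ hy.1 hy.2
    refine ⟨_, rfl, by simp, (A₁.map (Int.cast : ℤ → ℝ)).mulVecLin -
      (A.map (Int.cast : ℤ → ℝ)).mulVecLin, c₁ - c, ?_⟩
    filter_upwards [h₁] with y' hy'
    simp only [f, hy', intMul_eq_mulVecLin, LinearMap.sub_apply, OpenPartialHomeomorph.refl_apply,
      id_eq]
    abel
  have hzero : ∀ y ∈ D, ∀ᶠ y' in 𝓝 y, f y' = 0 := fun y hy =>
    LocAffAt.eventually_eq_zero (isPreconnected_interior_star h) hD hy₀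
      (by filter_upwards [hloc] with y' hy'; simp [f, hy']) hy
  have hEq : EqOn (fun y => P.S τ (P.param κ y)) (fun y => intMul A y + c) D := fun y hy =>
    sub_eq_zero.1 (hzero y hy).self_of_nhds
  have hEq' := hEq.of_subset_closure (t := {y | y ∈ P.poly κ ∧ P.param κ y ∈ P.W τ})
    ((P.S_continuousOn τ).comp ((P.param_continuousOn κ).mono fun y hy => hy.1) fun y hy => hy.2)
    ((continuous_intMul A).add continuous_const).continuousOn
    (fun y hy => ⟨interior_subset hy.1, hy.2⟩)
    (fun y hy => mem_closure_interior_star hy.1 hy.2)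
  exact fun y h1 h2 => hEq' ⟨h1, h2⟩

/-- The linear part of `S_σ` on a maximal cell kills the tangent vectors of `σ`. -/
theorem linear_comp_face (h : σ ≤ κ) {A : Matrix (Fin (n - P.dim σ)) (Fin (P.dim κ)) ℤ}
    {c : Fin (n - P.dim σ) → ℝ}
    (hA : ∀ y ∈ P.poly κ, P.param κ y ∈ P.W σ → P.S σ (P.param κ y) = intMul A y + c)
    {N : Matrix (Fin (P.dim κ)) (Fin (P.dim σ)) ℤ} {b : Fin (P.dim κ) → ℝ}
    (hN : ∀ x ∈ (σ : Set B), P.coord κ x = intMul N (P.coord σ x) + b) (u : Fin (P.dim σ) → ℝ) :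
    intMul A (intMul N u) = 0 := by
  -- `S σ` is zero on the interior of `σ`, so its affine expression in the coordinates of `σ`
  -- vanishes on an open set.
  have key : ∀ᶠ y in 𝓝 (polytopeBary (P.poly σ)),
      (A.map (Int.cast : ℤ → ℝ)).mulVecLin.comp (N.map (Int.cast : ℤ → ℝ)).mulVecLin y +
        (intMul A b + c) = 0 := by
    filter_upwards [isOpen_interior.mem_nhds (P.polytopeBary_mem σ)] with y hy
    have hyp := interior_subset hy
    have hmem := P.param_mem σ hyp
    have hW : P.param σ y ∈ P.W σ :=
      relInt_subset_star ((P.param_mem_relInt_iff σ hyp).2 hy)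
    obtain ⟨h1, h2⟩ := P.coord_spec κ (h hmem)
    have h3 := hA _ h1 (by rwa [h2])
    rw [h2, P.S_zero σ _ ⟨hmem, hW⟩, hN _ hmem, P.coord_param σ hyp, intMul_add] at h3
    rw [← add_assoc]
    exact h3.symm
  exact LinearMap.congr_fun (LinearMap.eq_zero_of_eventually _ key).1 u

/-- The kernel of the linear part of `S τ` contains the tangent space of `τ`, and equals it by a
dimension count. Tangent vectors of `τ` are tangent to `σ`, hence killed by the linear part of `S
σ`. -/
theorem ker_linear_le (hτσ : τ ≤ σ) (hσκ : σ ≤ κ) (hκ : P.IsMaxCell κ)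
    {A : Matrix (Fin (n - P.dim τ)) (Fin (P.dim κ)) ℤ}
    {A' : Matrix (Fin (P.dim κ)) (Fin (n - P.dim τ)) ℤ} {c : Fin (n - P.dim τ) → ℝ}
    (hAA' : A * A' = 1)
    (hA : ∀ y ∈ P.poly κ, P.param κ y ∈ P.W τ → P.S τ (P.param κ y) = intMul A y + c)
    {A₂ : Matrix (Fin (n - P.dim σ)) (Fin (P.dim κ)) ℤ} {c₂ : Fin (n - P.dim σ) → ℝ}
    (hA₂ : ∀ y ∈ P.poly κ, P.param κ y ∈ P.W σ → P.S σ (P.param κ y) = intMul A₂ y + c₂)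
    {v : Fin (P.dim κ) → ℝ} (hv : intMul A v = 0) : intMul A₂ v = 0 := by
  obtain ⟨N, N', b, hN, hNc⟩ := exists_coord_affine (hτσ.trans hσκ)
  obtain ⟨N₂, -, b₂, -, hNc₂⟩ := exists_coord_affine hσκ
  obtain ⟨N₃, -, b₃, -, hNc₃⟩ := exists_coord_affine hτσ
  let lA := (A.map (Int.cast : ℤ → ℝ)).mulVecLin
  let lN := (N.map (Int.cast : ℤ → ℝ)).mulVecLin
  have hinj : Function.Injective lN := fun x y hxy => by
    rw [← intMul_leftInverse hN x, ← intMul_leftInverse hN y]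
    exact congrArg _ hxy
  have hsurj : LinearMap.range lA = ⊤ := LinearMap.range_eq_top.2 fun y =>
    ⟨intMul A' y, intMul_leftInverse hAA' y⟩
  have hle : LinearMap.range lN ≤ LinearMap.ker lA := by
    rintro _ ⟨u, rfl⟩
    exact linear_comp_face (hτσ.trans hσκ) hA hNc u
  have hdim : Module.finrank ℝ (LinearMap.range lN) = Module.finrank ℝ (LinearMap.ker lA) := by
    have h1 := lA.finrank_range_add_finrank_ker
    rw [hsurj, finrank_top] at h1
    rw [LinearMap.finrank_range_of_inj hinj]
    simp only [Module.finrank_fin_fun] at h1 ⊢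
    -- The subtraction `n - P.dim τ` is truncated, so the count needs `dim τ ≤ n`.
    have h2 := P.dim_le τ
    have h3 : P.dim κ = n := hκ
    omega
  have hv' : v ∈ LinearMap.range lN := by
    rw [Submodule.eq_of_le_of_finrank_eq hle hdim]; exact hv
  obtain ⟨u, rfl⟩ := hv'
  -- The inclusion of `τ` in `κ` agrees with the composite through `σ` near the barycentre of `τ`,
  -- so the linear parts agree.
  have hcomp : intMul N u = intMul N₂ (intMul N₃ u) := by
    have key : ∀ᶠ y in 𝓝 (polytopeBary (P.poly τ)),
        (lN - (N₂.map (Int.cast : ℤ → ℝ)).mulVecLin.comp (N₃.map (Int.cast : ℤ → ℝ)).mulVecLin) y +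
          (b - (intMul N₂ b₃ + b₂)) = 0 := by
      filter_upwards [isOpen_interior.mem_nhds (P.polytopeBary_mem τ)] with y hy
      have hyp := interior_subset hy
      have hmem := P.param_mem τ hyp
      have h1 := hNc _ hmem
      rw [hNc₂ _ (hτσ hmem), hNc₃ _ hmem, P.coord_param τ hyp, intMul_add] at h1
      rw [← sub_eq_zero] at h1
      simp only [lN, LinearMap.sub_apply, LinearMap.comp_apply, ← intMul_eq_mulVecLin]
      rw [← neg_eq_zero, ← h1]
      abel
    exact sub_eq_zero.1 (LinearMap.congr_fun (LinearMap.eq_zero_of_eventually _ key).1 u)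
  change intMul A₂ (intMul N u) = 0
  rw [hcomp]
  exact linear_comp_face hσκ hA₂ hNc₂ _

/-- On the regular part of `W_τ ∩ W_σ`, the map `S_σ` factors through `S_τ`. -/
theorem exists_factor [T2Space B] (h : τ ≤ σ) :
    ∃ (p : Matrix (Fin (n - P.dim σ)) (Fin (n - P.dim τ)) ℤ) (c : Fin (n - P.dim σ) → ℝ),
      ∀ x ∈ (P.W τ ∩ P.W σ) \ M.Δ, ∀ᶠ y in 𝓝 x, P.S σ y = intMul p (P.S τ y) + c := by
  classical
  obtain ⟨κ, hσκ, hκ⟩ := P.pure σ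
  obtain ⟨A, A', c, hAA', hA⟩ := exists_linear (h.trans hσκ) hκ
  obtain ⟨A₂, -, c₂, -, hA₂⟩ := exists_linear hσκ hκ
  -- As `A * A' = 1`, the vector `v - A' A v` lies in the kernel of `A`, hence in that of `A₂`. So
  -- `A₂` factors through `A` by the integral matrix `A₂ * A'`.
  have hfac : ∀ v, intMul A₂ v = intMul (A₂ * A') (intMul A v) := fun v => by
    have h1 : intMul A (v - intMul A' (intMul A v)) = 0 := by
      have h2 := intMul_leftInverse hAA' (intMul A v)
      have h3 := intMul_add A (v - intMul A' (intMul A v)) (intMul A' (intMul A v))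
      rw [sub_add_cancel, h2] at h3
      exact right_eq_add.1 h3
    have h4 := ker_linear_le h hσκ hκ hAA' hA hA₂ h1
    have h5 := intMul_add A₂ (v - intMul A' (intMul A v)) (intMul A' (intMul A v))
    rwa [sub_add_cancel, h4, zero_add, ← intMul_mul] at h5
  refine ⟨A₂ * A', c₂ - intMul (A₂ * A') c, ?_⟩
  -- Starting point of the continuation: `z` lies in both stars and in the open cell `Int κ`, where
  -- the factorization is already known.
  obtain ⟨w, z, hz, hs⟩ := exists_hasWeight_chain (P := P.toPolyhedralDecomposition)
    {τ, σ, κ} (by simp) (by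
      have := h.trans hσκ
      simp only [Finset.mem_insert, Finset.mem_singleton]
      rintro a (rfl | rfl | rfl) b (rfl | rfl | rfl) <;> simp [*])
  have hzτ : z ∈ P.W τ := hz.mem_star_iff.2 ((hs τ).2 (by simp))
  have hzσ : z ∈ P.W σ := hz.mem_star_iff.2 ((hs σ).2 (by simp))
  have hzκ : z ∈ P.Int κ := hz.mem_relInt_iff.2 ⟨(hs κ).2 (by simp), fun ν hν => by
    have := (hs ν).1 hν
    simp only [Finset.mem_insert, Finset.mem_singleton] at this
    rcases this with rfl | rfl | rfl
    exacts [h.trans hσκ, hσκ, le_rfl]⟩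
  let f : B → Fin (n - P.dim σ) → ℝ :=
    fun y => P.S σ y - (intMul (A₂ * A') (P.S τ y) + (c₂ - intMul (A₂ * A') c))
  have hf₀ : ∀ᶠ y in 𝓝 z, f y = 0 := by
    filter_upwards [(P.isOpen_star τ).mem_nhds hzτ, (P.isOpen_star σ).mem_nhds hzσ,
      (isOpen_relInt hκ).mem_nhds hzκ] with y h1 h2 h3
    obtain ⟨h4, h5⟩ := P.coord_spec κ (mem_relInt_iff.1 h3).1
    have h6 := hA _ h4 (by rwa [h5])
    have h7 := hA₂ _ h4 (by rwa [h5])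
    rw [h5] at h6 h7
    simp only [f]
    rw [h6, h7, intMul_add, hfac]
    abel
  have hconn := M.codim_two _ ((P.isOpen_star τ).inter (P.isOpen_star σ))
    (isPreconnected_star_inter h)
  have hloc : ∀ x ∈ (P.W τ ∩ P.W σ) \ M.Δ, LocAffAt M.charts f x := fun x hx => by
    obtain ⟨e, he, hsrc⟩ := exists_chart hx.2
    obtain ⟨B₁, -, -, b₁, h₁⟩ := P.S_submersion τ e he x ⟨hx.1.1, hsrc⟩
    obtain ⟨B₂, -, -, b₂, h₂⟩ := P.S_submersion σ e he x ⟨hx.1.2, hsrc⟩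
    refine ⟨e, he, hsrc, (B₂.map (Int.cast : ℤ → ℝ)).mulVecLin -
      ((A₂ * A').map (Int.cast : ℤ → ℝ)).mulVecLin.comp (B₁.map (Int.cast : ℤ → ℝ)).mulVecLin,
      b₂ - intMul (A₂ * A') b₁ - (c₂ - intMul (A₂ * A') c), ?_⟩
    filter_upwards [h₁, h₂] with y h3 h4
    simp only [f, h3, h4, intMul_add, LinearMap.sub_apply, LinearMap.comp_apply,
      ← intMul_eq_mulVecLin]
    abel
  intro x hx
  filter_upwards [LocAffAt.eventually_eq_zero hconn hloc
    ⟨⟨hzτ, hzσ⟩, not_mem_sing hκ hzκ⟩ hf₀ hx] with y hy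
  exact sub_eq_zero.1 hy

theorem isTransport_of_factor {p : Matrix (Fin (n - P.dim σ)) (Fin (n - P.dim τ)) ℤ}
    {c : Fin (n - P.dim σ) → ℝ}
    (hp : ∀ x ∈ (P.W τ ∩ P.W σ) \ M.Δ, ∀ᶠ y in 𝓝 x, P.S σ y = intMul p (P.S τ y) + c) :
    P.IsTransport τ σ p := by
  intro e he x hx A A' hA hA'
  have hΔ : x ∉ M.Δ := by
    have : x ∈ ⋃ e ∈ M.charts, e.source := mem_biUnion he hx.2
    rwa [M.cover_reg] at this
  refine hA'.congr hx.2 ?_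
  obtain ⟨b, hb⟩ := hA
  refine ⟨intMul p b + c, ?_⟩
  filter_upwards [hb, hp x ⟨hx.1, hΔ⟩] with y h1 h2
  rw [h2, h1, intMul_add, intMul_mul, add_assoc]

/-- Adding to the chain a maximal cell above it moves the test point into the interior of that cell,
which avoids `Δ`. -/
theorem exists_regular_point (c : Finset P.cells) (hne : c.Nonempty)
    (hc : ∀ κ ∈ c, ∀ κ' ∈ c, κ ≤ κ' ∨ κ' ≤ κ) : ∃ x ∉ M.Δ, ∀ κ ∈ c, x ∈ P.W κ := by
  classical
  obtain ⟨w, x₀, hz, hs⟩ := exists_hasWeight_chain (P := P.toPolyhedralDecomposition) c hne hc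
  obtain ⟨ρ, hρ, hcar⟩ := hz.1.exists_top
  obtain ⟨κ, hle, hκ⟩ := P.pure ρ
  have hle' : ∀ ν ∈ c, ν ≤ κ := fun ν hν => (hcar ν ((hs ν).2 hν)).trans hle
  obtain ⟨w', x, hx, hs'⟩ := exists_hasWeight_chain (P := P.toPolyhedralDecomposition)
    (insert κ c) (by simp) (by
      intro a ha b hb
      rcases Finset.mem_insert.1 ha with rfl | h1 <;> rcases Finset.mem_insert.1 hb with rfl | h2
      · simp
      · exact Or.inr (hle' _ h2)
      · exact Or.inl (hle' _ h1)
      · exact hc a h1 b h2)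
  refine ⟨x, not_mem_sing hκ (hx.mem_relInt_iff.2 ⟨(hs' κ).2 (by simp), fun ν hν => ?_⟩),
    fun ν hν => hx.mem_star_iff.2 ((hs' ν).2 (by simp [hν]))⟩
  rcases Finset.mem_insert.1 ((hs' ν).1 hν) with rfl | h
  exacts [le_rfl, hle' _ h]

theorem right_cancel {a b c : ℕ} {p p' : Matrix (Fin a) (Fin b) ℤ} {A : Matrix (Fin b) (Fin c) ℤ}
    {A' : Matrix (Fin c) (Fin b) ℤ} (hA : A * A' = 1) (h : p * A = p' * A) : p = p' := by
  rw [← Matrix.mul_one p, ← Matrix.mul_one p', ← hA, ← Matrix.mul_assoc, ← Matrix.mul_assoc, h]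

theorem IsTransport.unique (h : τ ≤ σ)
    {p p' : Matrix (Fin (n - P.dim σ)) (Fin (n - P.dim τ)) ℤ}
    (hp : P.IsTransport τ σ p) (hp' : P.IsTransport τ σ p') : p = p' := by
  classical
  obtain ⟨x, hx, hW⟩ := exists_regular_point (P := P) {τ, σ} (by simp) (by
      simp only [Finset.mem_insert, Finset.mem_singleton]
      rintro a (rfl | rfl) b (rfl | rfl) <;> simp [*])
  obtain ⟨e, he, hsrc⟩ := exists_chart hx
  have hτ := hW τ (by simp)
  have hσ := hW σ (by simp)
  obtain ⟨A, A', hAA', hA⟩ := P.S_submersion τ e he x ⟨hτ, hsrc⟩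
  obtain ⟨A₂, -, -, hA₂⟩ := P.S_submersion σ e he x ⟨hσ, hsrc⟩
  refine right_cancel hAA' ?_
  rw [← hp e he x ⟨⟨hτ, hσ⟩, hsrc⟩ A A₂ hA hA₂, ← hp' e he x ⟨⟨hτ, hσ⟩, hsrc⟩ A A₂ hA hA₂]

theorem IsTransport.trans_eq (h : τ ≤ σ) {p : Matrix (Fin (n - P.dim σ)) (Fin (n - P.dim τ)) ℤ}
    (hp : P.IsTransport τ σ p) : P.trans τ σ = Matrix.mulVecLin p := by
  have hex : ∃ p, P.IsTransport τ σ p := ⟨p, hp⟩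
  rw [trans, dif_pos hex, hex.choose_spec.unique h hp]

theorem exists_trans [T2Space B] (h : τ ≤ σ) :
    ∃ (p : Matrix (Fin (n - P.dim σ)) (Fin (n - P.dim τ)) ℤ) (c : Fin (n - P.dim σ) → ℝ),
      P.trans τ σ = Matrix.mulVecLin p ∧ P.IsTransport τ σ p ∧
      ∀ x ∈ (P.W τ ∩ P.W σ) \ M.Δ, ∀ᶠ y in 𝓝 x, P.S σ y = intMul p (P.S τ y) + c := by
  obtain ⟨p, c, hp⟩ := exists_factor h
  exact ⟨p, c, (isTransport_of_factor hp).trans_eq h, isTransport_of_factor hp, hp⟩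

theorem trans_self (τ : P.cells) : P.trans τ τ = LinearMap.id := by
  have h : P.IsTransport τ τ 1 := fun e he x hx A A' hA hA' => by
    rw [Matrix.one_mul, hA.congr hx.2 hA']
  rw [h.trans_eq le_rfl, Matrix.mulVecLin_one]

/-- At one regular point of the three stars all transports are read off from linear parts of `S`;
that of `S τ` has a right inverse and can be cancelled. -/
theorem trans_comp [T2Space B] (h : τ ≤ σ) (h' : σ ≤ κ) :
    P.trans σ κ ∘ₗ P.trans τ σ = P.trans τ κ := by
  classical
  obtain ⟨p, -, hp, hpt, -⟩ := exists_trans h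
  obtain ⟨q, -, hq, hqt, -⟩ := exists_trans h'
  obtain ⟨r, -, hr, hrt, -⟩ := exists_trans (h.trans h')
  obtain ⟨x, hx, hW⟩ := exists_regular_point (P := P) {τ, σ, κ} (by simp) (by
      have := h.trans h'
      simp only [Finset.mem_insert, Finset.mem_singleton]
      rintro a (rfl | rfl | rfl) b (rfl | rfl | rfl) <;> simp [*])
  obtain ⟨e, he, hsrc⟩ := exists_chart hx
  have hτ := hW τ (by simp)
  have hσ := hW σ (by simp)
  have hκ := hW κ (by simp)
  obtain ⟨A, A', hAA', hA⟩ := P.S_submersion τ e he x ⟨hτ, hsrc⟩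
  obtain ⟨A₂, -, -, hA₂⟩ := P.S_submersion σ e he x ⟨hσ, hsrc⟩
  obtain ⟨A₃, -, -, hA₃⟩ := P.S_submersion κ e he x ⟨hκ, hsrc⟩
  have h1 := hpt e he x ⟨⟨hτ, hσ⟩, hsrc⟩ A A₂ hA hA₂
  have h2 := hqt e he x ⟨⟨hσ, hκ⟩, hsrc⟩ A₂ A₃ hA₂ hA₃
  have h3 := hrt e he x ⟨⟨hτ, hκ⟩, hsrc⟩ A A₃ hA hA₃
  rw [hp, hq, hr, ← Matrix.mulVecLin_mul]
  congr 1
  refine right_cancel hAA' ?_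
  rw [Matrix.mul_assoc, ← h1, ← h2, h3]

theorem transC_self (τ : P.cells) (s : P.QC τ) : P.transC τ τ s = s := by
  rw [transC, trans_self, LinearMap.rTensor_id]; rfl

end ToricDecomposition

namespace ToricDecomposition

open PolyhedralDecomposition AbPresheaf

variable {n : ℕ} {B : Type*} [TopologicalSpace B] [ChartedSpace (EuclideanSpace ℝ (Fin n)) B]
  {M : IntegralAffineManifold n B} {P : ToricDecomposition M} {τ σ κ : P.cells} {x x₀ : B}
  {w w₀ : P.cells → ℝ}

/-! ## Values of sections of `𝒬_𝒫 ⊗ ℂˣ` -/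

/-- Sections are transported along segments of the barycentric subdivision. -/
theorem section_transport {U : Set B} (u : P.sections U) (h₀ : P.HasWeight w₀ x₀)
    (h : P.HasWeight w x) (hs : ∀ κ, w₀ κ ≠ 0 → w κ ≠ 0)
    (hU : ∀ y v, P.HasWeight v y → (∀ κ, w₀ κ ≠ 0 → v κ ≠ 0) → y ∈ U)
    (hx₀ : x₀ ∈ U ∩ P.Int τ) (hx : x ∈ U ∩ P.Int σ) :
    u.1 σ ⟨x, hx⟩ = P.transC τ σ (u.1 τ ⟨x₀, hx₀⟩) := by
  classical
  obtain ⟨hσ, hc⟩ := h.mem_relInt_iff.1 hx.2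
  have hc₀ : P.CarriedBy w₀ σ := fun κ hκ => hc κ (hs κ hκ)
  let g := seg σ w₀ w
  have hg : ContinuousOn g (Icc 0 1) := continuousOn_seg h₀.1 h.1 hs hc
  have hg0 : g 0 = x₀ := by simpa [g, seg] using h₀.param_comb hc₀
  have hg1 : g 1 = x := by simpa [g, seg] using h.param_comb hc
  have hgw : ∀ {t}, t ∈ Icc (0 : ℝ) 1 → P.HasWeight ((1 - t) • w₀ + t • w) (g t) :=
    fun ht => hasWeight_seg h₀.1 h.1 hs hc ht
  have hgU : ∀ t ∈ Icc (0 : ℝ) 1, g t ∈ U := fun t ht => by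
    refine hU _ _ (hgw ht) fun κ hκ => ?_
    rcases ht.2.lt_or_eq with h1 | h1
    · exact seg_weight_pos_left h₀.1 h.1 ht h1 hκ
    · exact seg_weight_pos_right h₀.1 h.1 ht (by linarith) (hs κ hκ)
  have hgI : ∀ t ∈ Ioc (0 : ℝ) 1, g t ∈ U ∩ P.Int σ := fun t ht => by
    have ht' : t ∈ Icc (0 : ℝ) 1 := ⟨ht.1.le, ht.2⟩
    refine ⟨hgU t ht', (hgw ht').mem_relInt_iff.2 ⟨seg_weight_pos_right h₀.1 h.1 ht' ht.1 hσ,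
      fun ν hν => hc ν fun hz => ?_⟩⟩
    have : w₀ ν = 0 := by by_contra hn; exact hs ν hn hz
    simp [hz, this] at hν
  let F : ℝ → P.QC σ := fun t => if ht : g t ∈ U ∩ P.Int σ then u.1 σ ⟨g t, ht⟩ else 0
  have hF : ∀ t (ht : g t ∈ U ∩ P.Int σ), F t = u.1 σ ⟨g t, ht⟩ := fun t ht => dif_pos ht
  -- For `t > 0` the segment stays in `Int σ`, where the generization map is the identity, so the
  -- value is locally constant. The limit `t → 0` then uses the section condition at `x₀`, which is
  -- where `transC τ σ` enters.
  have hconst : ∀ a ∈ Ioc (0 : ℝ) 1, F 1 = F a := by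
    intro a ha
    refine isPreconnected_Ioc.induction₂ (fun a b => F a = F b) (fun a ha => ?_)
      (fun _ _ _ _ _ _ h1 h2 => h1.trans h2) (fun _ _ _ _ h => h.symm) ⟨one_pos, le_rfl⟩ ha
    have hcont : ContinuousWithinAt g (Ioc 0 1) a :=
      (hg a ⟨ha.1.le, ha.2⟩).mono Ioc_subset_Icc_self
    filter_upwards [hcont.eventually (u.2 σ ⟨g a, hgI a ha⟩), self_mem_nhdsWithin] with b hb hb'
    rw [hF a (hgI a ha), hF b (hgI b hb'), hb σ (hgI b hb'), transC_self]
  have hcont : ContinuousWithinAt g (Ioc 0 1) 0 :=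
    (hg 0 ⟨le_rfl, zero_le_one⟩).mono Ioc_subset_Icc_self
  have hev : ∀ᶠ y in 𝓝 (g 0), ∀ (σ : P.cells) (hy : y ∈ U ∩ P.Int σ),
      u.1 σ ⟨y, hy⟩ = P.transC τ σ (u.1 τ ⟨x₀, hx₀⟩) := by
    rw [hg0]; exact u.2 τ ⟨x₀, hx₀⟩
  have hne : (𝓝[Ioc (0 : ℝ) 1] 0).NeBot := by
    rw [nhdsWithin_Ioc_eq_nhdsGT one_pos]; infer_instance
  obtain ⟨a, h1, h2⟩ := ((hcont.eventually hev).and self_mem_nhdsWithin).exists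
  have h3 := h1 σ (hgI a h2)
  rw [← hF, ← hconst a h2, hF 1 (by rwa [hg1])] at h3
  rw [← h3]
  exact congrArg (u.1 σ) (Subtype.ext hg1.symm)

open Classical in
/-- The value at `x`, in the stalk `𝒬_σ ⊗ ℂˣ`, of the component of a cochain along a chain. -/
noncomputable def val {p : ℕ} (s : P.QSheaf.Cochain P.W p) (c : Fin (p + 1) →o P.cells)
    (σ : P.cells) (x : B) : P.QC σ :=
  if hx : x ∈ (⋂ i, P.W (c i)) ∩ P.Int σ then (s c).1 σ ⟨x, hx⟩ else 0

theorem val_eq {p : ℕ} (s : P.QSheaf.Cochain P.W p) (c : Fin (p + 1) →o P.cells)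
    (hx : x ∈ (⋂ i, P.W (c i)) ∩ P.Int σ) : val s c σ x = (s c).1 σ ⟨x, hx⟩ := dif_pos hx

theorem val_add {p : ℕ} (s t : P.QSheaf.Cochain P.W p) (c : Fin (p + 1) →o P.cells) :
    val (s + t) c σ x = val s c σ x + val t c σ x := by
  unfold val
  split_ifs
  · rfl
  · simp

theorem edgeValue_eq (s : P.QSheaf.Cochain P.W 1) (h : τ ≤ σ) :
    P.edgeValue s h = val s (edge h) σ (P.edgePt τ σ) := rfl

theorem edgeValue_add (s t : P.QSheaf.Cochain P.W 1) (h : τ ≤ σ) :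
    P.edgeValue (s + t) h = P.edgeValue s h + P.edgeValue t h := by
  simp only [edgeValue_eq, val_add]

/-- Evaluation of sections at a point. -/
def evalHom {U : Set B} (σ : P.cells) (x : ↥(U ∩ P.Int σ)) : P.QSheaf.sec U →+ P.QC σ where
  toFun u := Subtype.val (p := (· ∈ P.sections U)) u σ x
  map_zero' := rfl
  map_add' _ _ := rfl

theorem val_cechD {p : ℕ} (s : P.QSheaf.Cochain P.W p) (c : Fin (p + 2) →o P.cells)
    (hx : x ∈ (⋂ i, P.W (c i)) ∩ P.Int σ) :
    val (P.QSheaf.cechD P.W p s) c σ x =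
      ∑ j : Fin (p + 2), (-1 : ℤ) ^ (j : ℕ) • val s (chainFace c j) σ x := by
  have h1 : val (P.QSheaf.cechD P.W p s) c σ x = evalHom σ ⟨x, hx⟩ (P.QSheaf.cechD P.W p s c) :=
    val_eq _ _ hx
  rw [h1]
  change evalHom σ ⟨x, hx⟩ (∑ j : Fin (p + 2), _) = _
  rw [map_sum]
  refine Finset.sum_congr rfl fun j _ => ?_
  rw [map_zsmul, val_eq s _ ⟨iInter_subset_chainFace P.W c j hx.1, hx.2⟩]
  rfl

/-- Since the support of `x₀` is exactly the chain, every point whose support contains it lies in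
the overlap, so the whole segment from `x₀` to `x` does. -/
theorem val_transport {p : ℕ} (s : P.QSheaf.Cochain P.W p) (c : Fin (p + 1) →o P.cells)
    (h₀ : P.HasWeight w₀ x₀) (hs₀ : ∀ κ, w₀ κ ≠ 0 ↔ κ ∈ range c) (h : P.HasWeight w x)
    (hs : ∀ i, w (c i) ≠ 0) (hx₀ : x₀ ∈ P.Int τ) (hx : x ∈ P.Int σ) :
    val s c σ x = P.transC τ σ (val s c τ x₀) := by
  have hU : ∀ y v, P.HasWeight v y → (∀ κ, w₀ κ ≠ 0 → v κ ≠ 0) → y ∈ ⋂ i, P.W (c i) :=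
    fun y v hv hv₀ => mem_iInter.2 fun i => hv.mem_star_iff.2 (hv₀ _ ((hs₀ _).2 ⟨i, rfl⟩))
  have hs' : ∀ κ, w₀ κ ≠ 0 → w κ ≠ 0 := fun κ hκ => by
    obtain ⟨i, rfl⟩ := (hs₀ κ).1 hκ
    exact hs i
  rw [val_eq s c ⟨hU _ _ h₀ fun _ => id, hx₀⟩, val_eq s c ⟨hU _ _ h hs', hx⟩]
  exact section_transport _ h₀ h hs' hU _ _

/-- The single element `edgeValue` determines the section on all of `W_τ ∩ W_σ`. -/
theorem val_edge (s : P.QSheaf.Cochain P.W 1) (h : τ ≤ σ) (hw : P.HasWeight w x) (hτ : w τ ≠ 0)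
    (hσ : w σ ≠ 0) (hx : x ∈ P.Int κ) :
    val s (edge h) κ x = P.transC σ κ (P.edgeValue s h) := by
  obtain ⟨w₀, h₀, hs₀⟩ := exists_hasWeight_edgePt (P := P.toPolyhedralDecomposition) h
  refine val_transport s (edge h) h₀ (fun κ => ?_) hw (fun i => ?_) ?_ hx
  · rw [hs₀]
    constructor
    · rintro (rfl | rfl)
      exacts [⟨0, rfl⟩, ⟨1, rfl⟩]
    · rintro ⟨i, rfl⟩
      fin_cases i
      exacts [Or.inl rfl, Or.inr rfl]
  · fin_cases i
    exacts [hτ, hσ]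
  · exact h₀.mem_relInt_iff.2 ⟨(hs₀ σ).2 (Or.inr rfl), fun ν hν => by
      rcases (hs₀ ν).1 hν with rfl | rfl
      exacts [h, le_rfl]⟩

/-- The cocycle condition in terms of the elements `s_e`. -/
theorem edgeValue_cocycle {s : P.QSheaf.Cochain P.W 1} (hs : s ∈ P.QSheaf.cocycles P.W 1)
    {τ₁ τ₂ τ₃ : P.cells} (h₁₂ : τ₁ ≤ τ₂) (h₂₃ : τ₂ ≤ τ₃) :
    P.edgeValue s (h₁₂.trans h₂₃) =
      P.edgeValue s h₂₃ + P.transC τ₂ τ₃ (P.edgeValue s h₁₂) := by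
  classical
  let c : Fin 3 →o P.cells :=
    ⟨![τ₁, τ₂, τ₃], by
      have := h₁₂.trans h₂₃
      intro i j hij
      fin_cases i <;> fin_cases j <;> simp_all⟩
  -- The cocycle identity is evaluated at a point of `Int τ₃` in the triple overlap. There only
  -- `s_{g₁}`, whose own value lives over `τ₂`, has to be transported.
  obtain ⟨w, x, hx, hw⟩ := exists_hasWeight_chain (P := P.toPolyhedralDecomposition)
    {τ₁, τ₂, τ₃} (by simp) (by
      have := h₁₂.trans h₂₃
      simp only [Finset.mem_insert, Finset.mem_singleton]
      rintro a (rfl | rfl | rfl) b (rfl | rfl | rfl) <;> simp [*])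
  have hw₁ := (hw τ₁).2 (by simp)
  have hw₂ := (hw τ₂).2 (by simp)
  have hw₃ := (hw τ₃).2 (by simp)
  have hxI : x ∈ P.Int τ₃ := hx.mem_relInt_iff.2 ⟨hw₃, fun ν hν => by
    have := (hw ν).1 hν
    simp only [Finset.mem_insert, Finset.mem_singleton] at this
    rcases this with rfl | rfl | rfl
    exacts [h₁₂.trans h₂₃, h₂₃, le_rfl]⟩
  have hxW : x ∈ ⋂ i, P.W (c i) := mem_iInter.2 fun i => by
    refine hx.mem_star_iff.2 ?_
    fin_cases i
    exacts [hw₁, hw₂, hw₃]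
  have h1 := val_cechD s c ⟨hxW, hxI⟩
  have hf0 : chainFace c 0 = edge h₂₃ := by ext i; fin_cases i <;> rfl
  have hf1 : chainFace c 1 = edge (h₁₂.trans h₂₃) := by ext i; fin_cases i <;> rfl
  have hf2 : chainFace c 2 = edge h₁₂ := by ext i; fin_cases i <;> rfl
  have h0 : P.QSheaf.cechD P.W 1 s = 0 := hs
  have h2 : val (0 : P.QSheaf.Cochain P.W 2) c τ₃ x = 0 := val_eq _ _ ⟨hxW, hxI⟩
  rw [h0, h2, Fin.sum_univ_three, hf0, hf1, hf2, val_edge s h₂₃ hx hw₂ hw₃ hxI,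
    val_edge s (h₁₂.trans h₂₃) hx hw₁ hw₃ hxI, val_edge s h₁₂ hx hw₁ hw₂ hxI, transC_self,
    transC_self] at h1
  simp only [Fin.val_zero, pow_zero, one_smul, Fin.val_one, pow_one, neg_smul, Fin.val_two,
    even_two, Even.neg_pow, one_pow] at h1
  rw [← sub_eq_zero, ← neg_eq_zero, h1]
  abel

/-- The value of a 0-cochain on `Int τ`. -/
noncomputable def vertexValue (t : P.QSheaf.Cochain P.W 0) (τ : P.cells) : P.QC τ :=
  val t (OrderHom.const _ τ) τ (P.bary τ)

theorem val_const (t : P.QSheaf.Cochain P.W 0) (hw : P.HasWeight w x) (hτ : w τ ≠ 0)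
    (hx : x ∈ P.Int κ) :
    val t (OrderHom.const _ τ) κ x = P.transC τ κ (vertexValue t τ) := by
  obtain ⟨w₀, h₀, hs₀⟩ := exists_hasWeight_bary (P := P.toPolyhedralDecomposition) τ
  exact val_transport t _ h₀ (fun κ => by simp [hs₀, eq_comm]) hw (fun _ => hτ)
    (P.bary_mem_relInt τ) hx

theorem edgeValue_cechD (t : P.QSheaf.Cochain P.W 0) (h : τ ≤ σ) :
    P.edgeValue (P.QSheaf.cechD P.W 0 t) h =
      vertexValue t σ - P.transC τ σ (vertexValue t τ) := by
  obtain ⟨w, hw, hs⟩ := exists_hasWeight_edgePt (P := P.toPolyhedralDecomposition) h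
  have hτ := (hs τ).2 (Or.inl rfl)
  have hσ := (hs σ).2 (Or.inr rfl)
  have hI : P.edgePt τ σ ∈ P.Int σ := hw.mem_relInt_iff.2 ⟨hσ, fun ν hν => by
    rcases (hs ν).1 hν with rfl | rfl
    exacts [h, le_rfl]⟩
  have hW : P.edgePt τ σ ∈ ⋂ i, P.W (edge h i) := mem_iInter.2 fun i => by
    refine hw.mem_star_iff.2 ?_
    fin_cases i
    exacts [hτ, hσ]
  have hf0 : chainFace (edge h) 0 = OrderHom.const _ σ := by ext i; fin_cases i; rfl
  have hf1 : chainFace (edge h) 1 = OrderHom.const _ τ := by ext i; fin_cases i; rfl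
  rw [edgeValue_eq, val_cechD t (edge h) ⟨hW, hI⟩, Fin.sum_univ_two, hf0, hf1,
    val_const t hw hσ hI, val_const t hw hτ hI, transC_self]
  simp [sub_eq_add_neg]

/-! ## The pairing -/

theorem pairing_add_left (s s' : P.QC σ) (m : P.QDual σ) :
    P.pairing (s + s') m = P.pairing s m + P.pairing s' m := by
  simp [pairing]

theorem pairing_sub_left (s s' : P.QC σ) (m : P.QDual σ) :
    P.pairing (s - s') m = P.pairing s m - P.pairing s' m := by
  simp [pairing]

theorem pairing_sub_right (s : P.QC σ) (m m' : P.QDual σ) :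
    P.pairing s (m - m') = P.pairing s m - P.pairing s m' := by
  simp [pairing, LinearMap.rTensor_sub]

theorem pairing_transC (s : P.QC τ) (m : P.QDual σ) :
    P.pairing (P.transC τ σ s) m = P.pairing s (m ∘ₗ P.trans τ σ) := by
  rw [pairing, pairing, transC, LinearMap.rTensor_comp]; rfl

end ToricDecomposition

namespace PolyhedralCovering

open PolyhedralDecomposition

variable {n : ℕ} {B : Type*} [TopologicalSpace B] [ChartedSpace (EuclideanSpace ℝ (Fin n)) B]
  {M : IntegralAffineManifold n B} {P : ToricDecomposition M}
  {L : Type*} [TopologicalSpace L] {C : PolyhedralCovering P L} {τ σ κ : C.cells} {x : L}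

/-! ## Cells of the covering space -/

theorem le_of_mem_Int (hx : x ∈ C.Int τ) (hκ : x ∈ (κ : Set L)) : τ ≤ κ := by
  have h := mem_relInt_iff.1 hx
  have h1 := h.2 _ (C.inter_mem τ κ ⟨x, h.1, hκ⟩) inter_subset_left ⟨h.1, hκ⟩
  exact inter_eq_left.1 h1

theorem eq_of_mem_Int (hx : x ∈ C.Int τ) (hκ : x ∈ C.Int κ) : τ = κ :=
  (le_of_mem_Int hx (mem_relInt_iff.1 hκ).1).antisymm (le_of_mem_Int hκ (mem_relInt_iff.1 hx).1)

theorem proj_mem_Int (hx : x ∈ C.Int τ) : C.proj x ∈ P.Int (C.img τ) := by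
  change C.proj x ∈ relInt P.cells (C.proj '' τ)
  rw [← C.image_relInt τ]
  exact mem_image_of_mem C.proj hx

theorem exists_lift (τ : C.cells) {b : B} (hb : b ∈ P.Int (C.img τ)) :
    ∃ x ∈ C.Int τ, C.proj x = b := by
  have h := C.image_relInt τ
  change b ∈ relInt P.cells (C.proj '' τ) at hb
  rw [← h] at hb
  exact hb

theorem exists_lift_bary (τ : C.cells) : ∃ x ∈ C.Int τ, C.proj x = P.bary (C.img τ) :=
  C.exists_lift τ (P.bary_mem_relInt _)

/-- Every cell has a lift of a barycentre in its interior. Interiors are disjoint, `B` has finitely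
many barycentres, and fibres are finite. -/
instance : Finite C.cells := by
  choose f hf hfb using C.exists_lift_bary
  have hinj : Function.Injective f := fun τ σ h => eq_of_mem_Int (hf τ) (h ▸ hf σ)
  have hfin : (⋃ κ : P.cells, C.proj ⁻¹' {P.bary κ}).Finite :=
    finite_iUnion fun κ => C.branched.finite_fibre _
  have : Finite (range f) :=
    (hfin.subset (by
      rintro _ ⟨τ, rfl⟩
      exact mem_iUnion.2 ⟨C.img τ, hfb τ⟩)).to_subtype
  exact Finite.of_injective (rangeFactorization f) fun a b h => hinj (congrArg Subtype.val h)

theorem exists_mem_cell (C : PolyhedralCovering P L) (x : L) : ∃ κ : C.cells, x ∈ (κ : Set L) := by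
  obtain ⟨κ, hκ, hx⟩ := mem_sUnion.1 (C.cover.symm ▸ mem_univ x : x ∈ ⋃₀ C.cells)
  exact ⟨⟨κ, hκ⟩, hx⟩

theorem compactSpace (C : PolyhedralCovering P L) : CompactSpace L := by
  have : (univ : Set L) = ⋃ κ : C.cells, (κ : Set L) := by
    rw [← sUnion_eq_iUnion, C.cover]
  exact ⟨this ▸ isCompact_iUnion C.compact_cell⟩

theorem exists_mem_Int (C : PolyhedralCovering P L) (x : L) : ∃ κ : C.cells, x ∈ C.Int κ := by
  obtain ⟨κ, hκ⟩ := C.exists_mem_cell x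
  obtain ⟨σ, -, hσ⟩ := (Set.toFinite {τ : C.cells | x ∈ (τ : Set L)}).exists_le_minimal hκ
  refine ⟨σ, mem_relInt_iff.2 ⟨hσ.prop, fun τ hτ hle hxτ => ?_⟩⟩
  exact hle.antisymm (hσ.le_of_le (y := ⟨τ, hτ⟩) hxτ hle)

/-- The projection of the covering is an open map. -/
theorem isOpenMap_proj [T2Space B] [T2Space L] (C : PolyhedralCovering P L) : IsOpenMap C.proj := by
  have := C.compactSpace
  have hlc : LocallyConnectedSpace B :=
    ChartedSpace.locallyConnectedSpace (EuclideanSpace ℝ (Fin n)) B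
  rw [isOpenMap_iff_nhds_le]
  intro x N hN
  obtain ⟨N', hN', hNo, hxN⟩ := mem_nhds_iff.1 (mem_map.1 hN)
  have hfin := C.branched.finite_fibre (C.proj x)
  -- The point `x` is separated from the rest of its fibre. As `π` is closed, all fibres near `π x`
  -- lie in `(N' ∩ O₁) ∪ O₂`, and the component `V` of `x` stays in the first part.
  obtain ⟨O₁, O₂, hO₁, hO₂, hx₁, hF, hdisj⟩ := SeparatedNhds.of_isCompact_isCompact
    (isCompact_singleton (x := x)) (hfin.subset (sdiff_subset (t := {x}))).isCompact
    (disjoint_sdiff_right)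
  have hclosed : IsClosedMap C.proj := C.branched.continuous.isClosedMap
  let W₀ : Set B := (C.proj '' ((N' ∩ O₁) ∪ O₂)ᶜ)ᶜ
  have hW₀ : IsOpen W₀ := (hclosed _ ((hNo.inter hO₁).union hO₂).isClosed_compl).isOpen_compl
  have hxW₀ : C.proj x ∈ W₀ := by
    rintro ⟨z, hz, hzx⟩
    apply hz
    by_cases hzx' : z = x
    · exact Or.inl ⟨hzx' ▸ hxN, hx₁ hzx'⟩
    · exact Or.inr (hF ⟨hzx, hzx'⟩)
  set W := connectedComponentIn W₀ (C.proj x)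
  have hWo : IsOpen W := hW₀.connectedComponentIn
  have hxW : C.proj x ∈ W := mem_connectedComponentIn hxW₀
  have hWc : IsConnected W := isConnected_connectedComponentIn_iff.2 hxW₀
  set V := connectedComponentIn (C.proj ⁻¹' W) x
  have hxV : x ∈ V := mem_connectedComponentIn (by exact hxW)
  have hVsub : V ⊆ (N' ∩ O₁) ∪ O₂ := fun z hz => by
    have h0 : C.proj z ∈ W := connectedComponentIn_subset (C.proj ⁻¹' W) x hz
    have h1 : C.proj z ∈ W₀ := connectedComponentIn_subset _ _ h0
    by_contra hn
    exact h1 ⟨z, hn, rfl⟩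
  have hVN : V ⊆ N' ∩ O₁ := isPreconnected_connectedComponentIn.subset_left_of_subset_union
    (hNo.inter hO₁) hO₂ (hdisj.mono_left inter_subset_right) hVsub ⟨x, hxV, hxN, hx₁ rfl⟩
  refine mem_of_superset (hWo.mem_nhds hxW) fun y hy => ?_
  -- The trace along `V` is positive at `π x` because multiplicities are positive, hence positive at
  -- `y`; so `y` has a preimage in `V ⊆ N'`.
  have htr := C.branched.trace_const W hWo hWc x hxW _ hxW y hy
  have hpos : 0 < fibreTrace C.proj C.mult V (C.proj x) := by
    have hfin' : {z | z ∈ V ∧ C.proj z = C.proj x}.Finite := hfin.subset fun z hz => hz.2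
    rw [fibreTrace, finsum_mem_eq_finite_toFinset_sum _ hfin']
    exact Finset.sum_pos (fun z _ => C.branched.mult_pos z)
      ⟨x, by simp [hxV]⟩
  by_contra hn
  have hempty : {z | z ∈ V ∧ C.proj z = y} = ∅ := by
    refine eq_empty_of_forall_notMem fun z hz => hn ?_
    have h2 := hN' (hVN hz.1).1
    rwa [mem_preimage, hz.2] at h2
  have hzero : fibreTrace C.proj C.mult V y = 0 := by
    rw [fibreTrace, hempty, finsum_mem_empty]
  exact hpos.ne' (htr.trans hzero)

/-- A neighbourhood `N` of a point `x` of `Int τ` meets only cells through `x`, all of which contain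
`τ`. Its image is open around a point of a maximal cell `σ` of `B`, so it meets the interior of `σ`.
-/
theorem exists_maxCell [T2Space B] [T2Space L] (τ : C.cells) : ∃ σ : C.cells, τ ≤ σ ∧ C.IsMaxCell σ := by
  obtain ⟨x, hx, -⟩ := C.exists_lift_bary τ
  obtain ⟨σ, hle, hσ⟩ := P.pure (C.img τ)
  let N : Set L := (⋃ κ ∈ {κ : C.cells | x ∉ (κ : Set L)}, (κ : Set L))ᶜ
  have hN : IsOpen N := ((Set.toFinite _).isClosed_biUnion fun κ _ =>
    (C.compact_cell κ).isClosed).isOpen_compl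
  have hxN : x ∈ N := by
    simp only [N, mem_compl_iff, mem_iUnion, not_exists, mem_ofPred_eq]
    exact fun κ h1 h2 => h1 h2
  have hcl := closure_relInt σ (hle (mem_relInt_iff.1 (proj_mem_Int hx)).1)
  obtain ⟨y, ⟨z, hz, rfl⟩, hy⟩ := mem_closure_iff.1 hcl _ (C.isOpenMap_proj _ hN)
    (mem_image_of_mem _ hxN)
  obtain ⟨κ, hκ⟩ := C.exists_mem_Int z
  have himg : C.img κ = σ := eq_of_mem_relInt (proj_mem_Int hκ) hy
  refine ⟨κ, le_of_mem_Int hx ?_, (congrArg P.dim himg).trans hσ⟩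
  by_contra hn
  exact hz (mem_biUnion (x := κ) hn (mem_relInt_iff.1 hκ).1)

theorem isOpen_Int [T2Space L] (hσ : C.IsMaxCell σ) : IsOpen (C.Int σ) := by
  -- A cell above `σ` has the same image, by maximality in `B`, and `π` is injective on it.
  have hmax : ∀ κ : C.cells, σ ≤ κ → κ = σ := fun κ h => by
    have h1 : C.img σ = C.img κ := eq_of_le_of_dim_eq (C.img_mono h) hσ
    refine le_antisymm (fun x hx => ?_) h
    have h2 : C.proj x ∈ (C.img σ : Set B) := h1 ▸ mem_image_of_mem C.proj hx
    obtain ⟨y, hy, hyx⟩ := h2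
    rwa [← C.injOn κ (h hy) hx hyx]
  have : C.Int σ = (⋃ κ ∈ {κ : C.cells | κ ≠ σ}, (κ : Set L))ᶜ := by
    ext x
    simp only [mem_compl_iff, mem_iUnion, not_exists, exists_prop, not_and, mem_ofPred_eq]
    constructor
    · exact fun hx κ hκ hxκ => hκ (hmax κ (le_of_mem_Int hx hxκ))
    · intro h
      obtain ⟨κ, hκ⟩ := C.exists_mem_Int x
      by_cases hne : κ = σ
      · exact hne ▸ hκ
      · exact absurd (mem_relInt_iff.1 hκ).1 (h κ hne)
  rw [this, isOpen_compl_iff]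
  exact (Set.toFinite _).isClosed_biUnion fun κ _ => (C.compact_cell κ).isClosed

theorem isClosedEmbedding_cell [T2Space B] (σ : C.cells) :
    IsClosedEmbedding (fun x : (σ : Set L) => C.proj x) := by
  have : CompactSpace (σ : Set L) := isCompact_iff_compactSpace.1 (C.compact_cell σ)
  exact (C.branched.continuous.comp continuous_subtype_val).isClosedEmbedding
    (injOn_iff_injective.1 (C.injOn σ))

theorem closure_Int [T2Space B] (σ : C.cells) : (σ : Set L) ⊆ closure (C.Int σ) := by
  intro x hx
  have he := C.isClosedEmbedding_cell σ
  let S : Set (σ : Set L) := {y | (y : L) ∈ C.Int σ}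
  have h1 : (fun y : (σ : Set L) => C.proj y) '' S = P.Int (C.img σ) := by
    ext b
    constructor
    · rintro ⟨y, hy, rfl⟩; exact proj_mem_Int hy
    · intro hb
      obtain ⟨y, hy, rfl⟩ := C.exists_lift σ hb
      exact ⟨⟨y, (mem_relInt_iff.1 hy).1⟩, hy, rfl⟩
  have h2 : (⟨x, hx⟩ : (σ : Set L)) ∈ closure S := by
    rw [he.isEmbedding.closure_eq_preimage_closure_image, h1]
    exact closure_relInt (C.img σ) (mem_image_of_mem C.proj hx)
  have h3 := closure_subtype.1 h2
  refine closure_mono ?_ h3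
  rintro _ ⟨y, hy, rfl⟩
  exact hy

/-- A connected set joining `π x` to the barycentre of `π τ` inside `π σ` and the star lifts through
the embedding of `σ`, and so stays in the component of a point of `Int τ`. -/
theorem mem_W [T2Space B] (h : τ ≤ σ) (hx : x ∈ (σ : Set L)) (hW : C.proj x ∈ P.W (C.img τ)) : x ∈ C.W τ := by
  obtain ⟨J, hJ, h1, h2, h3⟩ := exists_isPreconnected_bary (P := P.toPolyhedralDecomposition)
    (σ := C.img σ) (mem_image_of_mem C.proj hx) hW
  obtain ⟨z, hz, hzb⟩ := C.exists_lift_bary τ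
  have he := C.isClosedEmbedding_cell σ
  let J' : Set (σ : Set L) := (fun y : (σ : Set L) => C.proj y) ⁻¹' J
  have himg : (fun y : (σ : Set L) => C.proj y) '' J' = J := by
    refine image_preimage_eq_of_subset fun b hb => ?_
    obtain ⟨y, hy, rfl⟩ := (h3 hb).1
    exact ⟨⟨y, hy⟩, rfl⟩
  have hJ' : IsPreconnected J' := he.isEmbedding.isInducing.isPreconnected_image.1 (himg ▸ hJ)
  have hJL := hJ'.image Subtype.val continuous_subtype_val.continuousOn
  refine mem_biUnion hz (hJL.subset_connectedComponentIn
    ⟨⟨z, h (mem_relInt_iff.1 hz).1⟩, ?_, rfl⟩ ?_ ⟨⟨x, hx⟩, h2, rfl⟩)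
  · change C.proj z ∈ J
    rwa [hzb]
  · rintro _ ⟨y, hy, rfl⟩
    exact (h3 hy).2

end PolyhedralCovering

/-! ## Slopes of local representatives -/

/-- A covector is treated as a one-row integral matrix, so that the matrix lemmas apply to slopes.
-/
theorem covecEval_eq {k : ℕ} (m : (Fin k → ℤ) →ₗ[ℤ] ℤ) (x : Fin k → ℝ) :
    covecEval m x = intMul (LinearMap.toMatrix' ((LinearMap.pi fun _ : Fin 1 => m))) x 0 := by
  simp [covecEval, intMul, Matrix.mulVec, dotProduct, LinearMap.toMatrix'_apply]

theorem covecEval_sub {k : ℕ} (m m' : (Fin k → ℤ) →ₗ[ℤ] ℤ) (x : Fin k → ℝ) :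
    covecEval (m - m') x = covecEval m x - covecEval m' x := by
  simp [covecEval, sub_mul, Finset.sum_sub_distrib]

theorem covecEval_add {k : ℕ} (m : (Fin k → ℤ) →ₗ[ℤ] ℤ) (x y : Fin k → ℝ) :
    covecEval m (x + y) = covecEval m x + covecEval m y := by
  simp [covecEval, mul_add, Finset.sum_add_distrib]

theorem covecEval_comp {k l : ℕ} (m : (Fin l → ℤ) →ₗ[ℤ] ℤ) (p : Matrix (Fin l) (Fin k) ℤ)
    (x : Fin k → ℝ) : covecEval (m ∘ₗ p.mulVecLin) x = covecEval m (intMul p x) := by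
  have : (LinearMap.pi fun _ : Fin 1 => m ∘ₗ p.mulVecLin) =
      (LinearMap.pi fun _ : Fin 1 => m) ∘ₗ p.toLin' := rfl
  rw [covecEval_eq, covecEval_eq, this, LinearMap.toMatrix'_comp, LinearMap.toMatrix'_toLin',
    intMul_mul]

theorem IntegralAffineManifold.AffAt.sub {n : ℕ} {B : Type*} [TopologicalSpace B]
    [ChartedSpace (EuclideanSpace ℝ (Fin n)) B] {M : IntegralAffineManifold n B} {x : B}
    {f g : B → ℝ} (hf : M.AffAt x f) (hg : M.AffAt x g) : M.AffAt x (fun y => f y - g y) := by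
  obtain ⟨U, hU, hxU, hfU, hf⟩ := hf
  obtain ⟨V, hV, hxV, hgV, hg⟩ := hg
  refine ⟨U ∩ V, hU.inter hV, ⟨hxU, hxV⟩,
    (hfU.mono inter_subset_left).sub (hgV.mono inter_subset_right), fun e he y hy => ?_⟩
  obtain ⟨a, c, h⟩ := hf e he y ⟨hy.1.1, hy.2⟩
  obtain ⟨a', c', h'⟩ := hg e he y ⟨hy.1.2, hy.2⟩
  refine ⟨a - a', c - c', ?_⟩
  filter_upwards [h, h'] with z h1 h2
  simp only [h1, h2, Pi.sub_apply, Int.cast_sub, sub_mul, Finset.sum_sub_distrib]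
  ring

theorem PolyhedralCovering.AffAt.sub {n : ℕ} {B : Type*} [TopologicalSpace B]
    [ChartedSpace (EuclideanSpace ℝ (Fin n)) B] {M : IntegralAffineManifold n B}
    {P : ToricDecomposition M} {L : Type*} [TopologicalSpace L] {C : PolyhedralCovering P L}
    {x : L} {f g : L → ℝ} (hf : C.AffAt x f) (hg : C.AffAt x g) :
    C.AffAt x (fun y => f y - g y) := by
  obtain ⟨f', hf', h⟩ := hf
  obtain ⟨g', hg', h'⟩ := hg
  refine ⟨_, hf'.sub hg', ?_⟩
  filter_upwards [h, h'] with y h1 h2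
  rw [h1, h2]

namespace TropicalLagrangianMultisection.LocalRep

open PolyhedralDecomposition PolyhedralCovering ToricDecomposition

variable {n : ℕ} {B : Type*} [TopologicalSpace B] [T2Space B]
  [ChartedSpace (EuclideanSpace ℝ (Fin n)) B] {M : IntegralAffineManifold n B}
  {P : ToricDecomposition M} {L : Type*} [TopologicalSpace L] [T2Space L]
  {T : TropicalLagrangianMultisection P L}

/-- Near a generic point of a maximal cell `κ`, an affine function that represents the difference
of two local representatives has slope the difference of their slopes. -/
theorem eventually_eq_covecEval (R R' : T.LocalRep) {τ σ κ : T.cells} (hτσ : τ ≤ σ) (hσκ : σ ≤ κ)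
    (hκ : T.IsMaxCell κ) {m : P.QDual (T.img τ)} {m' : P.QDual (T.img σ)}
    (hm : R.IsSlope τ κ m) (hm' : R'.IsSlope σ κ m') {x : L} (hx : x ∈ (κ : Set L)) {g : B → ℝ}
    (hg : ∀ᶠ y in 𝓝 x, R.fn τ ((R.fan τ).S y) - R'.fn σ ((R'.fan σ).S y) = g (T.proj y))
    {U : Set B} (hU : IsOpen U) (hxU : T.proj x ∈ U)
    (hUW : U ⊆ P.W (T.img τ) ∩ P.W (T.img σ)) :
    ∃ z ∈ U \ M.Δ, ∃ c : ℝ, ∀ᶠ y in 𝓝 z,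
      g y = covecEval (m - m' ∘ₗ P.trans (T.img τ) (T.img σ)) (P.S (T.img τ) y) + c := by
  obtain ⟨c₁, hc₁⟩ := hm
  obtain ⟨c₂, hc₂⟩ := hm'
  obtain ⟨p, c₃, hp, -, hpS⟩ := exists_trans (T.img_mono hτσ)
  obtain ⟨N, hN, hNo, hxN⟩ := mem_nhds_iff.1 hg
  have hO : IsOpen (N ∩ T.proj ⁻¹' U) := hNo.inter (hU.preimage T.branched.continuous)
  obtain ⟨y₀, hy₀, hy₀κ⟩ := mem_closure_iff.1 (closure_Int κ hx) _ hO ⟨hxN, hxU⟩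
  have hzΔ : T.proj y₀ ∉ M.Δ := not_mem_sing hκ (proj_mem_Int hy₀κ)
  -- The comparison holds on an open subset of `L` inside `Int κ`; openness of `π` turns it into an
  -- identity of germs on `B`.
  have himg : IsOpen (T.proj '' (N ∩ T.proj ⁻¹' U ∩ T.Int κ)) :=
    T.isOpenMap_proj _ (hO.inter (isOpen_Int hκ))
  refine ⟨T.proj y₀, ⟨hy₀.2, hzΔ⟩, c₁ - covecEval m' c₃ - c₂, ?_⟩
  filter_upwards [himg.mem_nhds ⟨y₀, ⟨hy₀, hy₀κ⟩, rfl⟩, hpS _ ⟨hUW hy₀.2, hzΔ⟩] with z hz hSz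
  obtain ⟨y, ⟨⟨hyN, hyU⟩, hyκ⟩, rfl⟩ := hz
  have hyκ' := (mem_relInt_iff.1 hyκ).1
  have h1 : y ∈ T.W τ := mem_W (hτσ.trans hσκ) hyκ' (hUW hyU).1
  have h2 : y ∈ T.W σ := mem_W hσκ hyκ' (hUW hyU).2
  have h3 := hN hyN
  simp only [mem_ofPred_eq] at h3
  rw [← h3, hc₁ y ⟨hyκ', h1⟩, hc₂ y ⟨hyκ', h2⟩, (R.fan τ).S_over y h1, (R'.fan σ).S_over y h2,
    hSz, covecEval_add, covecEval_sub, hp, covecEval_comp]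
  ring

/-- The difference of slopes of local representatives along nested cells `τ ≤ σ` is the same at all
maximal cells containing `σ`. -/
theorem slope_sub_eq (R R' : T.LocalRep) {τ σ κ₁ κ₂ : T.cells} (hτσ : τ ≤ σ) (h₁ : σ ≤ κ₁)
    (h₂ : σ ≤ κ₂) (hκ₁ : T.IsMaxCell κ₁) (hκ₂ : T.IsMaxCell κ₂)
    {m₁ m₂ : P.QDual (T.img τ)} {m₁' m₂' : P.QDual (T.img σ)}
    (hm₁ : R.IsSlope τ κ₁ m₁) (hm₂ : R.IsSlope τ κ₂ m₂)
    (hm₁' : R'.IsSlope σ κ₁ m₁') (hm₂' : R'.IsSlope σ κ₂ m₂') :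
    m₁ - m₁' ∘ₗ P.trans (T.img τ) (T.img σ) = m₂ - m₂' ∘ₗ P.trans (T.img τ) (T.img σ) := by
  have hlc : LocallyConnectedSpace B :=
    ChartedSpace.locallyConnectedSpace (EuclideanSpace ℝ (Fin n)) B
  obtain ⟨w, hw, hs⟩ := exists_hasWeight_edgePt (P := P.toPolyhedralDecomposition)
    (T.img_mono hτσ)
  have hI : P.edgePt (T.img τ) (T.img σ) ∈ P.Int (T.img σ) :=
    hw.mem_relInt_iff.2 ⟨(hs _).2 (Or.inr rfl), fun ν hν => by
      rcases (hs ν).1 hν with h | h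
      exacts [h ▸ T.img_mono hτσ, h.le]⟩
  -- This lift of the midpoint of the barycentres lies in `Int σ`, in `W_τ` and `W_σ` upstairs, and
  -- in both maximal cells `κ₁`, `κ₂`. So one affine function `g` compares the representatives next
  -- to both cells.
  obtain ⟨x, hxI, hxe⟩ := exists_lift σ hI
  have hxσ := (mem_relInt_iff.1 hxI).1
  have hWτ : T.proj x ∈ P.W (T.img τ) := hxe ▸ hw.mem_star_iff.2 ((hs _).2 (Or.inl rfl))
  have hWσ : T.proj x ∈ P.W (T.img σ) := hxe ▸ hw.mem_star_iff.2 ((hs _).2 (Or.inr rfl))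
  have haff := (R.represents τ x (mem_W hτσ hxσ hWτ)).sub
    (R'.represents σ x (mem_W le_rfl hxσ hWσ))
  simp only [sub_sub_sub_cancel_right] at haff
  obtain ⟨g, ⟨U₀, hU₀, hxU₀, -, hgU⟩, hg⟩ := haff
  let U₁ := U₀ ∩ (P.W (T.img τ) ∩ P.W (T.img σ))
  have hU₁ : IsOpen U₁ := hU₀.inter ((P.isOpen_star _).inter (P.isOpen_star _))
  have hxU₁ : T.proj x ∈ U₁ := ⟨hxU₀, hWτ, hWσ⟩
  -- Connectedness of `U` gives that of `U \ Δ`, along which `g` can be continued from `z₁` to `z₂`.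
  let U := connectedComponentIn U₁ (T.proj x)
  have hU : IsOpen U := hU₁.connectedComponentIn
  have hxU : T.proj x ∈ U := mem_connectedComponentIn hxU₁
  have hUU : U ⊆ U₁ := connectedComponentIn_subset _ _
  have hconn := M.codim_two U hU isPreconnected_connectedComponentIn
  obtain ⟨z₁, hz₁, c₁, hc₁⟩ := eventually_eq_covecEval R R' hτσ h₁ hκ₁ hm₁ hm₁' (h₁ hxσ) hg hU hxU
    (hUU.trans inter_subset_right)
  obtain ⟨z₂, hz₂, c₂, hc₂⟩ := eventually_eq_covecEval R R' hτσ h₂ hκ₂ hm₂ hm₂' (h₂ hxσ) hg hU hxU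
    (hUU.trans inter_subset_right)
  set n₁ := m₁ - m₁' ∘ₗ P.trans (T.img τ) (T.img σ)
  set n₂ := m₂ - m₂' ∘ₗ P.trans (T.img τ) (T.img σ)
  let f : B → Fin 1 → ℝ := fun y _ => g y - (covecEval n₁ (P.S (T.img τ) y) + c₁)
  have hloc : ∀ y ∈ U \ M.Δ, LocAffAt M.charts f y := fun y hy => by
    obtain ⟨e, he, hsrc⟩ := exists_chart hy.2
    obtain ⟨A, -, -, b, hA⟩ := P.S_submersion (T.img τ) e he y ⟨(hUU hy.1).2.1, hsrc⟩
    obtain ⟨a, c, ha⟩ := hgU e he y ⟨(hUU hy.1).1, hsrc⟩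
    refine ⟨e, he, hsrc, LinearMap.pi fun _ => (∑ i, (a i : ℝ) • LinearMap.proj i) -
      (LinearMap.proj 0 ∘ₗ ((LinearMap.toMatrix' (LinearMap.pi fun _ : Fin 1 => n₁)).map
        (Int.cast : ℤ → ℝ)).mulVecLin ∘ₗ (A.map (Int.cast : ℤ → ℝ)).mulVecLin),
      fun _ => c - (covecEval n₁ b + c₁), ?_⟩
    filter_upwards [hA, ha] with z h1 h2
    funext i
    have h3 := covecEval_eq n₁ (intMul A (e z))
    simp only [f, h1, h2, covecEval_add, h3, Pi.add_apply, LinearMap.pi_apply, LinearMap.sub_apply,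
      LinearMap.comp_apply, ← intMul_eq_mulVecLin, LinearMap.proj_apply, LinearMap.sum_apply,
      LinearMap.smul_apply, smul_eq_mul]
    ring
  have hz := LocAffAt.eventually_eq_zero hconn hloc hz₁
    (by filter_upwards [hc₁] with y hy; funext i; simp [f, hy]) hz₂
  obtain ⟨e, he, hsrc⟩ := exists_chart hz₂.2
  obtain ⟨A, A', hAA', b, hA⟩ :=
    P.S_submersion (T.img τ) e he z₂ ⟨(hUU hz₂.1).2.1, hsrc⟩
  -- Near `z₂` the function `g` has both slopes `n₁` and `n₂` with respect to `S τ`; its linear part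
  -- `A` has a right inverse, so they coincide.
  have hmat : LinearMap.toMatrix' (LinearMap.pi fun _ : Fin 1 => n₁) =
      LinearMap.toMatrix' (LinearMap.pi fun _ : Fin 1 => n₂) := by
    refine right_cancel hAA' (intMul_congr_of_eventually (z := e z₂)
      (c := fun _ => covecEval n₁ b + c₁) (c' := fun _ => covecEval n₂ b + c₂)
      (OpenPartialHomeomorph.eventually_nhds_image (p := fun v => _ = _) hsrc ?_))
    filter_upwards [hz, hc₂, hA] with y h1 h2 h3
    have h4 := sub_eq_zero.1 (congrFun h1 0)
    rw [h2, h3, covecEval_add, covecEval_add, covecEval_eq n₁ (intMul A _),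
      covecEval_eq n₂ (intMul A _)] at h4
    funext i
    rw [Subsingleton.elim i 0, intMul_mul, intMul_mul, Pi.add_apply, Pi.add_apply, ← add_assoc,
      ← add_assoc, h4]
  have hpi := LinearMap.toMatrix'.injective hmat
  ext1 i
  have := LinearMap.congr_fun hpi
  exact LinearMap.ext fun t => congrFun (this _) 0

end TropicalLagrangianMultisection.LocalRep

namespace AbPresheaf

theorem cechClass_eq_of_sub_mem {X : Type*} (F : AbPresheaf X) {I : Type*} [PartialOrder I]
    (W : I → Set X) {p : ℕ} {c c' : F.cocycles W (p + 1)}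
    (h : c.1 - c'.1 ∈ F.coboundaries W p) :
    F.cechClass W p c = F.cechClass W p c' := by
  rw [← sub_eq_zero, ← map_sub]
  exact (QuotientAddGroup.eq_zero_iff _).2 (AddSubgroup.mem_addSubgroupOf.2 h)

end AbPresheaf

/-! ## Constant cochains -/

section ConstCochain

open AbPresheaf

variable {L : Type*} [TopologicalSpace L] {I : Type*} [PartialOrder I] (W : I → Set L)

/-- Constant sections of the constant sheaf. -/
noncomputable def constSection (U : Set L) : CStar →+ (constCStar L).sec U where
  toFun a := LocallyConstant.const U a
  map_zero' := rfl
  map_add' _ _ := rfl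

/-- The 1-cochain of constant functions with values `b`. -/
noncomputable def edgeCochain (b : ∀ τ σ : I, τ ≤ σ → CStar) : (constCStar L).Cochain W 1 :=
  fun t => constSection _ (b (t 0) (t 1) (t.monotone (by decide : (0 : Fin 2) ≤ 1)))

/-- The 2-cochain of constant functions with values `a`. -/
noncomputable def triangleCochain (a : ∀ τ₁ τ₂ τ₃ : I, τ₁ ≤ τ₂ → τ₂ ≤ τ₃ → CStar) :
    (constCStar L).Cochain W 2 :=
  fun t => constSection _ (a (t 0) (t 1) (t 2) (t.monotone (by decide : (0 : Fin 3) ≤ 1))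
    (t.monotone (by decide : (1 : Fin 3) ≤ 2)))

theorem cechD_edgeCochain (b : ∀ τ σ : I, τ ≤ σ → CStar) :
    (constCStar L).cechD W 1 (edgeCochain W b) = triangleCochain W fun τ₁ τ₂ τ₃ h₁₂ h₂₃ =>
      b τ₂ τ₃ h₂₃ - b τ₁ τ₃ (h₁₂.trans h₂₃) + b τ₁ τ₂ h₁₂ := by
  funext t
  have h0 : (0 : Fin 3) ≤ 1 := by decide
  have h1 : (1 : Fin 3) ≤ 2 := by decide
  change (∑ j : Fin 3, (-1 : ℤ) ^ (j : ℕ) • (constSection _ (b (chainFace t j 0) (chainFace t j 1)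
    ((chainFace t j).monotone (by decide : (0 : Fin 2) ≤ 1))) : (constCStar L).sec (⋂ i, W (t i)))) = constSection _ _
  simp_rw [← map_zsmul, ← map_sum]
  congr 1
  rw [Fin.sum_univ_three]
  change (-1 : ℤ) ^ 0 • b (t 1) (t 2) (t.monotone h1) +
    (-1 : ℤ) ^ 1 • b (t 0) (t 2) (t.monotone (h0.trans h1)) +
    (-1 : ℤ) ^ 2 • b (t 0) (t 1) (t.monotone h0) = _
  simp [sub_eq_add_neg]

theorem cechD_triangleCochain (a : ∀ τ₁ τ₂ τ₃ : I, τ₁ ≤ τ₂ → τ₂ ≤ τ₃ → CStar)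
    (ha : ∀ (τ₀ τ₁ τ₂ τ₃ : I) (h₀₁ : τ₀ ≤ τ₁) (h₁₂ : τ₁ ≤ τ₂) (h₂₃ : τ₂ ≤ τ₃),
      a τ₁ τ₂ τ₃ h₁₂ h₂₃ - a τ₀ τ₂ τ₃ (h₀₁.trans h₁₂) h₂₃ + a τ₀ τ₁ τ₃ h₀₁ (h₁₂.trans h₂₃) -
        a τ₀ τ₁ τ₂ h₀₁ h₁₂ = 0) :
    (constCStar L).cechD W 2 (triangleCochain W a) = 0 := by
  funext t
  have h0 : (0 : Fin 4) ≤ 1 := by decide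
  have h1 : (1 : Fin 4) ≤ 2 := by decide
  have h2 : (2 : Fin 4) ≤ 3 := by decide
  change (∑ j : Fin 4, (-1 : ℤ) ^ (j : ℕ) • (constSection _ (a (chainFace t j 0) (chainFace t j 1)
    (chainFace t j 2) ((chainFace t j).monotone (by decide : (0 : Fin 3) ≤ 1))
    ((chainFace t j).monotone (by decide : (1 : Fin 3) ≤ 2))) :
      (constCStar L).sec (⋂ i, W (t i)))) = 0
  simp_rw [← map_zsmul, ← map_sum]
  refine (congrArg (constSection _) ?_).trans (map_zero (constSection _))
  rw [Fin.sum_univ_four]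
  change (-1 : ℤ) ^ 0 • a (t 1) (t 2) (t 3) (t.monotone h1) (t.monotone h2) +
    (-1 : ℤ) ^ 1 • a (t 0) (t 2) (t 3) (t.monotone (h0.trans h1)) (t.monotone h2) +
    (-1 : ℤ) ^ 2 • a (t 0) (t 1) (t 3) (t.monotone h0) (t.monotone (h1.trans h2)) +
    (-1 : ℤ) ^ 3 • a (t 0) (t 1) (t 2) (t.monotone h0) (t.monotone h1) = 0
  rw [← ha (t 0) (t 1) (t 2) (t 3) (t.monotone h0) (t.monotone h1) (t.monotone h2)]
  have e3 : (-1 : ℤ) ^ 3 = -1 := by norm_num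
  rw [e3]
  simp [sub_eq_add_neg]

end ConstCochain

/-! ## The obstruction cochain -/

namespace TropicalLagrangianMultisection.LocalRep

open PolyhedralCovering ToricDecomposition AbPresheaf

variable {n : ℕ} {B : Type*} [TopologicalSpace B]
  [ChartedSpace (EuclideanSpace ℝ (Fin n)) B] {M : IntegralAffineManifold n B}
  {P : ToricDecomposition M} {L : Type*} [TopologicalSpace L]
  {T : TropicalLagrangianMultisection P L} (R R' : T.LocalRep)

theorem slope_spec {τ σ : T.cells} (h : τ ≤ σ) : R.IsSlope τ σ (R.slope h) :=
  (R.exists_slope h).choose_spec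

variable [T2Space B] [T2Space L]

/-- The difference `m_τ - m'_σ` of slopes along `τ ≤ σ`, at some maximal cell containing `σ`. -/
noncomputable def slopeDiff {τ σ : T.cells} (h : τ ≤ σ) : P.QDual (T.img τ) :=
  R.slope (h.trans (exists_maxCell σ).choose_spec.1) -
    R'.slope (exists_maxCell σ).choose_spec.1 ∘ₗ P.trans (T.img τ) (T.img σ)

theorem slope_sub_eq_slopeDiff {τ σ κ : T.cells} (h : τ ≤ σ) (hκ : σ ≤ κ) (hmax : T.IsMaxCell κ) :
    R.slope (h.trans hκ) - R'.slope hκ ∘ₗ P.trans (T.img τ) (T.img σ) = R.slopeDiff R' h :=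
  slope_sub_eq R R' h hκ (exists_maxCell σ).choose_spec.1 hmax (exists_maxCell σ).choose_spec.2
    (R.slope_spec _) (R.slope_spec _) (R'.slope_spec _) (R'.slope_spec _)

/-- The value of the obstruction cochain on `τ₁ ≤ τ₂ ≤ τ₃`. -/
noncomputable def obsValue (s : P.QSheaf.Cochain P.W 1) (τ₁ τ₂ τ₃ : T.cells) (h₁₂ : τ₁ ≤ τ₂)
    (h₂₃ : τ₂ ≤ τ₃) : CStar :=
  P.pairing (P.edgeValue s (T.img_mono h₁₂)) (R.slopeDiff R h₂₃)

/-- Substituting the cocycle relation for `s_{g₃}` cancels `s_{g₂}(m_{τ₃})`. Moving the transport to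
the other side of the pairing leaves `s_{g₁}` paired with a slope difference, which no longer
involves `κ`. -/
theorem obs_eq {s : P.QSheaf.Cochain P.W 1} (hs : s ∈ P.QSheaf.cocycles P.W 1)
    {τ₁ τ₂ τ₃ κ : T.cells} (h₁₂ : τ₁ ≤ τ₂) (h₂₃ : τ₂ ≤ τ₃) (h : τ₃ ≤ κ) (hκ : T.IsMaxCell κ) :
    R.obs s h₁₂ h₂₃ h = R.obsValue s τ₁ τ₂ τ₃ h₁₂ h₂₃ := by
  rw [obs, obsValue, ← R.slope_sub_eq_slopeDiff R h₂₃ h hκ,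
    edgeValue_cocycle hs (T.img_mono h₁₂) (T.img_mono h₂₃), pairing_add_left, pairing_transC,
    pairing_sub_right]
  abel

/-- The obstruction cochain. -/
noncomputable def obsCochain (s : P.QSheaf.Cochain P.W 1) : (constCStar L).Cochain T.W 2 :=
  triangleCochain T.W (R.obsValue s)

theorem isObsCochain_iff {s : P.QSheaf.Cochain P.W 1} (hs : s ∈ P.QSheaf.cocycles P.W 1)
    {c : (constCStar L).Cochain T.W 2} : R.IsObsCochain s c ↔ c = R.obsCochain s := by
  constructor
  · intro h
    funext t
    obtain ⟨κ, hle, hκ⟩ := exists_maxCell (t 2)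
    rw [h t κ hle hκ, R.obs_eq hs _ _ hle hκ]
    rfl
  · rintro rfl t κ hle hκ
    rw [R.obs_eq hs _ _ hle hκ]
    rfl

/-- All four faces of a simplex can be computed at one maximal cell `κ` above it, where `obs` is the
differential of `(τ, σ) ↦ s_e(m_σ(κ))`. Since `κ` varies with the simplex, this proves closedness
but not exactness. -/
theorem obsCochain_mem_cocycles {s : P.QSheaf.Cochain P.W 1}
    (hs : s ∈ P.QSheaf.cocycles P.W 1) : R.obsCochain s ∈ (constCStar L).cocycles T.W 2 := by
  refine cechD_triangleCochain T.W _ fun τ₀ τ₁ τ₂ τ₃ h₀₁ h₁₂ h₂₃ => ?_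
  obtain ⟨κ, hle, hκ⟩ := exists_maxCell τ₃
  rw [← R.obs_eq hs h₁₂ h₂₃ hle hκ, ← R.obs_eq hs (h₀₁.trans h₁₂) h₂₃ hle hκ,
    ← R.obs_eq hs h₀₁ (h₁₂.trans h₂₃) hle hκ, ← R.obs_eq hs h₀₁ h₁₂ (h₂₃.trans hle) hκ]
  unfold obs
  abel

theorem obsCochain_sub_mem_coboundaries {s : P.QSheaf.Cochain P.W 1}
    (hs : s ∈ P.QSheaf.cocycles P.W 1) :
    R.obsCochain s - R'.obsCochain s ∈ (constCStar L).coboundaries T.W 1 := by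
  -- For the trivial inclusion `σ ≤ σ` the transport is the identity, so this slope difference is
  -- `m_σ - m'_σ`, which is the same at every maximal cell.
  refine ⟨edgeCochain T.W fun τ σ h =>
    P.pairing (P.edgeValue s (T.img_mono h)) (R.slopeDiff R' (le_refl σ)), ?_⟩
  rw [cechD_edgeCochain]
  have key : ∀ (τ₁ τ₂ τ₃ : T.cells) (h₁₂ : τ₁ ≤ τ₂) (h₂₃ : τ₂ ≤ τ₃),
      P.pairing (P.edgeValue s (T.img_mono h₂₃)) (R.slopeDiff R' (le_refl τ₃)) -
        P.pairing (P.edgeValue s (T.img_mono (h₁₂.trans h₂₃))) (R.slopeDiff R' (le_refl τ₃)) +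
        P.pairing (P.edgeValue s (T.img_mono h₁₂)) (R.slopeDiff R' (le_refl τ₂)) =
      R.obsValue s τ₁ τ₂ τ₃ h₁₂ h₂₃ - R'.obsValue s τ₁ τ₂ τ₃ h₁₂ h₂₃ := fun τ₁ τ₂ τ₃ h₁₂ h₂₃ => by
    obtain ⟨κ, hle, hκ⟩ := exists_maxCell τ₃
    rw [← R.obs_eq hs h₁₂ h₂₃ hle hκ, ← R'.obs_eq hs h₁₂ h₂₃ hle hκ,
      ← R.slope_sub_eq_slopeDiff R' le_rfl hle hκ,
      ← R.slope_sub_eq_slopeDiff R' le_rfl (h₂₃.trans hle) hκ, trans_self, trans_self,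
      LinearMap.comp_id, LinearMap.comp_id]
    simp only [pairing_sub_right, obs]
    abel
  funext t
  exact (congrArg (constSection _) (key _ _ _ _ _)).trans (map_sub (constSection _) _ _)

/-- Here `s_e = t_σ - p(t_τ)`. The slope differences satisfy `d(τ₁,τ₃) = d(τ₁,τ₂) + d(τ₂,τ₃) ∘ p`,
so the cochain is the differential of the pairing of `t_τ` with `d(τ,σ)`. -/
theorem obsCochain_cechD_mem_coboundaries (t : P.QSheaf.Cochain P.W 0) :
    R.obsCochain (P.QSheaf.cechD P.W 0 t) ∈ (constCStar L).coboundaries T.W 1 := by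
  refine ⟨edgeCochain T.W fun τ σ h =>
    P.pairing (vertexValue t (T.img τ)) (R.slopeDiff R h), ?_⟩
  rw [cechD_edgeCochain, obsCochain]
  congr 1
  funext τ₁ τ₂ τ₃ h₁₂ h₂₃
  obtain ⟨κ, hle, hκ⟩ := exists_maxCell τ₃
  rw [obsValue, edgeValue_cechD, pairing_sub_left, pairing_transC,
    ← R.slope_sub_eq_slopeDiff R h₁₂ (h₂₃.trans hle) hκ,
    ← R.slope_sub_eq_slopeDiff R h₂₃ hle hκ,
    ← R.slope_sub_eq_slopeDiff R (h₁₂.trans h₂₃) hle hκ, LinearMap.sub_comp,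
    LinearMap.comp_assoc, trans_comp (T.img_mono h₁₂) (T.img_mono h₂₃)]
  simp only [pairing_sub_right]
  abel

theorem obsCochain_add (s s' : P.QSheaf.Cochain P.W 1) :
    R.obsCochain (s + s') = R.obsCochain s + R.obsCochain s' := by
  have h : R.obsValue (s + s') = fun τ₁ τ₂ τ₃ h₁₂ h₂₃ =>
      R.obsValue s τ₁ τ₂ τ₃ h₁₂ h₂₃ + R.obsValue s' τ₁ τ₂ τ₃ h₁₂ h₂₃ := by
    funext τ₁ τ₂ τ₃ h₁₂ h₂₃
    simp only [obsValue, edgeValue_add, pairing_add_left]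
  rw [obsCochain, h]
  funext t
  exact map_add (constSection _) _ _

/-- The obstruction cocycle as a function of `s`. -/
noncomputable def obsCocycle : P.QSheaf.cocycles P.W 1 →+ (constCStar L).cocycles T.W 2 :=
  AddMonoidHom.mk' (fun s => ⟨R.obsCochain s.1, R.obsCochain_mem_cocycles s.2⟩)
    fun s s' => Subtype.ext (R.obsCochain_add s.1 s'.1)

/-- The obstruction homomorphism. -/
noncomputable def obsHom : P.QSheaf.cechH P.W 0 →+ (constCStar L).cechH T.W 1 :=
  QuotientAddGroup.lift _ (((constCStar L).cechClass T.W 1).comp R.obsCocycle) fun s hs => by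
    obtain ⟨t, ht⟩ := AddSubgroup.mem_addSubgroupOf.1 hs
    rw [AddMonoidHom.mem_ker, AddMonoidHom.comp_apply,
      ← map_zero ((constCStar L).cechClass T.W 1)]
    refine cechClass_eq_of_sub_mem _ _ ?_
    change R.obsCochain s.1 - 0 ∈ _
    rw [sub_zero, ← ht]
    exact R.obsCochain_cechD_mem_coboundaries t

/-- The homomorphism is built from `R`, but the cochain may come from any `R'`: this is the
independence of the representatives. -/
theorem obsHom_cechClass (s : P.QSheaf.cocycles P.W 1) {c : (constCStar L).cocycles T.W 2}
    (hc : R'.IsObsCochain s.1 c.1) :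
    R.obsHom (P.QSheaf.cechClass P.W 0 s) = (constCStar L).cechClass T.W 1 c := by
  refine cechClass_eq_of_sub_mem _ _ (c := ⟨R.obsCochain s.1, R.obsCochain_mem_cocycles s.2⟩) ?_
  rw [(R'.isObsCochain_iff s.2).1 hc]
  exact R.obsCochain_sub_mem_coboundaries R' s.2

end TropicalLagrangianMultisection.LocalRep

theorem mainTheorem6 {n : ℕ} {B : Type*} [TopologicalSpace B] [T2Space B] [CompactSpace B]
    [ChartedSpace (EuclideanSpace ℝ (Fin n)) B] {M : IntegralAffineManifold n B}
    (P : ToricDecomposition M) {L : Type*} [TopologicalSpace L] [T2Space L] [ParacompactSpace L]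
    (T : TropicalLagrangianMultisection P L) (R : T.LocalRep) :
    -- the value depends only on the lifts `τ₁' ⊆ τ₂' ⊆ τ₃'`
    (∀ s ∈ P.QSheaf.cocycles P.W 1, ∀ (τ₁ τ₂ τ₃ σ σ' : T.cells) (h₁₂ : τ₁ ≤ τ₂) (h₂₃ : τ₂ ≤ τ₃)
      (h : τ₃ ≤ σ) (h' : τ₃ ≤ σ'), T.IsMaxCell σ → T.IsMaxCell σ' →
      R.obs s h₁₂ h₂₃ h = R.obs s h₁₂ h₂₃ h') ∧
    -- so it defines a 2-cochain on the cover `W'`, and this cochain is closed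
    (∀ s ∈ P.QSheaf.cocycles P.W 1, ∃! c : (constCStar L).Cochain T.W 2, R.IsObsCochain s c) ∧
    (∀ s ∈ P.QSheaf.cocycles P.W 1, ∀ c, R.IsObsCochain s c →
      c ∈ (constCStar L).cocycles T.W 2) ∧
    -- its class does not depend on the local representatives
    (∀ s ∈ P.QSheaf.cocycles P.W 1, ∀ (R' : T.LocalRep) (c c'), R.IsObsCochain s c →
      R'.IsObsCochain s c' → c - c' ∈ (constCStar L).coboundaries T.W 1) ∧
    -- and `[s] ↦ [c]` is a well-defined homomorphism
    ∃! o : P.QSheaf.cechH P.W 0 →+ (constCStar L).cechH T.W 1,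
      ∀ (R' : T.LocalRep) (s : P.QSheaf.cocycles P.W 1) (c : (constCStar L).cocycles T.W 2),
        R'.IsObsCochain s.1 c.1 →
          o (P.QSheaf.cechClass P.W 0 s) = (constCStar L).cechClass T.W 1 c := by

  refine ⟨fun s hs τ₁ τ₂ τ₃ σ σ' h₁₂ h₂₃ h h' hσ hσ' => ?_, fun s hs => ?_, fun s hs c hc => ?_,
    fun s hs R' c c' hc hc' => ?_, R.obsHom, fun R' s c hc => R.obsHom_cechClass R' s hc,
    fun o ho => ?_⟩
  · rw [R.obs_eq hs h₁₂ h₂₃ h hσ, R.obs_eq hs h₁₂ h₂₃ h' hσ']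
  · exact ⟨R.obsCochain s, (R.isObsCochain_iff hs).2 rfl, fun c hc => (R.isObsCochain_iff hs).1 hc⟩
  · rw [(R.isObsCochain_iff hs).1 hc]
    exact R.obsCochain_mem_cocycles hs
  · rw [(R.isObsCochain_iff hs).1 hc, (R'.isObsCochain_iff hs).1 hc']
    exact R.obsCochain_sub_mem_coboundaries R' hs
  -- Uniqueness: every class has a cocycle `s`, and the obstruction cochain of `s` for `R` already
  -- prescribes the value.
  · refine AddMonoidHom.ext fun a => ?_
    obtain ⟨s, rfl⟩ := QuotientAddGroup.mk'_surjective _ a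
    have hc : R.IsObsCochain s.1 (⟨R.obsCochain s.1, R.obsCochain_mem_cocycles s.2⟩ :
        (constCStar L).cocycles T.W 2).1 := (R.isObsCochain_iff s.2).2 rfl
    exact (ho R s _ hc).trans (R.obsHom_cechClass R s hc).symm
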